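/- **Setting.** Let $K$ be a compact Lie group, realised as a closed group of unitary matrices, with Lie algebra $\mathfrak k$, and let $G=K_{\mathbb C}=K\exp(i\mathfrak k)\subseteq GL_m(\mathbb C)$ be its complexification. Let $(Y,\omega)$ be a Kähler manifold with a holomorphic action of $G$ such that $\omega$ is $K$-invariant, and let $\mu_K:Y\to\mathfrak k^*$ be a moment map for the $K$-action: a smooth $K$-equivariant map with $d\mu_K(y)(\xi)\cdot a=\omega_y(a_y,\xi)$ for $a\in\mathfrak k$, where $a_y=\frac{d}{dt}\big|_{t=0}\exp(ta)y$. The sign convention is that $g(v,w)=\omega(iv,w)$ is the Riemannian metric. Extend $\mu_K$ complex-linearly to $\mu_G:Y\to\mathfrak g^*=\mathrm{Hom}_{\mathbb C}(\mathfrak g,\mathbb C)$, where $\mathfrak g=\mathfrak k\oplus i\mathfrak k$. Let $H=U\rtimes R$ be a complex linear algebraic group with unipotent radical $U$ and Levi subgroup $R$. Suppose that $U$ is internally graded by a central one-parameter subgroup $\lambda:\mathbb C^*\to Z(R)$, that is, all weights of the adjoint action of $\lambda(\mathbb C^*)$ on $\mathrm{Lie}(U)$ are positive. Put $\hat U=U\rtimes\lambda(\mathbb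 C^*)$, and let $Q$ be a maximal compact subgroup of $H$ containing $\lambda(S^1)$. Let $\rho:H\to G$ be a homomorphism of algebraic groups with $\rho(Q)\subseteq K$ and $K\cap\rho(\hat U)=\rho(\lambda(S^1))$, and let $X\subseteq Y$ be a connected compact complex submanifold invariant under the action of $H$ through $\rho$. For a character $\chi:H\to\mathbb C^*$ of algebraic groups and $c\in\mathbb R$, define $\mu_H:X\to\mathrm{Lie}(H)^*$ by $\mu_H(x)\cdot a=\mu_G(x)\cdot d\rho(a)+\frac{c}{i}\,d\chi(a)$. Let $\mu_U$ be its restriction to $\mathrm{Lie}(U)$, and let $\mu_{\lambda(S^1)}(x)=\mu_H(x)\cdot d\lambda(i)\in\mathbb R$; the latter is defined by the same formula on $Y$. Let $\omega_{\min}$ be the minimum of $\mu_{\lambda(S^1)}$ on $X$. Let $Z_{\min}(X)$ be the set of $\lambda(\mathbb C^*)$-fixed points of $X$ at which $\mu_{\lambda(S^1)}$ takes its minimal value on $X$, and define $Z_{\min}(Y)$ in the same way with $Y$ in place of $X$. *Semistability coincides with stability for $H$* means that * $Z_{\min}(X)\subseteq Z_{\min}(Y)$; * $\mathrm{Stab}_U(z)=\{1\}$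 for every $z\in Z_{\min}(X)$; * $0$ is a regular value of the moment map $\mu_{R/\lambda(\mathbb C^*)}$ on $Z_{\min}(X)$. Here $\mu_{R/\lambda(\mathbb C^*)}=\mu_H|_{\mathrm{Lie}(Q)}-\xi_0$ for some $\mathrm{Ad}(Q)$-invariant $\xi_0\in\mathrm{Lie}(Q)^*$ with $\xi_0(d\lambda(i))=\omega_{\min}$; it takes values in the space of real functionals on $\mathrm{Lie}(Q)$ that vanish on $d\lambda(i)$. **Proposition.** With the other data fixed, there is $\epsilon>0$ such that the following holds for every $\chi$ and $c$ for which $\omega_{\min}<0\le\omega_{\min}+\epsilon$ (so that the action is well adapted) and semistability coincides with stability for $H$. There is $\delta>0$ such that, writing $S_\delta=\mu_U^{-1}(0)\cap\{x\in X:\mu_{\lambda(S^1)}(x)<\delta\}$ and $W_\delta=US_\delta$: 1. $S_\delta$ is a $Q$-invariant symplectic submanifold of $X$; 2. $W_\delta$ is an open subset of $X$ containing $S_\delta$ as a closed submanifold; 3. $S_\delta$ is a slice for the action of $U$ on $W_\delta$: if $u\in U$, $x\in S_\delta$ and $ux\in S_\delta$, then $u=1$; 4. the inclusion $S_\delta\subseteq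 W_\delta$ induces a homeomorphism $S_\delta\cong W_\delta/U$. -/

import Mathlib

open scoped Manifold ContDiff Topology
open Filter Set

/-! ## Matrix groups and their Lie algebras -/

abbrev CMat (n : ℕ) := Matrix (Fin n) (Fin n) ℂ

abbrev CGL (n : ℕ) := GL (Fin n) ℂ

/-- The matrix exponential, as an invertible matrix. -/
noncomputable def expGL {n : ℕ} (A : CMat n) : CGL n := (Matrix.isUnit_exp A).unit

/-- The Lie algebra of a closed subgroup `S` of `GL_n(ℂ)`: all `A` such that `exp (t A) ∈ S` for
all real `t`. -/
def lieSet {n : ℕ} (S : Subgroup (CGL n)) : Set (CMat n) := {A | ∀ t : ℝ, expGL (t • A) ∈ S}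

theorem lieTrotter {𝔸 : Type*} [NormedRing 𝔸] [NormedAlgebra ℝ 𝔸] [CompleteSpace 𝔸] (A B : 𝔸) :
    Tendsto (fun k : ℕ => (NormedSpace.exp (((k : ℝ)⁻¹) • A) *
      NormedSpace.exp (((k : ℝ)⁻¹) • B)) ^ k) atTop (𝓝 (NormedSpace.exp (A + B))) := by
  let _ : NormedAlgebra ℚ 𝔸 := NormedAlgebra.restrictScalars ℚ ℝ 𝔸
  have hexp : HasStrictFDerivAt (NormedSpace.exp : 𝔸 → 𝔸)
      ((ContinuousLinearEquiv.refl ℝ 𝔸 : 𝔸 ≃L[ℝ] 𝔸) : 𝔸 →L[ℝ] 𝔸) 0 :=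
    hasStrictFDerivAt_exp_zero
  have hA : HasDerivAt (fun t : ℝ => NormedSpace.exp (t • A) * NormedSpace.exp (t • B))
      (A + B) 0 := by
    have h1 := (hasDerivAt_exp_smul_const A (0 : ℝ)).mul (hasDerivAt_exp_smul_const B (0 : ℝ))
    simp only [zero_smul, NormedSpace.exp_zero, one_mul, mul_one] at h1
    exact h1
  set f : ℝ → 𝔸 := fun t => NormedSpace.exp (t • A) * NormedSpace.exp (t • B) with hf
  have hf0 : f 0 = NormedSpace.exp 0 := by simp [hf]
  let g := hexp.localInverse NormedSpace.exp _ 0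
  have hg : HasFDerivAt g ((ContinuousLinearEquiv.refl ℝ 𝔸).symm : 𝔸 →L[ℝ] 𝔸)
      (NormedSpace.exp 0) := hexp.to_localInverse.hasFDerivAt
  have hgf : HasDerivAt (fun t => g (f t)) (A + B) 0 := by
    rw [← hf0] at hg
    exact hg.comp_hasDerivAt (0 : ℝ) hA
  have hgf0 : g (f 0) = 0 := by
    rw [hf0]; exact hexp.localInverse_apply_image
  have hinv : ∀ᶠ t in 𝓝 (0 : ℝ), NormedSpace.exp (g (f t)) = f t := by
    have h := hexp.eventually_right_inverse
    rw [← hf0] at h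
    exact hA.continuousAt.eventually h
  have hk : Tendsto (fun k : ℕ => ((k : ℝ))⁻¹) atTop (𝓝 0) := tendsto_inv_atTop_nhds_zero_nat
  have hk' : Tendsto (fun k : ℕ => ((k : ℝ))⁻¹) atTop (𝓝[≠] 0) := by
    refine tendsto_nhdsWithin_iff.2 ⟨hk, ?_⟩
    filter_upwards [eventually_gt_atTop 0] with k hk0
    simpa using hk0.ne'
  have hlim : Tendsto (fun k : ℕ => (k : ℝ) • g (f ((k : ℝ)⁻¹))) atTop (𝓝 (A + B)) := by
    have h := (hasDerivAt_iff_tendsto_slope.1 hgf).comp hk'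
    refine h.congr fun k => ?_
    simp [slope_def_module, hgf0]
  have hcont : Continuous (NormedSpace.exp : 𝔸 → 𝔸) := NormedSpace.exp_continuous
  refine ((hcont.tendsto _).comp hlim).congr' ?_
  filter_upwards [hk.eventually hinv] with k hk1
  have : (k : ℝ) • g (f ((k : ℝ)⁻¹)) = k • g (f ((k : ℝ)⁻¹)) := Nat.cast_smul_eq_nsmul ℝ _ _
  simp only [Function.comp, this]
  rw [NormedSpace.exp_nsmul, hk1]

theorem isInducing_unitsVal (𝔸 : Type*) [NormedRing 𝔸] [NormedAlgebra ℝ 𝔸] [CompleteSpace 𝔸] :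
    Topology.IsInducing (Units.val : 𝔸ˣ → 𝔸) :=
  Units.isOpenEmbedding_val.isInducing

theorem expGL_trotter {n : ℕ} (A B : CMat n) :
    Tendsto (fun k : ℕ => (expGL (((k : ℝ)⁻¹) • A) * expGL (((k : ℝ)⁻¹) • B)) ^ k) atTop
      (𝓝 (expGL (A + B))) := by
  have key : Tendsto (fun k : ℕ => (NormedSpace.exp (((k : ℝ)⁻¹) • A) *
      NormedSpace.exp (((k : ℝ)⁻¹) • B)) ^ k) atTop (𝓝 (NormedSpace.exp (A + B))) := by
    let _ : SeminormedRing (CMat n) := Matrix.linftyOpSemiNormedRing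
    let _ : NormedRing (CMat n) := Matrix.linftyOpNormedRing
    let _ : NormedAlgebra ℝ (CMat n) := Matrix.linftyOpNormedAlgebra
    exact lieTrotter A B
  have hemb : Topology.IsInducing (Units.val : CGL n → CMat n) := by
    let _ : SeminormedRing (CMat n) := Matrix.linftyOpSemiNormedRing
    let _ : NormedRing (CMat n) := Matrix.linftyOpNormedRing
    let _ : NormedAlgebra ℝ (CMat n) := Matrix.linftyOpNormedAlgebra
    exact isInducing_unitsVal (CMat n)
  rw [hemb.tendsto_nhds_iff]
  exact key

theorem expGL_zero {n : ℕ} : expGL (0 : CMat n) = 1 := by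
  apply Units.ext
  simp [expGL]

/-- The Lie algebra of a closed subgroup of `GL_n(ℂ)` is a real vector space. -/
noncomputable def lieAlgebra {n : ℕ} (S : Subgroup (CGL n)) (hS : IsClosed (S : Set (CGL n))) :
    Submodule ℝ (CMat n) where
  carrier := lieSet S
  zero_mem' := fun t => by
    rw [smul_zero, expGL_zero]; exact S.one_mem
  add_mem' := fun {A B} hA hB t => by
    rw [smul_add]
    refine hS.mem_of_tendsto (expGL_trotter (t • A) (t • B)) (Eventually.of_forall fun k => ?_)
    refine S.pow_mem (S.mul_mem ?_ ?_) k
    · rw [smul_smul]; exact hA _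
    · rw [smul_smul]; exact hB _
  smul_mem' := fun c A hA t => by
    rw [smul_smul]; exact hA _

open Classical in
/-- `g` as an element of the subgroup `S` that contains it (used only when `g ∈ S`). -/
noncomputable def toSub {n : ℕ} (S : Subgroup (CGL n)) (g : CGL n) : S :=
  if h : g ∈ S then ⟨g, h⟩ else 1

/-- The skew-Hermitian part of a matrix; `a = skewPart a + i skewPart (-i a)`. -/
noncomputable def skewPart {n : ℕ} (a : CMat n) : CMat n :=
  (1 / 2 : ℂ) • (a - a.conjTranspose)

/-- `G ⊆ GL_m(ℂ)` is the complexification of the compact group `K` of unitary matrices: `G` has the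
polar decomposition `G = K exp (i 𝔨)`. Every complex reductive Lie group with a chosen maximal
compact subgroup is of this form, up to isomorphism. -/
structure IsComplexification {m : ℕ} (K G : Subgroup (CGL m)) : Prop where
  compact : IsCompact (K : Set (CGL m))
  unitary : ∀ k ∈ K, (k : CMat m) ∈ Matrix.unitaryGroup (Fin m) ℂ
  polar : ∀ g : CGL m, g ∈ G ↔ ∃ k ∈ K, ∃ A ∈ lieSet K, g = k * expGL (Complex.I • A)

/-! ## Linear algebraic groups -/

/-- Zariski closed subsets of `GL_n(ℂ)`. -/
def IsZariskiClosed {n : ℕ} (S : Set (CGL n)) : Prop :=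
  ∃ I : Set (MvPolynomial (Fin n × Fin n) ℂ), ∀ g : CGL n, g ∈ S ↔
    ∀ p ∈ I, MvPolynomial.eval (fun ij => (g : CMat n) ij.1 ij.2) p = 0

/-- Regular functions on a linear algebraic group: polynomials in the matrix entries of `g` and of
`g⁻¹`. -/
def IsRegularFun {n : ℕ} {H : Subgroup (CGL n)} (f : H → ℂ) : Prop :=
  ∃ P : MvPolynomial ((Fin n × Fin n) ⊕ (Fin n × Fin n)) ℂ, ∀ h : H,
    f h = MvPolynomial.eval (Sum.elim (fun ij => ((h : CGL n) : CMat n) ij.1 ij.2)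
      (fun ij => (((h : CGL n)⁻¹ : CGL n) : CMat n) ij.1 ij.2)) P

/-- `V` is a Zariski closed normal subgroup of `H` consisting of unipotent matrices. (In
characteristic zero such a group is automatically connected.) -/
structure IsNormalUnipotent {n : ℕ} (H V : Subgroup (CGL n)) : Prop where
  le : V ≤ H
  closed : IsZariskiClosed (V : Set (CGL n))
  normal : ∀ h ∈ H, ∀ v ∈ V, h * v * h⁻¹ ∈ V
  unipotent : ∀ v ∈ V, IsNilpotent ((v : CMat n) - 1)

/-- A linear algebraic group `H = U ⋊ R` over `ℂ` with unipotent radical `U`, Levi subgroup `R`,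
maximal compact subgroup `Q`, and a central one-parameter subgroup `lam : ℂˣ → Z(R)` grading `U`,
with `lam (S¹) ⊆ Q`. -/
structure InternallyGradedGroup (n : ℕ) where
  H : Subgroup (CGL n)
  H_closed : IsZariskiClosed (H : Set (CGL n))
  U : Subgroup (CGL n)
  U_unipotent : IsNormalUnipotent H U
  U_maximal : ∀ V : Subgroup (CGL n), IsNormalUnipotent H V → V ≤ U
  R : Subgroup (CGL n)
  R_le : R ≤ H
  R_closed : IsZariskiClosed (R : Set (CGL n))
  R_inf_U : U ⊓ R = ⊥
  U_mul_R : ∀ h ∈ H, ∃ u ∈ U, ∃ r ∈ R, h = u * r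
  lam : ℂˣ →* H
  /-- The matrix entries of `lam t` are Laurent polynomials in `t`. -/
  lam_regular : ∀ i j, ∃ P : MvPolynomial (Fin 2) ℂ, ∀ t : ℂˣ,
    ((lam t : CGL n) : CMat n) i j = MvPolynomial.eval ![(t : ℂ), ((t⁻¹ : ℂˣ) : ℂ)] P
  lam_mem : ∀ t, (lam t : CGL n) ∈ R
  lam_central : ∀ t, ∀ r ∈ R, (lam t : CGL n) * r = r * (lam t : CGL n)
  /-- All weights of the adjoint action of `ℂˣ` on the Lie algebra of `U` are positive. -/
  weights_pos : ∀ (k : ℤ), ∀ b ∈ lieSet U, b ≠ 0 →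
    (∀ t : ℂˣ, ((lam t : CGL n) : CMat n) * b * (((lam t : CGL n)⁻¹ : CGL n) : CMat n) =
      ((t : ℂ) ^ k) • b) → 0 < k
  Q : Subgroup (CGL n)
  Q_le : Q ≤ H
  Q_compact : IsCompact (Q : Set (CGL n))
  Q_maximal : ∀ Q' : Subgroup (CGL n), Q' ≤ H → IsCompact (Q' : Set (CGL n)) → Q ≤ Q' → Q' = Q
  lam_circle : ∀ t : ℂˣ, ‖(t : ℂ)‖ = 1 → (lam t : CGL n) ∈ Q

/-- The generator of the Lie algebra of `lam (S¹)`, namely the derivative at `θ = 0` of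
`θ ↦ lam (exp (i θ))`. -/
noncomputable def InternallyGradedGroup.circleGen {n : ℕ} (𝓗 : InternallyGradedGroup n) : CMat n :=
  Matrix.of fun i j => deriv (fun θ : ℝ =>
    ((𝓗.lam (Units.mk0 (Complex.exp (θ * Complex.I)) (Complex.exp_ne_zero _)) : CGL n) : CMat n)
      i j) 0

/-! ## Submanifolds

A complex manifold modelled on `E` is regarded as a real manifold through the same charts, with
model `𝓘(ℝ, E)`. The tangent space at a point is `E` (through the preferred chart at the point, as
always in Mathlib), and its complex structure is multiplication by `i` on `E`. -/

section Submanifolds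

variable {E : Type*} [NormedAddCommGroup E] [NormedSpace ℂ E]
  {M : Type*} [TopologicalSpace M] [ChartedSpace E M]

/-- Smooth embedded real submanifolds: locally, in a smooth real chart, `S` is a linear
subspace. -/
def IsEmbeddedSubmanifold (E : Type*) [NormedAddCommGroup E] [NormedSpace ℂ E]
    {M : Type*} [TopologicalSpace M] [ChartedSpace E M] (S : Set M) : Prop :=
  ∀ x ∈ S, ∃ φ ∈ IsManifold.maximalAtlas 𝓘(ℝ, E) ∞ M, x ∈ φ.source ∧
    ∃ V : Submodule ℝ E, ∀ y ∈ φ.source, y ∈ S ↔ φ y ∈ V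

/-- The tangent vectors at `x` to a subset `S`: velocities of curves in `S`. -/
def tangentVectors (E : Type*) [NormedAddCommGroup E] [NormedSpace ℂ E]
    {M : Type*} [TopologicalSpace M] [ChartedSpace E M] (S : Set M) (x : M) : Set E :=
  {v | ∃ γ : ℝ → M, γ 0 = x ∧ (∀ t, γ t ∈ S) ∧ MDifferentiableAt 𝓘(ℝ, ℝ) 𝓘(ℝ, E) γ 0 ∧
    (mfderiv 𝓘(ℝ, ℝ) 𝓘(ℝ, E) γ 0 : ℝ →L[ℝ] E) 1 = v}

/-- The derivative of a map between complex manifolds, as a map of real tangent spaces. -/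
noncomputable def realDeriv {E' : Type*} [NormedAddCommGroup E'] [NormedSpace ℂ E']
    {M' : Type*} [TopologicalSpace M'] [ChartedSpace E' M'] (f : M → M') (x : M) : E →L[ℝ] E' :=
  (mfderiv 𝓘(ℝ, E) 𝓘(ℝ, E') f x : E →L[ℝ] E')

/-- A real two-form in a chart `φ`: its pull-back under `φ⁻¹`. -/
noncomputable def formInChart (form : M → E [⋀^Fin 2]→L[ℝ] ℝ) (φ : OpenPartialHomeomorph M E) :
    E → E [⋀^Fin 2]→L[ℝ] ℝ := fun e =>
  (form (φ.symm e)).compContinuousLinearMap (realDeriv (φ.symm : E → M) e)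

/-- A Kähler form on a complex manifold: a smooth closed real two-form of type `(1,1)` for which
`g(v, w) = form (i v, w)` is a Riemannian metric. (If `η` is the Hermitian metric with real part
`g` which is conjugate-linear in the first variable, then `form = - Im η`.) -/
structure IsKahlerForm (form : M → E [⋀^Fin 2]→L[ℝ] ℝ) : Prop where
  smooth : ∀ x : M, ContDiffOn ℝ ∞ (formInChart form (chartAt E x)) (chartAt E x).target
  closed : ∀ x : M, ∀ e ∈ (chartAt E x).target,
    extDeriv (formInChart form (chartAt E x)) e = 0
  type_one_one : ∀ (x : M) (v w : E), form x ![Complex.I • v, Complex.I • w] = form x ![v, w]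
  positive : ∀ (x : M) (v : E), v ≠ 0 → 0 < form x ![Complex.I • v, v]

/-- A symplectic submanifold: an embedded submanifold to whose tangent spaces the two-form
restricts nondegenerately. -/
def IsSymplecticSubmanifold (form : M → E [⋀^Fin 2]→L[ℝ] ℝ) (S : Set M) : Prop :=
  IsEmbeddedSubmanifold E S ∧ ∀ x ∈ S, ∀ v ∈ tangentVectors E S x, v ≠ 0 →
    ∃ w ∈ tangentVectors E S x, form x ![v, w] ≠ 0

end Submanifolds

/-! ## Hamiltonian actions -/

/-- A Kähler manifold `Y` with a holomorphic action of a complex reductive group `G = K_ℂ`, whose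
Kähler form is `K`-invariant, and with a moment map for the action of `K`. -/
structure HamiltonianReductiveAction (m : ℕ) (E : Type*) [NormedAddCommGroup E] [NormedSpace ℂ E]
    (Y : Type*) [TopologicalSpace Y] [ChartedSpace E Y] where
  G : Subgroup (CGL m)
  K : Subgroup (CGL m)
  complexification : IsComplexification K G
  form : Y → E [⋀^Fin 2]→L[ℝ] ℝ
  kahler : IsKahlerForm form
  act : G →* Equiv.Perm Y
  /-- `G × Y → Y` is holomorphic: locally it extends holomorphically to an open subset of
  `M_m(ℂ) × Y`. -/
  act_holomorphic : ∀ (g : G) (y : Y), ∃ F : (Fin m → Fin m → ℂ) × Y → Y,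
    ContMDiffAt (𝓘(ℂ, Fin m → Fin m → ℂ).prod 𝓘(ℂ, E)) 𝓘(ℂ, E) ω F
      (fun i j => ((g : CGL m) : CMat m) i j, y) ∧
    ∀ᶠ q : G × Y in 𝓝 (g, y), F (fun i j => ((q.1 : CGL m) : CMat m) i j, q.2) = act q.1 q.2
  form_invariant : ∀ k : G, (k : CGL m) ∈ K → ∀ (y : Y) (v w : E),
    form (act k y) ![realDeriv (act k) y v, realDeriv (act k) y w] = form y ![v, w]
  /-- The moment map `Y → 𝔨*`. -/
  mu : Y → Module.Dual ℝ (lieAlgebra K complexification.compact.isClosed)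
  mu_smooth : ∀ a, ContMDiff 𝓘(ℝ, E) 𝓘(ℝ, ℝ) ∞ (fun y => mu y a)
  /-- `dμ_y(ξ)(a) = form_y (a_y, ξ)`, where `a_y` is the derivative at `0` of
  `t ↦ exp (t a) y`. -/
  mu_deriv : ∀ (a : lieAlgebra K complexification.compact.isClosed) (y : Y) (ξ : E),
    (mfderiv 𝓘(ℝ, E) 𝓘(ℝ, ℝ) (fun y' => mu y' a) y : E →L[ℝ] ℝ) ξ =
      form y ![(mfderiv 𝓘(ℝ, ℝ) 𝓘(ℝ, E)
        (fun t : ℝ => act (toSub G (expGL (t • (a : CMat m)))) y) 0 : ℝ →L[ℝ] E) 1, ξ]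
  /-- `μ` is `K`-equivariant for the coadjoint action. -/
  mu_equivariant : ∀ k : G, (k : CGL m) ∈ K → ∀ (y : Y)
    (a b : lieAlgebra K complexification.compact.isClosed),
    (b : CMat m) = ((k : CGL m) : CMat m) * (a : CMat m) * (((k : CGL m)⁻¹ : CGL m) : CMat m) →
    mu (act k y) b = mu y a

namespace HamiltonianReductiveAction

variable {m : ℕ} {E : Type*} [NormedAddCommGroup E] [NormedSpace ℂ E]
  {Y : Type*} [TopologicalSpace Y] [ChartedSpace E Y]

open Classical in
/-- `μ(y)(a)` for `a ∈ 𝔨` (and `0` for other matrices, which are never used). -/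
noncomputable def muK (𝓨 : HamiltonianReductiveAction m E Y) (y : Y) (a : CMat m) : ℝ :=
  if h : a ∈ lieAlgebra 𝓨.K 𝓨.complexification.compact.isClosed then 𝓨.mu y ⟨a, h⟩ else 0

/-- The complex-linear extension of `μ(y)` to `𝔤 = 𝔨 ⊕ i 𝔨`: for `a = a₁ + i a₂` with
`a₁, a₂ ∈ 𝔨` it takes the value `μ(y)(a₁) + i μ(y)(a₂)`. -/
noncomputable def muG (𝓨 : HamiltonianReductiveAction m E Y) (y : Y) (a : CMat m) : ℂ :=
  𝓨.muK y (skewPart a) + Complex.I * 𝓨.muK y (skewPart (-Complex.I • a))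

end HamiltonianReductiveAction

/-- The data of a Hamiltonian action of `H` on `X`: a Kähler manifold `Y` with a Hamiltonian action
of `G = K_ℂ`, a homomorphism `ρ : H → G` of algebraic groups with `ρ(Q) ⊆ K`, and an `H`-invariant
complex submanifold `X` of `Y`. (The moment map for `H` depends in addition on a character.) -/
structure HamiltonianHAction (n m : ℕ)
    (EY : Type*) [NormedAddCommGroup EY] [NormedSpace ℂ EY]
    (Y : Type*) [TopologicalSpace Y] [ChartedSpace EY Y]
    (EX : Type*) [NormedAddCommGroup EX] [NormedSpace ℂ EX]
    (X : Type*) [TopologicalSpace X] [ChartedSpace EX X] where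
  grp : InternallyGradedGroup n
  amb : HamiltonianReductiveAction m EY Y
  rho : grp.H →* amb.G
  rho_regular : ∀ i j, IsRegularFun (fun h : grp.H => ((rho h : CGL m) : CMat m) i j)
  rho_Q : ∀ q : grp.H, (q : CGL n) ∈ grp.Q → (rho q : CGL m) ∈ amb.K
  /-- `K ∩ ρ(U ⋊ lam (ℂˣ)) = ρ(lam (S¹))`. -/
  rho_inter : ∀ u : grp.H, (u : CGL n) ∈ grp.U → ∀ t : ℂˣ,
    (rho (u * grp.lam t) : CGL m) ∈ amb.K →
    ∃ s : ℂˣ, ‖(s : ℂ)‖ = 1 ∧ rho (u * grp.lam t) = rho (grp.lam s)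
  /-- The inclusion of the complex submanifold `X` in `Y`. -/
  incl : X → Y
  incl_embedding : Manifold.IsSmoothEmbedding 𝓘(ℂ, EX) 𝓘(ℂ, EY) ω incl
  /-- The induced action of `H` on `X`. -/
  act : grp.H →* Equiv.Perm X
  act_incl : ∀ (h : grp.H) (x : X), incl (act h x) = amb.act (rho h) (incl x)

namespace HamiltonianHAction

variable {n m : ℕ}
  {EY : Type*} [NormedAddCommGroup EY] [NormedSpace ℂ EY]
  {Y : Type*} [TopologicalSpace Y] [ChartedSpace EY Y]
  {EX : Type*} [NormedAddCommGroup EX] [NormedSpace ℂ EX]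
  {X : Type*} [TopologicalSpace X] [ChartedSpace EX X]
  (D : HamiltonianHAction n m EY Y EX X)

/-- The restriction of the Kähler form to `X`. -/
noncomputable def formX (x : X) : EX [⋀^Fin 2]→L[ℝ] ℝ :=
  (D.amb.form (D.incl x)).compContinuousLinearMap (realDeriv D.incl x)

/-- The derivative of `ρ` at the identity, on the Lie algebra of `H`. -/
noncomputable def dRho (A : CMat n) : CMat m :=
  Matrix.of fun i j =>
    deriv (fun t : ℝ => ((D.rho (toSub D.grp.H (expGL (t • A))) : CGL m) : CMat m) i j) 0

/-- The derivative of a character `χ` of `H` at the identity, on the Lie algebra of `H`. -/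
noncomputable def dChar (χ : D.grp.H →* ℂˣ) (A : CMat n) : ℂ :=
  deriv (fun t : ℝ => (χ (toSub D.grp.H (expGL (t • A))) : ℂ)) 0

/-- The pairing with `A ∈ Lie H` of the moment map for `H`, at a point of `Y`: the sum of the
restriction of `μ_G` along `ρ` and of the real multiple `c` of the character `χ`. As the derivative
of a character is imaginary on the Lie algebra of a compact group, it is divided by `i`. -/
noncomputable def muHY (χ : D.grp.H →* ℂˣ) (c : ℝ) (y : Y) (A : CMat n) : ℂ :=
  D.amb.muG y (D.dRho A) + (c / Complex.I) * D.dChar χ A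

/-- The pairing with `A ∈ Lie H` of the moment map `μ_H : X → (Lie H)*`. -/
noncomputable def muH (χ : D.grp.H →* ℂˣ) (c : ℝ) (x : X) (A : CMat n) : ℂ :=
  D.muHY χ c (D.incl x) A

/-- The moment map of the circle `lam (S¹)` on `Y`. -/
noncomputable def muLamY (χ : D.grp.H →* ℂˣ) (c : ℝ) (y : Y) : ℝ :=
  (D.muHY χ c y D.grp.circleGen).re

/-- The moment map of the circle `lam (S¹)` on `X`. -/
noncomputable def muLam (χ : D.grp.H →* ℂˣ) (c : ℝ) (x : X) : ℝ :=
  D.muLamY χ c (D.incl x)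

/-- The zero set in `X` of `μ_U : X → (Lie U)*`, the restriction of `μ_H` to `Lie U`. -/
def muUZero (χ : D.grp.H →* ℂˣ) (c : ℝ) : Set X :=
  {x | ∀ A ∈ lieSet D.grp.U, D.muH χ c x A = 0}

/-- `Z_min(Y)`: fixed points of `lam (ℂˣ)` at which the moment map of the circle takes its minimal
value on `Y`. -/
def ZminY (χ : D.grp.H →* ℂˣ) (c : ℝ) : Set Y :=
  {y | (∀ t : ℂˣ, D.amb.act (D.rho (D.grp.lam t)) y = y) ∧
    ∀ y' : Y, D.muLamY χ c y ≤ D.muLamY χ c y'}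

/-- `Z_min(X)`: fixed points of `lam (ℂˣ)` at which the moment map of the circle takes its minimal
value on `X`. -/
def Zmin (χ : D.grp.H →* ℂˣ) (c : ℝ) : Set X :=
  {x | (∀ t : ℂˣ, D.act (D.grp.lam t) x = x) ∧ ∀ x' : X, D.muLam χ c x ≤ D.muLam χ c x'}

/-- The action is well adapted with parameter `ε`: the minimal value `w` of the moment map of the
circle on `X` satisfies `w < 0 ≤ w + ε`. -/
def IsWellAdapted (χ : D.grp.H →* ℂˣ) (c ε : ℝ) : Prop :=
  ∃ w : ℝ, IsLeast (range (D.muLam χ c)) w ∧ w < 0 ∧ 0 ≤ w + ε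

/-- Semistability coincides with stability for the action of `U`. -/
def SemistableEqStableU (χ : D.grp.H →* ℂˣ) (c : ℝ) : Prop :=
  (∀ z ∈ D.Zmin χ c, D.incl z ∈ D.ZminY χ c) ∧
  ∀ z ∈ D.Zmin χ c, ∀ u : D.grp.H, (u : CGL n) ∈ D.grp.U → D.act u z = z → u = 1

/-- `0` is a regular value of the moment map of `R / lam (ℂˣ)` on `Z_min(X)`. This moment map is the
restriction to `Lie R` of `μ_H`, whose values lie in the real dual of `Lie Q`, minus an invariant
functional `ξ₀` on `Lie Q` whose value on the generator of `lam (S¹)` is the minimal value of the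
moment map of the circle; it takes values in the functionals that vanish on this generator. -/
def ZeroIsRegularValue (χ : D.grp.H →* ℂˣ) (c : ℝ)
    (ξ₀ : Module.Dual ℝ (lieAlgebra D.grp.Q D.grp.Q_compact.isClosed)) : Prop :=
  (∀ q ∈ D.grp.Q, ∀ a b : lieAlgebra D.grp.Q D.grp.Q_compact.isClosed,
    (b : CMat n) = (q : CMat n) * (a : CMat n) * ((q⁻¹ : CGL n) : CMat n) → ξ₀ b = ξ₀ a) ∧
  (∀ a : lieAlgebra D.grp.Q D.grp.Q_compact.isClosed, (a : CMat n) = D.grp.circleGen →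
    IsLeast (range (D.muLam χ c)) (ξ₀ a)) ∧
  ∀ z ∈ D.Zmin χ c,
    (∀ a : lieAlgebra D.grp.Q D.grp.Q_compact.isClosed, (D.muH χ c z a).re = ξ₀ a) →
    ∀ l : Module.Dual ℝ (lieAlgebra D.grp.Q D.grp.Q_compact.isClosed),
      (∀ a : lieAlgebra D.grp.Q D.grp.Q_compact.isClosed,
        (a : CMat n) = D.grp.circleGen → l a = 0) →
      ∃ v ∈ tangentVectors EX (D.Zmin χ c) z,
        ∀ a : lieAlgebra D.grp.Q D.grp.Q_compact.isClosed,
          (mfderiv 𝓘(ℝ, EX) 𝓘(ℝ, ℝ) (fun x => (D.muH χ c x a).re) z : EX →L[ℝ] ℝ) v = l a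

/-- Semistability coincides with stability for the action of `H`. -/
def SemistableEqStable (χ : D.grp.H →* ℂˣ) (c : ℝ) : Prop :=
  D.SemistableEqStableU χ c ∧
  ∃ ξ₀ : Module.Dual ℝ (lieAlgebra D.grp.Q D.grp.Q_compact.isClosed), D.ZeroIsRegularValue χ c ξ₀

/-- The set `μ_U⁻¹(0) ∩ {μ_{lam (S¹)} < δ}`. -/
def slice (χ : D.grp.H →* ℂˣ) (c δ : ℝ) : Set X :=
  D.muUZero χ c ∩ {x | D.muLam χ c x < δ}

/-- The `U`-sweep of a subset of `X`. -/
def sweep (S : Set X) : Set X :=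
  {y | ∃ u : D.grp.H, (u : CGL n) ∈ D.grp.U ∧ ∃ x ∈ S, D.act u x = y}

theorem subset_sweep (S : Set X) : S ⊆ D.sweep S :=
  fun x hx => ⟨1, D.grp.U.one_mem, x, hx, by simp⟩

/-- The equivalence relation on a subset of `X` of lying in the same `U`-orbit. -/
def orbitSetoid (W : Set X) : Setoid W where
  r x y := ∃ u : D.grp.H, (u : CGL n) ∈ D.grp.U ∧ D.act u x = y
  iseqv :=
    { refl := fun x => ⟨1, D.grp.U.one_mem, by simp⟩
      symm := by
        rintro x y ⟨u, hu, h⟩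
        refine ⟨u⁻¹, D.grp.U.inv_mem hu, ?_⟩
        rw [← h, ← Equiv.Perm.mul_apply, ← map_mul, inv_mul_cancel, map_one, Equiv.Perm.one_apply]
      trans := by
        rintro x y z ⟨u, hu, h⟩ ⟨v, hv, h'⟩
        refine ⟨v * u, D.grp.U.mul_mem hv hu, ?_⟩
        rw [map_mul, Equiv.Perm.mul_apply, h, h'] }

/-- The map `S → W / U` induced by the inclusion of `S` in its sweep `W`; the target carries the
quotient topology. -/
def sliceToQuotient (S : Set X) : S → Quotient (D.orbitSetoid (D.sweep S)) :=
  fun x => Quotient.mk _ ⟨x, D.subset_sweep S x.2⟩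

end HamiltonianHAction

/-!
The zero set of the moment map of `U` is controlled by its behaviour at the points of `X` where the
moment map of the circle `lam (S¹)` is minimal; a compactness argument then spreads the conclusions
to a neighbourhood of the minimum. The character changes the moment map of the circle by a constant
and, as characters are trivial on unipotent groups, does not change that of `U`. So everything is
expressed through the function `height`, which does not involve the character, and its minimum
`base` on `X`.

The function `height` increases along the flow of `lam t` for `t > 0`, and its minima along such a
flow are fixed points. By assumption the points `z` of `base` are minima of `height` on all of `Y`.
The adjoint of `Lie (ρ U)` has negative weights, so `lam t` contracts the orbits of the
corresponding one-parameter groups through `z` for `t → ∞`; these orbits therefore lie in the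
minimum and are constant (`vel_conjTranspose_eq_zero`). Hence the skew-Hermitian part of
`a ∈ Lie (ρ U)` acts at `z` as `a / 2`, and the derivative at `z` of the moment map of `U` is, up to
the factor `2`, the pairing `ξ ↦ ω (a z, ξ)`. As `U` acts freely on `base`, this has three
consequences.

* The derivative is an isomorphism on the tangent space of the orbit of `U`, so by the inverse
  function theorem small elements of `U` do not map zeros of the moment map to zeros, and all points
  near a zero can be moved to zeros by small elements of `U` (`exists_locally_free`,
  `eventually_locally_transversal`).
* The moment map is a submersion at `z`, so its zero set is a submanifold near `z`.
* The kernel of the derivative is a complex subspace, so the Kähler form is nondegenerate on it; this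
  persists near `z` (`eventually_symplectic_zerosBelow`).

Large elements of `U` are excluded by a properness statement (`exists_level_norm_lt`): an element
which moves a point of small height to a point of small height can be conjugated by `lam t` with
`t < 1`, which decreases heights, to an element of a prescribed norm, and there are none of these by
compactness, because `lam t` for `t → 0` contracts the orbits of `U` and fixes `base`, so that an
orbit of `U` meets `base` at most once.

On the algebraic side this uses that unipotent groups are exponentials of their Lie algebras, that
the weights of `lam` on `Lie U` being positive makes the adjoint action of `lam t` on it a
polynomial in `t` without constant term (`InternallyGradedGroup.exists_adLam_eq_sum`), that `Q`
commutes with `lam (S¹)`, and that the Lie algebra of a complexification is closed under adjoints.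
-/


/-! ### One-parameter groups of matrices -/

section OneParameter

/-- A one-parameter group in a Banach algebra which is differentiable at `0` is an exponential. -/
theorem eq_exp_of_hasDerivAt_zero {𝕜 : Type*} [RCLike 𝕜] {𝔸 : Type*} [NormedRing 𝔸]
    [NormedAlgebra 𝕜 𝔸] [CompleteSpace 𝔸] {p : 𝕜 → 𝔸} {A : 𝔸} (h0 : p 0 = 1)
    (hadd : ∀ s t, p (s + t) = p s * p t) (hd : HasDerivAt p A 0) (t : 𝕜) :
    p t = NormedSpace.exp (t • A) := by
  let _ : NormedAlgebra ℚ 𝔸 := NormedAlgebra.restrictScalars ℚ 𝕜 𝔸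
  have hp : ∀ t, HasDerivAt p (p t * A) t := fun t => by
    have h1 : HasDerivAt (fun s => p t * p (s - t)) (p t * A) t := by
      have : HasDerivAt (fun s => p (s - t)) A t := by
        have h2 : HasDerivAt p A (t - t) := by simpa using hd
        simpa using h2.comp_sub_const t t
      exact this.const_mul (p t)
    refine h1.congr_of_eventuallyEq (Eventually.of_forall fun s => ?_)
    simp only
    rw [← hadd]; congr 1; ring
  have he : ∀ t : 𝕜, HasDerivAt (fun s : 𝕜 => NormedSpace.exp (s • (-A)))
      (-A * NormedSpace.exp (t • (-A))) t := fun t => hasDerivAt_exp_smul_const' (-A) t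
  have hz : ∀ t, HasDerivAt (fun s => p s * NormedSpace.exp (s • (-A))) 0 t := fun t => by
    have h := (hp t).mul (he t)
    have h' : p t * A * NormedSpace.exp (t • (-A)) + p t * (-A * NormedSpace.exp (t • (-A))) = 0 := by
      noncomm_ring
    rwa [h'] at h
  have hc : p t * NormedSpace.exp (t • (-A)) = p 0 * NormedSpace.exp ((0 : 𝕜) • (-A)) :=
    is_const_of_deriv_eq_zero (fun t => (hz t).differentiableAt) (fun t => (hz t).deriv) t 0
  rw [h0, zero_smul, NormedSpace.exp_zero, one_mul] at hc
  have hi : NormedSpace.exp (t • (-A)) * NormedSpace.exp (t • A) = 1 := by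
    rw [← NormedSpace.exp_add_of_commute]
    · simp
    · exact ((Commute.refl A).neg_left.smul_left t).smul_right t
  calc p t = p t * (NormedSpace.exp (t • (-A)) * NormedSpace.exp (t • A)) := by rw [hi, mul_one]
    _ = NormedSpace.exp (t • A) := by rw [← mul_assoc, hc, one_mul]

variable {n : ℕ}

/-- A one-parameter group of matrices whose entries are differentiable at `0` is an exponential. -/
theorem matrix_eq_exp_of_hasDerivAt_zero {𝕜 : Type*} [RCLike 𝕜] [NormedAlgebra 𝕜 ℂ]
    {p : 𝕜 → CMat n} {A : CMat n} (h0 : p 0 = 1)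
    (hadd : ∀ s t, p (s + t) = p s * p t) (hd : ∀ i j, HasDerivAt (fun t => p t i j) (A i j) 0)
    (t : 𝕜) : p t = NormedSpace.exp (t • A) := by
  let _ : SeminormedRing (CMat n) := Matrix.linftyOpSemiNormedRing
  let _ : NormedRing (CMat n) := Matrix.linftyOpNormedRing
  have : @CompleteSpace (CMat n) PseudoMetricSpace.toUniformSpace :=
    inferInstanceAs (CompleteSpace (Fin n → Fin n → ℂ))
  let _ : NormedAlgebra 𝕜 (CMat n) := Matrix.linftyOpNormedAlgebra
  refine eq_exp_of_hasDerivAt_zero h0 hadd ?_ t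
  have h1 : HasDerivAt (fun t => fun i j => p t i j) (fun i j => A i j) 0 :=
    hasDerivAt_pi.2 fun i => hasDerivAt_pi.2 fun j => hd i j
  exact h1

theorem hasDerivAt_matrix_exp_smul {𝕜 : Type*} [RCLike 𝕜] [NormedAlgebra 𝕜 ℂ] (A : CMat n)
    (i j : Fin n) : HasDerivAt (fun t : 𝕜 => NormedSpace.exp (t • A) i j) (A i j) 0 := by
  let _ : SeminormedRing (CMat n) := Matrix.linftyOpSemiNormedRing
  let _ : NormedRing (CMat n) := Matrix.linftyOpNormedRing
  have : @CompleteSpace (CMat n) PseudoMetricSpace.toUniformSpace :=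
    inferInstanceAs (CompleteSpace (Fin n → Fin n → ℂ))
  let _ : NormedAlgebra 𝕜 (CMat n) := Matrix.linftyOpNormedAlgebra
  have h1 : HasDerivAt (fun t : 𝕜 => NormedSpace.exp (t • A)) A 0 := by
    have h := hasDerivAt_exp_smul_const A (0 : 𝕜)
    rw [zero_smul, NormedSpace.exp_zero, one_mul] at h
    exact h
  exact hasDerivAt_pi.1 (hasDerivAt_pi.1 h1 i) j

/-- The matrix exponential is analytic. It is written in terms of entries, as `CMat n` carries no
norm. -/
theorem contDiff_matrix_exp {E : Type*}
    [NormedAddCommGroup E] [NormedSpace ℝ E] [FiniteDimensional ℝ E] (L : E →ₗ[ℝ] CMat n) :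
    ContDiff ℝ ω (fun (e : E) => fun (i j : Fin n) => NormedSpace.exp (L e) i j) := by
  let _ : SeminormedRing (CMat n) := Matrix.linftyOpSemiNormedRing
  let _ : NormedRing (CMat n) := Matrix.linftyOpNormedRing
  let _ : NormedAlgebra ℝ (CMat n) := Matrix.linftyOpNormedAlgebra
  have h1 : ContDiff ℝ ω (NormedSpace.exp : CMat n → CMat n) :=
    contDiff_iff_contDiffAt.2 fun x => (NormedSpace.exp_analytic x).contDiffAt
  have h2 : ContDiff ℝ ω (fun e : E => NormedSpace.exp (L e)) :=
    h1.comp (LinearMap.toContinuousLinearMap L).contDiff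
  have : FiniteDimensional ℝ (CMat n) := inferInstanceAs (FiniteDimensional ℝ (Fin n → Fin n → ℂ))
  let P : Fin n → Fin n → CMat n →ₗ[ℝ] ℂ := fun i j => ((LinearMap.proj j : (Fin n → ℂ) →ₗ[ℝ] ℂ) ∘ₗ
      (LinearMap.proj i : (Fin n → Fin n → ℂ) →ₗ[ℝ] (Fin n → ℂ)))
  exact contDiff_pi.2 fun i => contDiff_pi.2 fun j =>
    (LinearMap.toContinuousLinearMap (P i j)).contDiff.comp h2

theorem continuous_matrix_exp : Continuous (NormedSpace.exp : CMat n → CMat n) := by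
  let _ : SeminormedRing (CMat n) := Matrix.linftyOpSemiNormedRing
  let _ : NormedRing (CMat n) := Matrix.linftyOpNormedRing
  let _ : NormedAlgebra ℝ (CMat n) := Matrix.linftyOpNormedAlgebra
  let _ : NormedAlgebra ℚ (CMat n) := NormedAlgebra.restrictScalars ℚ ℝ _
  exact NormedSpace.exp_continuous

theorem matrix_exp_smul_injective {A B : CMat n}
    (h : ∀ t : ℝ, NormedSpace.exp (t • A) = NormedSpace.exp (t • B)) : A = B := by
  ext i j
  refine (hasDerivAt_matrix_exp_smul (𝕜 := ℝ) A i j).unique ?_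
  simpa only [h] using hasDerivAt_matrix_exp_smul (𝕜 := ℝ) B i j

@[simp] theorem expGL_coe (A : CMat n) : ((expGL A : CGL n) : CMat n) = NormedSpace.exp A := rfl

theorem expGL_add_of_commute {A B : CMat n} (h : Commute A B) :
    expGL (A + B) = expGL A * expGL B :=
  Units.ext (Matrix.exp_add_of_commute A B h)

theorem expGL_add_smul {𝕜 : Type*} [RCLike 𝕜] [NormedAlgebra 𝕜 ℂ] (A : CMat n) (s t : 𝕜) :
    expGL ((s + t) • A) = expGL (s • A) * expGL (t • A) := by
  rw [add_smul]
  exact expGL_add_of_commute (((Commute.refl A).smul_left s).smul_right t)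

theorem expGL_neg (A : CMat n) : expGL (-A) = (expGL A)⁻¹ := by
  rw [eq_inv_iff_mul_eq_one, ← expGL_add_of_commute (Commute.refl A).neg_left, neg_add_cancel,
    expGL_zero]

theorem expGL_nsmul (k : ℕ) (A : CMat n) : expGL (k • A) = expGL A ^ k :=
  Units.ext (by simpa using Matrix.exp_nsmul k A)

theorem expGL_conj (g : CGL n) (A : CMat n) :
    expGL ((g : CMat n) * A * ((g⁻¹ : CGL n) : CMat n)) = g * expGL A * g⁻¹ :=
  Units.ext (by simpa using Matrix.exp_units_conj g A)

theorem expGL_smul_injective {A B : CMat n} (h : ∀ t : ℝ, expGL (t • A) = expGL (t • B)) :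
    A = B :=
  matrix_exp_smul_injective fun t => congrArg Units.val (h t)

/-- The topology of `GL_n(ℂ)` is that of an open subset of the space of matrices. -/
theorem isOpenEmbedding_glVal : Topology.IsOpenEmbedding (Units.val : CGL n → CMat n) := by
  let _ : SeminormedRing (CMat n) := Matrix.linftyOpSemiNormedRing
  let _ : NormedRing (CMat n) := Matrix.linftyOpNormedRing
  let _ : NormedAlgebra ℝ (CMat n) := Matrix.linftyOpNormedAlgebra
  exact Units.isOpenEmbedding_val

theorem continuous_expGL : Continuous (expGL : CMat n → CGL n) :=
  isOpenEmbedding_glVal.isInducing.continuous_iff.2 continuous_matrix_exp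

/-- A one-parameter group in `GL_n(ℂ)` whose entries are differentiable at `0` is an
exponential. -/
theorem eq_expGL_of_hasDerivAt_zero {𝕜 : Type*} [RCLike 𝕜] [NormedAlgebra 𝕜 ℂ]
    {p : 𝕜 → CGL n} {A : CMat n} (hadd : ∀ s t, p (s + t) = p s * p t)
    (hd : ∀ i j, HasDerivAt (fun t => (p t : CMat n) i j) (A i j) 0)
    (t : 𝕜) : p t = expGL (t • A) := by
  have h0 : p 0 = 1 := by
    have := hadd 0 0
    rw [add_zero] at this
    exact left_eq_mul.1 this
  refine Units.ext (matrix_eq_exp_of_hasDerivAt_zero (p := fun t => (p t : CMat n)) ?_ ?_ hd t)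
  · simp [h0]
  · intro s t; simp [hadd]

end OneParameter

/-! ### Unipotent groups and Zariski closed sets -/

section Unipotent

/-- Polynomial functions of one complex variable. -/
def IsPolyFun (f : ℂ → ℂ) : Prop := ∃ p : Polynomial ℂ, ∀ z, f z = p.eval z

theorem IsPolyFun.const (c : ℂ) : IsPolyFun fun _ => c := ⟨.C c, by simp⟩

theorem IsPolyFun.add {f g : ℂ → ℂ} (hf : IsPolyFun f) (hg : IsPolyFun g) :
    IsPolyFun fun z => f z + g z := by
  obtain ⟨p, hp⟩ := hf
  obtain ⟨q, hq⟩ := hg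
  exact ⟨p + q, fun z => by simp [hp, hq]⟩

theorem IsPolyFun.mul {f g : ℂ → ℂ} (hf : IsPolyFun f) (hg : IsPolyFun g) :
    IsPolyFun fun z => f z * g z := by
  obtain ⟨p, hp⟩ := hf
  obtain ⟨q, hq⟩ := hg
  exact ⟨p * q, fun z => by simp [hp, hq]⟩

theorem IsPolyFun.sum {ι : Type*} (s : Finset ι) {f : ι → ℂ → ℂ} (hf : ∀ i ∈ s, IsPolyFun (f i)) :
    IsPolyFun fun z => ∑ i ∈ s, f i z := by
  classical
  induction s using Finset.induction_on with
  | empty => simpa using IsPolyFun.const 0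
  | insert a s ha ih =>
    simp only [Finset.sum_insert ha]
    exact (hf a (by simp)).add (ih fun i hi => hf i (by simp [hi]))

theorem IsPolyFun.comp_add_left {f : ℂ → ℂ} (hf : IsPolyFun f) (c : ℂ) :
    IsPolyFun fun z => f (c + z) := by
  obtain ⟨p, hp⟩ := hf
  exact ⟨p.comp (.C c + .X), fun z => by simp [hp]⟩

theorem IsPolyFun.mvPolynomial_eval {σ : Type*} {f : σ → ℂ → ℂ} (hf : ∀ i, IsPolyFun (f i))
    (q : MvPolynomial σ ℂ) : IsPolyFun fun z => MvPolynomial.eval (fun i => f i z) q := by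
  induction q using MvPolynomial.induction_on with
  | C a => simpa using IsPolyFun.const a
  | add p q hp hq => simpa using hp.add hq
  | mul_X p i hp => simpa using hp.mul (hf i)

theorem IsPolyFun.differentiable {f : ℂ → ℂ} (hf : IsPolyFun f) : Differentiable ℂ f := by
  obtain ⟨p, hp⟩ := hf
  rw [funext hp]
  exact p.differentiable

/-- Polynomial functions that agree on an infinite set are equal. -/
theorem IsPolyFun.eq_of_infinite {f g : ℂ → ℂ} (hf : IsPolyFun f) (hg : IsPolyFun g)
    (h : {z | f z = g z}.Infinite) (z : ℂ) : f z = g z := by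
  obtain ⟨p, hp⟩ := hf
  obtain ⟨q, hq⟩ := hg
  rw [hp, hq, Polynomial.eq_of_infinite_eval_eq p q (by simpa [hp, hq] using h)]

theorem infinite_range_natCast : (range ((↑) : ℕ → ℂ)).Infinite :=
  infinite_range_of_injective Nat.cast_injective

theorem infinite_range_ofReal : (range ((↑) : ℝ → ℂ)).Infinite :=
  infinite_range_of_injective Complex.ofReal_injective

variable {n : ℕ}

/-- Matrices depending polynomially on a complex variable. -/
def IsPolyMat (M : ℂ → CMat n) : Prop := ∀ i j, IsPolyFun fun z => M z i j

theorem IsPolyMat.mul {M N : ℂ → CMat n} (hM : IsPolyMat M) (hN : IsPolyMat N) :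
    IsPolyMat fun z => M z * N z := fun i j => by
  simp only [Matrix.mul_apply]
  exact IsPolyFun.sum _ fun k _ => (hM i k).mul (hN k j)

theorem IsPolyMat.const (A : CMat n) : IsPolyMat fun _ => A := fun i j => IsPolyFun.const (A i j)

theorem isPolyMat_sum_smul {N : ℕ} {f : ℕ → ℂ → ℂ} (hf : ∀ k, IsPolyFun (f k)) (A : ℕ → CMat n) :
    IsPolyMat fun z => ∑ k ∈ Finset.range N, f k z • A k := fun i j => by
  simp only [Matrix.sum_apply, Matrix.smul_apply, smul_eq_mul]
  exact IsPolyFun.sum _ fun k _ => (hf k).mul (.const _)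

/-- A polynomial curve with infinitely many points in a Zariski closed set lies in it. -/
theorem IsZariskiClosed.mem_of_isPolyMat {S : Set (CGL n)} (hS : IsZariskiClosed S) {γ : ℂ → CGL n}
    (hγ : IsPolyMat fun z => (γ z : CMat n)) (h : {z | γ z ∈ S}.Infinite) (z : ℂ) : γ z ∈ S := by
  obtain ⟨I, hI⟩ := hS
  refine (hI _).2 fun p hp => ?_
  refine (IsPolyFun.mvPolynomial_eval (fun ij : Fin n × Fin n => hγ ij.1 ij.2) p).eq_of_infinite
    (.const 0) (h.mono fun z hz => ?_) z
  exact (hI _).1 hz p hp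

theorem IsZariskiClosed.isClosed {S : Set (CGL n)} (hS : IsZariskiClosed S) : IsClosed S := by
  obtain ⟨I, hI⟩ := hS
  have : S = ⋂ p ∈ I, {g : CGL n |
      MvPolynomial.eval (fun ij : Fin n × Fin n => (g : CMat n) ij.1 ij.2) p = 0} := by
    ext g; simp [hI]
  rw [this]
  refine isClosed_biInter fun p _ => isClosed_eq ?_ continuous_const
  refine (MvPolynomial.continuous_eval p).comp (continuous_pi fun ij => ?_)
  exact (continuous_apply_apply (ρ := fun _ _ => ℂ) ij.1 ij.2).comp
    isOpenEmbedding_glVal.continuous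

/-- The exponential of a nilpotent matrix is polynomial. -/
theorem isPolyMat_exp_smul {A : CMat n} (hA : IsNilpotent A) :
    IsPolyMat fun z : ℂ => NormedSpace.exp (z • A) := by
  obtain ⟨N, hN⟩ := hA
  have h : ∀ z : ℂ, NormedSpace.exp (z • A) =
      ∑ k ∈ Finset.range N, ((k.factorial : ℂ)⁻¹ * z ^ k) • A ^ k := fun z => by
    rw [NormedSpace.exp_eq_tsum ℂ]
    beta_reduce
    rw [tsum_eq_sum (s := Finset.range N)]
    · simp only [smul_pow, smul_smul]
    · intro k hk
      rw [smul_pow, pow_eq_zero_of_le (by simpa using hk) hN, smul_zero, smul_zero]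
  simp only [h]
  exact isPolyMat_sum_smul (fun k => ⟨.C (k.factorial : ℂ)⁻¹ * .X ^ k, by simp⟩) _

/-- The complex powers of a unipotent matrix, given by the binomial series, form a polynomial
one-parameter group; so a unipotent matrix is an exponential. -/
theorem exists_expGL_eq_of_isNilpotent_sub_one {u : CGL n} (hu : IsNilpotent ((u : CMat n) - 1)) :
    ∃ A : CMat n, expGL A = u ∧ IsPolyMat fun z : ℂ => (expGL (z • A) : CMat n) := by
  obtain ⟨N, hN⟩ := hu
  set X : CMat n := (u : CMat n) - 1 with hX
  let b : ℕ → ℂ → ℂ := fun k z => (k.factorial : ℂ)⁻¹ * (descPochhammer ℂ k).eval z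
  have hb : ∀ k, IsPolyFun (b k) := fun k =>
    ⟨.C (k.factorial : ℂ)⁻¹ * descPochhammer ℂ k, fun z => by simp [b]⟩
  let P : ℂ → CMat n := fun z => ∑ k ∈ Finset.range N, b k z • X ^ k
  have hP : IsPolyMat P := isPolyMat_sum_smul hb _
  have hbn : ∀ k m : ℕ, b k m = (m.choose k : ℂ) := fun k m => by
    have : (k.factorial : ℂ) ≠ 0 := by exact_mod_cast k.factorial_ne_zero
    simp only [b]
    rw [descPochhammer_eval_eq_descFactorial, Nat.descFactorial_eq_factorial_mul_choose]
    push_cast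
    field_simp
  have hPn : ∀ m : ℕ, P m = (u : CMat n) ^ m := fun m => by
    have h1 : (u : CMat n) = X + 1 := by simp [hX]
    have h2 : (u : CMat n) ^ m = ∑ k ∈ Finset.range (m + 1 + N), (m.choose k : ℂ) • X ^ k := by
      rw [h1, (Commute.one_right X).add_pow]
      rw [Finset.sum_subset (Finset.range_mono (show m + 1 ≤ m + 1 + N by omega))]
      · refine Finset.sum_congr rfl fun k _ => ?_
        rw [one_pow, mul_one, ← nsmul_eq_mul', Nat.cast_smul_eq_nsmul]
      · intro k _ hk
        rw [Nat.choose_eq_zero_of_lt (by simpa using hk)]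
        simp
    rw [h2]
    simp only [P, hbn]
    refine Finset.sum_subset (Finset.range_mono (by omega)) fun k _ hk => ?_
    rw [pow_eq_zero_of_le (by simpa using hk) hN, smul_zero]
  have hadd1 : ∀ (m : ℕ) (z : ℂ), P (m + z) = P m * P z := fun m z => by
    ext i j
    refine ((hP i j).comp_add_left m).eq_of_infinite (((IsPolyMat.const (P m)).mul hP) i j)
      (infinite_range_natCast.mono ?_) z
    rintro _ ⟨k, rfl⟩
    simp only [mem_ofPred_eq]
    rw [← Nat.cast_add, hPn, hPn, hPn, pow_add]
  have hadd : ∀ s t : ℂ, P (s + t) = P s * P t := fun s t => by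
    ext i j
    rw [add_comm]
    refine ((hP i j).comp_add_left t).eq_of_infinite ((hP.mul (IsPolyMat.const (P t))) i j)
      (infinite_range_natCast.mono ?_) s
    rintro _ ⟨k, rfl⟩
    simp only [mem_ofPred_eq]
    rw [add_comm, hadd1]
  have h0 : P 0 = 1 := by simpa using hPn 0
  let A : CMat n := Matrix.of fun i j => deriv (fun z => P z i j) 0
  have hexp : ∀ z : ℂ, P z = NormedSpace.exp (z • A) :=
    matrix_eq_exp_of_hasDerivAt_zero h0 hadd fun i j => ((hP i j).differentiable 0).hasDerivAt
  refine ⟨A, Units.ext ?_, ?_⟩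
  · have := hexp 1
    rw [one_smul] at this
    rw [expGL_coe, ← this]
    simpa using hPn 1
  · simpa only [expGL_coe, ← hexp] using hP

/-- The exponent is uniform, so it survives passage to a limit of nilpotent matrices. -/
theorem pow_eq_zero_of_isNilpotent {A : CMat n} (hA : IsNilpotent A) : A ^ n = 0 := by
  have h := Matrix.aeval_self_charpoly A
  have h2 : A.charpoly = Polynomial.X ^ n := by
    have := (Matrix.isNilpotent_charpoly_sub_pow_of_isNilpotent hA).eq_zero
    rw [sub_eq_zero] at this
    simpa using this
  rwa [h2, map_pow, Polynomial.aeval_X] at h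

/-- The Lie algebra of a unipotent group consists of nilpotent matrices: take the limit of
`(t⁻¹ (exp (t A) - 1)) ^ n = 0`. -/
theorem isNilpotent_of_mem_lieSet {S : Subgroup (CGL n)}
    (hS : ∀ v ∈ S, IsNilpotent ((v : CMat n) - 1)) {A : CMat n} (hA : A ∈ lieSet S) :
    IsNilpotent A := by
  refine ⟨n, ?_⟩
  have h1 : ∀ t : ℝ, (t⁻¹ • (NormedSpace.exp (t • A) - 1)) ^ n = 0 := fun t => by
    rw [smul_pow, ← expGL_coe, pow_eq_zero_of_isNilpotent (hS _ (hA t)), smul_zero]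
  have h2 : Tendsto (fun t : ℝ => t⁻¹ • (NormedSpace.exp (t • A) - 1)) (𝓝[≠] 0) (𝓝 A) := by
    refine tendsto_pi_nhds.2 fun i => tendsto_pi_nhds.2 fun j => ?_
    have h := hasDerivAt_iff_tendsto_slope.1 (hasDerivAt_matrix_exp_smul (𝕜 := ℝ) A i j)
    refine h.congr fun t => ?_
    simp [slope_def_module, Matrix.smul_apply, Matrix.sub_apply]
  have h3 := (h2.pow n).congr fun t => h1 t
  exact tendsto_nhds_unique h3 tendsto_const_nhds

end Unipotent

/-! ### Complexifications of compact groups -/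

section Complexification

variable {n : ℕ}

open Matrix in
/-- For a Hermitian matrix `S`, the matrix `exp S + exp (-S) - 2 - S ^ 2` has nonnegative
eigenvalues; its trace bounds the entries of `S` in terms of `exp S`. -/
theorem norm_entry_sq_le_trace_exp {S : CMat n} (hS : S.IsHermitian) (i j : Fin n) :
    ‖S i j‖ ^ 2 ≤ (trace (NormedSpace.exp S) + trace (NormedSpace.exp (-S))).re - 2 * n := by
  set V : CMat n := (hS.eigenvectorUnitary : CMat n)
  have hV1 : star V * V = 1 := Unitary.coe_star_mul_self hS.eigenvectorUnitary
  have hV2 : V * star V = 1 := Unitary.coe_mul_star_self hS.eigenvectorUnitary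
  have hVu : IsUnit V := ⟨⟨V, star V, hV2, hV1⟩, rfl⟩
  have hVi : V⁻¹ = star V := Matrix.inv_eq_left_inv hV1
  set s := hS.eigenvalues
  have hsp : S = V * diagonal (fun k => (s k : ℂ)) * V⁻¹ := by
    rw [hVi]
    conv_lhs => rw [hS.spectral_theorem]
    rfl
  have htr : ∀ D : CMat n, trace (V * D * V⁻¹) = trace D := fun D => by
    rw [Matrix.trace_mul_comm, ← Matrix.mul_assoc, hVi, hV1, Matrix.one_mul]
  have he : ∀ d : Fin n → ℂ, NormedSpace.exp (V * diagonal d * V⁻¹) =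
      V * diagonal (fun k => Complex.exp (d k)) * V⁻¹ := fun d => by
    rw [Matrix.exp_conj _ _ hVu, Matrix.exp_diagonal]
    congr 3
    ext k
    rw [Pi.coe_exp, Complex.exp_eq_exp_ℂ]
  have h1 : trace (NormedSpace.exp S) = ∑ k, Complex.exp (s k) := by
    rw [hsp, he, htr, trace_diagonal]
  have h2 : trace (NormedSpace.exp (-S)) = ∑ k, Complex.exp (-(s k)) := by
    have : -S = V * diagonal (fun k => -(s k : ℂ)) * V⁻¹ := by
      have : diagonal (fun k => -(s k : ℂ)) = -diagonal (fun k => (s k : ℂ)) :=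
        (diagonal_neg _).symm
      conv_lhs => rw [hsp]
      rw [this, Matrix.mul_neg, Matrix.neg_mul]
    rw [this, he, htr, trace_diagonal]
  have h3 : trace (S * S) = ∑ k, ((s k : ℂ)) ^ 2 := by
    have : S * S = V * diagonal (fun k => (s k : ℂ) ^ 2) * V⁻¹ := by
      have : diagonal (fun k => (s k : ℂ) ^ 2) =
          diagonal (fun k => (s k : ℂ)) * diagonal (fun k => (s k : ℂ)) := by
        rw [diagonal_mul_diagonal]; congr 1; ext k; ring
      rw [this]
      conv_lhs => rw [hsp]
      rw [hVi]
      calc _ = V * diagonal (fun k => (s k : ℂ)) * (star V * V) * diagonal (fun k => (s k : ℂ)) *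
            star V := by simp only [Matrix.mul_assoc]
        _ = _ := by rw [hV1]; simp only [Matrix.mul_assoc, Matrix.one_mul]
    rw [this, htr, trace_diagonal]
  have h4 : (trace (S * S)).re = ∑ a, ∑ b, ‖S a b‖ ^ 2 := by
    simp only [trace, diag_apply, Matrix.mul_apply, Complex.re_sum]
    refine Finset.sum_congr rfl fun a _ => Finset.sum_congr rfl fun b _ => ?_
    have : S b a = star (S a b) := (hS.apply b a).symm
    rw [this, Complex.star_def, Complex.mul_conj, Complex.normSq_eq_norm_sq]
    norm_cast
  have h5 : ‖S i j‖ ^ 2 ≤ (trace (S * S)).re := by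
    rw [h4]
    calc ‖S i j‖ ^ 2 ≤ ∑ b, ‖S i b‖ ^ 2 :=
          Finset.single_le_sum (f := fun b => ‖S i b‖ ^ 2) (fun b _ => by positivity)
            (Finset.mem_univ j)
      _ ≤ _ := Finset.single_le_sum (f := fun a => ∑ b, ‖S a b‖ ^ 2)
            (fun a _ => Finset.sum_nonneg fun b _ => by positivity) (Finset.mem_univ i)
  refine h5.trans ?_
  rw [h1, h2, h3, ← Finset.sum_add_distrib, Complex.re_sum, Complex.re_sum]
  have h6 : (2 * n : ℝ) = ∑ _k : Fin n, (2 : ℝ) := by simp [mul_comm]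
  rw [h6, ← Finset.sum_sub_distrib]
  refine Finset.sum_le_sum fun k _ => ?_
  have h7 : ((s k : ℂ) ^ 2).re = s k ^ 2 := by norm_cast
  have h8 : (Complex.exp (s k) + Complex.exp (-(s k))).re = Real.exp (s k) + Real.exp (-(s k)) := by
    rw [Complex.add_re, Complex.exp_ofReal_re, ← Complex.ofReal_neg, Complex.exp_ofReal_re]
  rw [h7, h8]
  have h9 : 1 + s k ^ 2 / 2 ≤ Real.cosh (s k) := by
    have hc : Real.cosh (s k) = 1 + 2 * Real.sinh (s k / 2) ^ 2 := by
      have := Real.cosh_two_mul (s k / 2)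
      rw [Real.cosh_sq, mul_div_cancel₀ _ two_ne_zero] at this
      linarith
    have hs : (s k / 2) ^ 2 ≤ Real.sinh (s k / 2) ^ 2 := by
      rw [sq_le_sq, Real.abs_sinh]
      exact Real.self_le_sinh_iff.2 (abs_nonneg _)
    rw [hc]; nlinarith
  rw [Real.cosh_eq] at h9
  linarith

variable {K G : Subgroup (CGL n)}

theorem expGL_mem_of_mem_lieSet {S : Subgroup (CGL n)} {A : CMat n} (hA : A ∈ lieSet S) :
    expGL A ∈ S := by simpa using hA 1

theorem conjTranspose_eq_neg_of_mem_lieSet (hK : ∀ k ∈ K, (k : CMat n) ∈ Matrix.unitaryGroup (Fin n) ℂ)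
    {A : CMat n} (hA : A ∈ lieSet K) : A.conjTranspose = -A := by
  refine matrix_exp_smul_injective fun t => ?_
  have h1 : NormedSpace.exp (t • A.conjTranspose) = (NormedSpace.exp (t • A)).conjTranspose := by
    rw [← Matrix.exp_conjTranspose, Matrix.conjTranspose_smul]; simp
  have h2 := Matrix.mem_unitaryGroup_iff'.1 (hK _ (hA t))
  have h3 : ((expGL (t • A))⁻¹ : CGL n) = star ((expGL (t • A) : CGL n) : CMat n) := 
    Units.inv_eq_of_mul_eq_one_left h2
  rw [h1, ← expGL_coe, smul_neg, ← expGL_coe, expGL_neg, h3]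
  rfl

theorem isHermitian_I_smul {A : CMat n} (hA : A.conjTranspose = -A) :
    (Complex.I • A).IsHermitian := by
  rw [Matrix.IsHermitian, Matrix.conjTranspose_smul, hA]; simp

/-- The trace estimate for the Hermitian matrix `2 i A`, in terms of `g = k exp (i A)`. -/
theorem norm_entry_sq_le_of_polar {k : CGL n} (hk : (k : CMat n) ∈ Matrix.unitaryGroup (Fin n) ℂ)
    {A : CMat n} (hA : A.conjTranspose = -A) (i j : Fin n) :
    (2 * ‖A i j‖) ^ 2 ≤ (Matrix.trace
        (((k * expGL (Complex.I • A) : CGL n) : CMat n).conjTranspose *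
          ((k * expGL (Complex.I • A) : CGL n) : CMat n)) +
      Matrix.trace ((((k * expGL (Complex.I • A))⁻¹ : CGL n) : CMat n) *
        (((k * expGL (Complex.I • A))⁻¹ : CGL n) : CMat n).conjTranspose)).re - 2 * n := by
  have hH := isHermitian_I_smul hA
  have hS : ((2 : ℂ) • Complex.I • A).IsHermitian := by
    rw [Matrix.IsHermitian, Matrix.conjTranspose_smul, hH.eq]; simp
  have h := norm_entry_sq_le_trace_exp hS i j
  have h2 : ‖((2 : ℂ) • Complex.I • A) i j‖ = 2 * ‖A i j‖ := by
    simp [Matrix.smul_apply]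
  rw [h2] at h
  have hkk := Matrix.mem_unitaryGroup_iff'.1 hk
  have hk' : ((k⁻¹ : CGL n) : CMat n) = (k : CMat n).conjTranspose :=
    Units.inv_eq_of_mul_eq_one_left hkk
  have he : (NormedSpace.exp (Complex.I • A)).conjTranspose = NormedSpace.exp (Complex.I • A) := by
    rw [← Matrix.exp_conjTranspose, hH.eq]
  have he' : (NormedSpace.exp (-(Complex.I • A))).conjTranspose =
      NormedSpace.exp (-(Complex.I • A)) := by
    rw [← Matrix.exp_conjTranspose, Matrix.conjTranspose_neg, hH.eq]
  have e1 : ((k * expGL (Complex.I • A) : CGL n) : CMat n).conjTranspose *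
      ((k * expGL (Complex.I • A) : CGL n) : CMat n) =
      NormedSpace.exp ((2 : ℂ) • Complex.I • A) := by
    rw [Units.val_mul, Matrix.conjTranspose_mul, expGL_coe, he, two_smul,
      Matrix.exp_add_of_commute _ _ (Commute.refl _)]
    calc _ = NormedSpace.exp (Complex.I • A) * (star (k : CMat n) * (k : CMat n)) *
        NormedSpace.exp (Complex.I • A) := by simp only [Matrix.mul_assoc]; rfl
      _ = _ := by rw [hkk, Matrix.mul_one]
  have e2 : (((k * expGL (Complex.I • A))⁻¹ : CGL n) : CMat n) *
        (((k * expGL (Complex.I • A))⁻¹ : CGL n) : CMat n).conjTranspose =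
      NormedSpace.exp (-((2 : ℂ) • Complex.I • A)) := by
    rw [mul_inv_rev, Units.val_mul, ← expGL_neg, expGL_coe, Matrix.conjTranspose_mul, he', hk',
      Matrix.conjTranspose_conjTranspose, two_smul, neg_add,
      Matrix.exp_add_of_commute _ _ (Commute.refl _)]
    calc _ = NormedSpace.exp (-(Complex.I • A)) * (star (k : CMat n) * (k : CMat n)) *
        NormedSpace.exp (-(Complex.I • A)) := by simp only [Matrix.mul_assoc]; rfl
      _ = _ := by rw [hkk, Matrix.mul_one]
  rw [e1, e2]
  exact h

theorem isClosed_lieSet {S : Subgroup (CGL n)} (hS : IsClosed (S : Set (CGL n))) :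
    IsClosed (lieSet S) := by
  have : lieSet S = ⋂ t : ℝ, {A | expGL (t • A) ∈ S} := by ext; simp [lieSet]
  rw [this]
  exact isClosed_iInter fun t => hS.preimage (continuous_expGL.comp (continuous_const_smul t))

/-- `K_ℂ` is closed: in the polar decomposition `g = k exp (i A)` the trace estimate bounds `A` in
terms of `g`, so that locally `K_ℂ` is the image of a compact set. -/
theorem IsComplexification.isClosed (h : IsComplexification K G) : IsClosed (G : Set (CGL n)) := by
  let τ : CGL n → ℝ := fun g => (Matrix.trace ((g : CMat n).conjTranspose * (g : CMat n)) +
      Matrix.trace (((g⁻¹ : CGL n) : CMat n) * ((g⁻¹ : CGL n) : CMat n).conjTranspose)).re - 2 * n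
  have hv : Continuous fun g : CGL n => (g : CMat n) := isOpenEmbedding_glVal.continuous
  have hvi : Continuous fun g : CGL n => ((g⁻¹ : CGL n) : CMat n) := hv.comp continuous_inv
  have hτ : Continuous τ := by
    refine Continuous.sub (Complex.continuous_re.comp (Continuous.add ?_ ?_)) continuous_const
    · exact (hv.matrix_conjTranspose.matrix_mul hv).matrix_trace
    · exact (hvi.matrix_mul hvi.matrix_conjTranspose).matrix_trace
  refine isClosed_of_closure_subset fun g hg => ?_
  -- Near `g` the Hermitian factors stay in a bounded, hence compact, subset of `i 𝔨`.
  let C : ℝ := τ g + 1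
  let T : Set (CMat n) := lieSet K ∩ {A | ∀ i j, ‖A i j‖ ≤ max C 1}
  have hT : IsCompact T := by
    have h1 : IsCompact {A : CMat n | ∀ i j, ‖A i j‖ ≤ max C 1} := by
      have : {A : CMat n | ∀ i j, ‖A i j‖ ≤ max C 1} =
          Set.pi univ fun _ : Fin n => Set.pi univ fun _ : Fin n =>
            Metric.closedBall (0 : ℂ) (max C 1) := by
        ext A
        exact ⟨fun h i _ j _ => mem_closedBall_zero_iff.2 (h i j),
          fun h i j => mem_closedBall_zero_iff.1 (h i trivial j trivial)⟩
      rw [this]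
      exact isCompact_univ_pi fun i => isCompact_univ_pi fun j => isCompact_closedBall _ _
    exact h1.inter_left (isClosed_lieSet h.compact.isClosed)
  have hc : IsCompact ((fun p : CGL n × CMat n => p.1 * expGL (Complex.I • p.2)) ''
      ((K : Set (CGL n)) ×ˢ T)) :=
    (h.compact.prod hT).image
      (continuous_fst.mul (continuous_expGL.comp (continuous_const_smul Complex.I |>.comp continuous_snd)))
  have hsub : (fun p : CGL n × CMat n => p.1 * expGL (Complex.I • p.2)) ''
      ((K : Set (CGL n)) ×ˢ T) ⊆ G := by
    rintro _ ⟨⟨k, A⟩, ⟨hk, hA⟩, rfl⟩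
    exact (h.polar _).2 ⟨k, hk, A, hA.1, rfl⟩
  refine hsub ?_
  rw [← hc.isClosed.closure_eq]
  refine mem_closure_iff_nhds.2 fun t ht => ?_
  have hnhds : {x | τ x < C} ∈ 𝓝 g := (isOpen_lt hτ continuous_const).mem_nhds (by simp [C])
  obtain ⟨x, ⟨hxt, hxC⟩, hxG⟩ := mem_closure_iff_nhds.1 hg _ (inter_mem ht hnhds)
  obtain ⟨k, hk, A, hA, rfl⟩ := (h.polar x).1 hxG
  refine ⟨_, hxt, ⟨k, A⟩, ⟨hk, hA, fun i j => ?_⟩, rfl⟩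
  have h1 := norm_entry_sq_le_of_polar (h.unitary k hk)
    (conjTranspose_eq_neg_of_mem_lieSet h.unitary hA) i j
  have h2 : τ (k * expGL (Complex.I • A)) < C := hxC
  have h3 : (2 * ‖A i j‖) ^ 2 < C := h1.trans_lt h2
  rcases le_total ‖A i j‖ 1 with h4 | h4
  · exact h4.trans (le_max_right _ _)
  · refine le_trans ?_ (le_max_left _ _)
    nlinarith

/-- Unitary elements of `K_ℂ` lie in `K`: the trace estimate gives `A = 0` in their polar
decomposition. -/
theorem IsComplexification.mem_of_mem_unitary (h : IsComplexification K G) {g : CGL n} (hg : g ∈ G)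
    (hu : (g : CMat n) ∈ Matrix.unitaryGroup (Fin n) ℂ) : g ∈ K := by
  obtain ⟨k, hk, A, hA, rfl⟩ := (h.polar g).1 hg
  have hA' := conjTranspose_eq_neg_of_mem_lieSet h.unitary hA
  have h1 := norm_entry_sq_le_of_polar (h.unitary k hk) hA'
  have hi := Units.inv_eq_of_mul_eq_one_left (Matrix.mem_unitaryGroup_iff'.1 hu)
  have h2 : A = 0 := by
    ext i j
    have h3 := h1 i j
    rw [hi] at h3
    have e1 : ((k * expGL (Complex.I • A) : CGL n) : CMat n).conjTranspose *
      ((k * expGL (Complex.I • A) : CGL n) : CMat n) = 1 := Matrix.mem_unitaryGroup_iff'.1 hu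
    rw [show star ((k * expGL (Complex.I • A) : CGL n) : CMat n) =
      ((k * expGL (Complex.I • A) : CGL n) : CMat n).conjTranspose from rfl,
      Matrix.conjTranspose_conjTranspose, e1] at h3
    simp only [Matrix.trace_one, Fintype.card_fin, Complex.add_re, Complex.natCast_re] at h3
    have h4 : ‖A i j‖ ^ 2 ≤ 0 := by nlinarith
    have h5 : ‖A i j‖ = 0 := by
      have := sq_nonneg ‖A i j‖
      exact pow_eq_zero_iff two_ne_zero |>.1 (le_antisymm h4 this)
    simpa using h5
  rw [h2, smul_zero, expGL_zero, mul_one]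
  exact hk

theorem IsComplexification.le (h : IsComplexification K G) : K ≤ G := fun k hk =>
  (h.polar k).2 ⟨k, hk, 0, fun t => by simp [expGL_zero], by simp [expGL_zero]⟩

theorem IsComplexification.mem_lieSet_of_mem (h : IsComplexification K G) {A : CMat n}
    (hA : A ∈ lieSet K) : A ∈ lieSet G := fun t => h.le (hA t)

theorem IsComplexification.I_smul_mem_lieSet (h : IsComplexification K G) {A : CMat n}
    (hA : A ∈ lieSet K) : Complex.I • A ∈ lieSet G := fun t => by
  refine (h.polar _).2 ⟨1, K.one_mem, t • A, fun s => ?_, ?_⟩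
  · rw [smul_smul]; exact hA _
  · rw [one_mul, smul_comm]

/-- The Lie algebra of `K_ℂ` is closed under adjoints, as `(k exp (i A))* = exp (i A) k⁻¹`. -/
theorem IsComplexification.conjTranspose_mem_lieSet (h : IsComplexification K G) {a : CMat n}
    (ha : a ∈ lieSet G) : a.conjTranspose ∈ lieSet G := by
  intro t
  have e : (expGL (t • a.conjTranspose) : CMat n) = (expGL (t • a) : CMat n).conjTranspose := by
    rw [expGL_coe, expGL_coe, ← Matrix.exp_conjTranspose, Matrix.conjTranspose_smul]; simp
  obtain ⟨k, hk, A, hA, hkA⟩ := (h.polar _).1 (ha t)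
  have hA' := conjTranspose_eq_neg_of_mem_lieSet h.unitary hA
  have hH := isHermitian_I_smul hA'
  have hk' : ((k⁻¹ : CGL n) : CMat n) = (k : CMat n).conjTranspose :=
    Units.inv_eq_of_mul_eq_one_left (Matrix.mem_unitaryGroup_iff'.1 (h.unitary k hk))
  have e2 : expGL (t • a.conjTranspose) = expGL (Complex.I • A) * k⁻¹ := by
    refine Units.ext ?_
    rw [e, hkA, Units.val_mul, Matrix.conjTranspose_mul, Units.val_mul, hk', expGL_coe,
      ← Matrix.exp_conjTranspose, hH.eq]
  rw [e2]
  exact G.mul_mem ((h.polar _).2 ⟨1, K.one_mem, A, hA, by simp⟩) (G.inv_mem (h.le hk))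

/-- The skew-Hermitian part of an element of the Lie algebra of `K_ℂ` lies in the Lie algebra
of `K`. -/
theorem IsComplexification.skewPart_mem (h : IsComplexification K G) {a : CMat n}
    (ha : a ∈ lieSet G) : skewPart a ∈ lieSet K := by
  have hs : skewPart a ∈ lieAlgebra G h.isClosed := by
    have : skewPart a = (1 / 2 : ℝ) • (a - a.conjTranspose) := by
      rw [skewPart, ← Complex.coe_smul]; simp
    rw [this]
    exact Submodule.smul_mem _ _ (Submodule.sub_mem _ ha (h.conjTranspose_mem_lieSet ha))
  have hskew : (skewPart a).conjTranspose = -skewPart a := by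
    rw [skewPart, Matrix.conjTranspose_smul, Matrix.conjTranspose_sub,
      Matrix.conjTranspose_conjTranspose, ← smul_neg, neg_sub]
    simp
  intro t
  refine h.mem_of_mem_unitary (hs t) (Matrix.mem_unitaryGroup_iff'.2 ?_)
  have : star ((expGL (t • skewPart a) : CGL n) : CMat n) =
      ((expGL (t • skewPart a))⁻¹ : CGL n) := by
    rw [← expGL_neg, expGL_coe, expGL_coe, Matrix.star_eq_conjTranspose,
      ← Matrix.exp_conjTranspose, Matrix.conjTranspose_smul, hskew]
    simp
  rw [this, Units.inv_mul]

theorem skewPart_add_I_smul (a : CMat n) :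
    a = skewPart a + Complex.I • skewPart (-Complex.I • a) := by
  ext i j
  simp only [skewPart, Matrix.add_apply, Matrix.smul_apply, Matrix.sub_apply,
    Matrix.conjTranspose_apply, smul_eq_mul, star_mul', star_neg, Complex.star_def, Complex.conj_I]
  ring_nf
  simp only [Complex.I_sq]
  ring

theorem conjTranspose_eq_neg_skewPart_add (a : CMat n) :
    a.conjTranspose = -skewPart a + Complex.I • skewPart (-Complex.I • a) := by
  ext i j
  simp only [skewPart, Matrix.add_apply, Matrix.smul_apply, Matrix.sub_apply, Matrix.neg_apply,
    Matrix.conjTranspose_apply, smul_eq_mul, star_mul', star_neg, Complex.star_def, Complex.conj_I]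
  ring_nf
  simp only [Complex.I_sq]
  ring

end Complexification

/-! ### Internally graded groups -/

section Graded

theorem coeff_eq_zero_of_forall_units {M : ℕ} {c : ℕ → ℂ}
    (h : ∀ t : ℂˣ, ∑ k ∈ Finset.range M, (t : ℂ) ^ k * c k = 0) {k : ℕ} (hk : k < M) : c k = 0 := by
  let p : Polynomial ℂ := ∑ k ∈ Finset.range M, .C (c k) * .X ^ k
  have hp : p = 0 := by
    refine Polynomial.eq_zero_of_infinite_isRoot p ?_
    refine ((Set.finite_singleton (0 : ℂ)).infinite_compl).mono fun z hz => ?_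
    have hz' : z ≠ 0 := hz
    have := h (Units.mk0 z hz')
    simp only [Units.val_mk0] at this
    simp only [p, mem_ofPred_eq, Polynomial.IsRoot, Polynomial.eval_finsetSum,
      Polynomial.eval_mul, Polynomial.eval_C, Polynomial.eval_pow, Polynomial.eval_X]
    simpa only [mul_comm] using this
  have h2 : p.coeff k = c k := by
    simp [p, Polynomial.coeff_C_mul, Polynomial.coeff_X_pow, hk]
  rw [← h2, hp, Polynomial.coeff_zero]

theorem matrix_coeff_eq_zero_of_forall_units {n M : ℕ} {C : ℕ → CMat n}
    (h : ∀ t : ℂˣ, ∑ k ∈ Finset.range M, (t : ℂ) ^ k • C k = 0) {k : ℕ} (hk : k < M) :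
    C k = 0 := by
  ext i j
  refine coeff_eq_zero_of_forall_units (c := fun k => C k i j) (fun t => ?_) hk
  have := congrFun (congrFun (h t) i) j
  simpa [Matrix.sum_apply] using this

/-- Functions on `ℂˣ` that become polynomial after multiplication with any large power of the
coordinate. -/
def IsLaurentFun (f : ℂˣ → ℂ) : Prop :=
  ∃ N : ℕ, ∀ m ≥ N, ∃ p : Polynomial ℂ, ∀ t : ℂˣ, (t : ℂ) ^ m * f t = p.eval (t : ℂ)

theorem IsLaurentFun.of_exists {f : ℂˣ → ℂ} {N : ℕ}
    (h : ∃ p : Polynomial ℂ, ∀ t : ℂˣ, (t : ℂ) ^ N * f t = p.eval (t : ℂ)) : IsLaurentFun f := by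
  obtain ⟨p, hp⟩ := h
  refine ⟨N, fun m hm => ⟨.X ^ (m - N) * p, fun t => ?_⟩⟩
  rw [Polynomial.eval_mul, ← hp, Polynomial.eval_pow, Polynomial.eval_X, ← mul_assoc, ← pow_add,
    Nat.sub_add_cancel hm]

theorem IsLaurentFun.const (c : ℂ) : IsLaurentFun fun _ => c :=
  .of_exists (N := 0) ⟨.C c, by simp⟩

theorem IsLaurentFun.coe : IsLaurentFun fun t => (t : ℂ) := .of_exists (N := 0) ⟨.X, by simp⟩

theorem IsLaurentFun.coe_inv : IsLaurentFun fun t => ((t⁻¹ : ℂˣ) : ℂ) :=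
  .of_exists (N := 1) ⟨.C 1, by simp⟩

theorem IsLaurentFun.add {f g : ℂˣ → ℂ} (hf : IsLaurentFun f) (hg : IsLaurentFun g) :
    IsLaurentFun fun t => f t + g t := by
  obtain ⟨N, hN⟩ := hf
  obtain ⟨M, hM⟩ := hg
  obtain ⟨p, hp⟩ := hN (N + M) (by omega)
  obtain ⟨q, hq⟩ := hM (N + M) (by omega)
  exact .of_exists (N := N + M) ⟨p + q, fun t => by rw [mul_add, hp, hq, Polynomial.eval_add]⟩

theorem IsLaurentFun.mul {f g : ℂˣ → ℂ} (hf : IsLaurentFun f) (hg : IsLaurentFun g) :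
    IsLaurentFun fun t => f t * g t := by
  obtain ⟨N, hN⟩ := hf
  obtain ⟨M, hM⟩ := hg
  obtain ⟨p, hp⟩ := hN N le_rfl
  obtain ⟨q, hq⟩ := hM M le_rfl
  refine .of_exists (N := N + M) ⟨p * q, fun t => ?_⟩
  rw [Polynomial.eval_mul, ← hp, ← hq]; ring

theorem IsLaurentFun.sum {ι : Type*} (s : Finset ι) {f : ι → ℂˣ → ℂ}
    (hf : ∀ i ∈ s, IsLaurentFun (f i)) : IsLaurentFun fun z => ∑ i ∈ s, f i z := by
  classical
  induction s using Finset.induction_on with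
  | empty => simpa using IsLaurentFun.const 0
  | insert a s ha ih =>
    simp only [Finset.sum_insert ha]
    exact (hf a (by simp)).add (ih fun i hi => hf i (by simp [hi]))

theorem IsLaurentFun.mvPolynomial_eval {σ : Type*} {f : σ → ℂˣ → ℂ} (hf : ∀ i, IsLaurentFun (f i))
    (q : MvPolynomial σ ℂ) : IsLaurentFun fun z => MvPolynomial.eval (fun i => f i z) q := by
  induction q using MvPolynomial.induction_on with
  | C a => simpa using IsLaurentFun.const a
  | add p q hp hq => simpa using hp.add hq
  | mul_X p i hp => simpa using hp.mul (hf i)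

theorem IsLaurentFun.comp_inv {f : ℂˣ → ℂ} {P : MvPolynomial (Fin 2) ℂ}
    (h : ∀ t : ℂˣ, f t = MvPolynomial.eval ![(t : ℂ), ((t⁻¹ : ℂˣ) : ℂ)] P) :
    IsLaurentFun f ∧ IsLaurentFun fun t => f t⁻¹ := by
  constructor
  · have := IsLaurentFun.mvPolynomial_eval
      (f := fun i t => (![(t : ℂ), ((t⁻¹ : ℂˣ) : ℂ)] : Fin 2 → ℂ) i) (fun i => by
        fin_cases i
        · exact IsLaurentFun.coe
        · exact IsLaurentFun.coe_inv) P
    exact (funext h : f = _) ▸ this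
  · have := IsLaurentFun.mvPolynomial_eval
      (f := fun i t => (![((t⁻¹ : ℂˣ) : ℂ), (t : ℂ)] : Fin 2 → ℂ) i) (fun i => by
        fin_cases i
        · exact IsLaurentFun.coe_inv
        · exact IsLaurentFun.coe) P
    have e : (fun t => f t⁻¹) = fun t : ℂˣ => MvPolynomial.eval
        (fun i => (![((t⁻¹ : ℂˣ) : ℂ), (t : ℂ)] : Fin 2 → ℂ) i) P := by
      funext t
      rw [h, inv_inv]
    rw [e]
    exact this

variable {n : ℕ}

/-- A matrix-valued Laurent polynomial on `ℂˣ`, with coefficients shifted by a common power. -/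
theorem exists_matrix_laurent_coeff {M : ℂˣ → CMat n}
    (h : ∀ i j, IsLaurentFun fun t => M t i j) :
    ∃ (N L : ℕ) (A : ℕ → CMat n), ∀ t : ℂˣ,
      (t : ℂ) ^ N • M t = ∑ k ∈ Finset.range L, (t : ℂ) ^ k • A k := by
  choose N hN using h
  let N' := ∑ i, ∑ j, N i j
  have hN' : ∀ i j, N i j ≤ N' := fun i j =>
    (Finset.single_le_sum (f := fun j => N i j) (fun _ _ => Nat.zero_le _)
      (Finset.mem_univ j)).trans
    (Finset.single_le_sum (f := fun i => ∑ j, N i j) (fun _ _ => Nat.zero_le _)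
      (Finset.mem_univ i))
  choose p hp using fun i j => hN i j N' (hN' i j)
  let L := ∑ i, ∑ j, ((p i j).natDegree + 1)
  have hL : ∀ i j, (p i j).natDegree < L := fun i j =>
    Nat.lt_of_succ_le ((Finset.single_le_sum (f := fun j => (p i j).natDegree + 1)
      (fun _ _ => Nat.zero_le _) (Finset.mem_univ j)).trans
    (Finset.single_le_sum (f := fun i => ∑ j, ((p i j).natDegree + 1)) (fun _ _ => Nat.zero_le _)
      (Finset.mem_univ i)))
  refine ⟨N', L, fun k => Matrix.of fun i j => (p i j).coeff k, fun t => ?_⟩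
  ext i j
  rw [Matrix.smul_apply, smul_eq_mul, hp i j t, Polynomial.eval_eq_sum_range' (hL i j),
    Matrix.sum_apply]
  exact Finset.sum_congr rfl fun k _ => by simp [mul_comm]

namespace InternallyGradedGroup

variable (𝓗 : InternallyGradedGroup n)

theorem isNilpotent_of_mem {A : CMat n} (hA : A ∈ lieSet 𝓗.U) : IsNilpotent A :=
  isNilpotent_of_mem_lieSet 𝓗.U_unipotent.unipotent hA

/-- The Lie algebra of `U` is complex: `exp (z A)` is polynomial in `z`, and lies in `U` for real `z`. -/
theorem expGL_smul_mem {A : CMat n} (hA : A ∈ lieSet 𝓗.U) (z : ℂ) : expGL (z • A) ∈ 𝓗.U := by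
  refine 𝓗.U_unipotent.closed.mem_of_isPolyMat
    (isPolyMat_exp_smul (𝓗.isNilpotent_of_mem hA)) (γ := fun z => expGL (z • A)) ?_ z
  refine infinite_range_ofReal.mono ?_
  rintro _ ⟨t, rfl⟩
  simpa using hA t

/-- The Lie algebra of the unipotent radical, as a complex vector space. -/
noncomputable def lieU : Submodule ℂ (CMat n) where
  carrier := lieSet 𝓗.U
  zero_mem' := (lieAlgebra 𝓗.U 𝓗.U_unipotent.closed.isClosed).zero_mem
  add_mem' := (lieAlgebra 𝓗.U 𝓗.U_unipotent.closed.isClosed).add_mem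
  smul_mem' := fun c A hA t => by
    rw [← Complex.coe_smul, smul_smul]
    exact 𝓗.expGL_smul_mem hA _

theorem expGL_mem_U {A : CMat n} (hA : A ∈ 𝓗.lieU) : expGL A ∈ 𝓗.U := expGL_mem_of_mem_lieSet hA

theorem lieU_le {A : CMat n} (hA : A ∈ 𝓗.lieU) : A ∈ lieSet 𝓗.H :=
  fun t => 𝓗.U_unipotent.le (hA t)

/-- Unipotent groups are the exponentials of their Lie algebras: the powers of `u` lie on a polynomial
one-parameter group, which is contained in the Zariski closed group `U`. -/
theorem exists_expGL_eq {u : CGL n} (hu : u ∈ 𝓗.U) : ∃ A ∈ 𝓗.lieU, expGL A = u := by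
  obtain ⟨A, hA, hpoly⟩ :=
    exists_expGL_eq_of_isNilpotent_sub_one (𝓗.U_unipotent.unipotent u hu)
  refine ⟨A, fun t => ?_, hA⟩
  have := 𝓗.U_unipotent.closed.mem_of_isPolyMat hpoly (infinite_range_natCast.mono ?_) (t : ℂ)
  · simpa using this
  · rintro _ ⟨k, rfl⟩
    have : expGL ((k : ℂ) • A) = u ^ k := by
      rw [Nat.cast_smul_eq_nsmul, expGL_nsmul, hA]
    rw [mem_ofPred_eq, this]
    exact 𝓗.U.pow_mem hu k

/-- The exponential has trivial kernel on nilpotent matrices: `exp (z A)` is polynomial in `z` and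
equal to `1` for all natural numbers `z`. -/
theorem eq_zero_of_expGL_eq_one {A : CMat n} (hA : A ∈ 𝓗.lieU) (h : expGL A = 1) : A = 0 := by
  refine matrix_exp_smul_injective fun t => ?_
  ext i j
  have := (isPolyMat_exp_smul (𝓗.isNilpotent_of_mem hA) i j).eq_of_infinite
    (.const ((1 : CMat n) i j)) (infinite_range_natCast.mono ?_) (t : ℂ)
  · simpa using this
  · rintro _ ⟨k, rfl⟩
    have : expGL ((k : ℂ) • A) = 1 := by
      rw [Nat.cast_smul_eq_nsmul, expGL_nsmul, h, one_pow]
    have h2 : (expGL ((k : ℂ) • A) : CMat n) i j = ((1 : CGL n) : CMat n) i j := by rw [this]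
    exact h2

theorem conj_mem_lieU {A : CMat n} (hA : A ∈ 𝓗.lieU) {h : CGL n} (hh : h ∈ 𝓗.H) :
    (h : CMat n) * A * ((h⁻¹ : CGL n) : CMat n) ∈ 𝓗.lieU := fun t => by
  have : t • ((h : CMat n) * A * ((h⁻¹ : CGL n) : CMat n)) =
      (h : CMat n) * (t • A) * ((h⁻¹ : CGL n) : CMat n) := by
    rw [Matrix.mul_smul, Matrix.smul_mul]
  rw [this, expGL_conj]
  exact 𝓗.U_unipotent.normal h hh _ (hA t)

/-- The adjoint action of `lam t` on matrices. -/
noncomputable def adLam (t : ℂˣ) (A : CMat n) : CMat n :=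
  ((𝓗.lam t : CGL n) : CMat n) * A * (((𝓗.lam t : CGL n)⁻¹ : CGL n) : CMat n)

theorem adLam_mem_lieU {A : CMat n} (hA : A ∈ 𝓗.lieU) (t : ℂˣ) : 𝓗.adLam t A ∈ 𝓗.lieU :=
  𝓗.conj_mem_lieU hA (𝓗.lam t).2

theorem adLam_mul (s t : ℂˣ) (A : CMat n) : 𝓗.adLam (s * t) A = 𝓗.adLam s (𝓗.adLam t A) := by
  simp only [adLam, map_mul, Subgroup.coe_mul, mul_inv_rev, Units.val_mul, Matrix.mul_assoc]

theorem adLam_smul (t : ℂˣ) (c : ℂ) (A : CMat n) : 𝓗.adLam t (c • A) = c • 𝓗.adLam t A := by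
  simp only [adLam, Matrix.mul_smul, Matrix.smul_mul]

theorem adLam_sum (t : ℂˣ) {ι : Type*} (s : Finset ι) (A : ι → CMat n) :
    𝓗.adLam t (∑ i ∈ s, A i) = ∑ i ∈ s, 𝓗.adLam t (A i) := by
  simp only [adLam, Matrix.mul_sum, Matrix.sum_mul]

theorem lam_inv_coe (t : ℂˣ) : ((𝓗.lam t : CGL n)⁻¹ : CGL n) = (𝓗.lam t⁻¹ : CGL n) := by
  rw [map_inv]; rfl

/-- As all weights are positive, the adjoint action of `lam t` on the Lie algebra of the unipotent
radical is polynomial in `t`, without constant term. -/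
theorem exists_adLam_eq_sum {A : CMat n} (hA : A ∈ 𝓗.lieU) :
    ∃ (L : ℕ) (C : ℕ → CMat n), ∀ t : ℂˣ,
      𝓗.adLam t A = ∑ k ∈ Finset.range L, (t : ℂ) ^ (k + 1) • C k := by
  have hL : ∀ i j, IsLaurentFun fun t => ((𝓗.lam t : CGL n) : CMat n) i j := fun i j => by
    obtain ⟨P, hP⟩ := 𝓗.lam_regular i j
    exact (IsLaurentFun.comp_inv hP).1
  have hLi : ∀ i j, IsLaurentFun fun t => (((𝓗.lam t : CGL n)⁻¹ : CGL n) : CMat n) i j :=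
    fun i j => by
      obtain ⟨P, hP⟩ := 𝓗.lam_regular i j
      simp only [lam_inv_coe]
      exact (IsLaurentFun.comp_inv hP).2
  obtain ⟨N, L, C, hC⟩ := exists_matrix_laurent_coeff (M := fun t => 𝓗.adLam t A) fun i j => by
    simp only [adLam, Matrix.mul_apply]
    exact IsLaurentFun.sum _ fun k _ =>
      (IsLaurentFun.sum _ fun l _ => (hL i l).mul (.const _)).mul (hLi k j)
  have hmem : ∀ k < L, C k ∈ 𝓗.lieU := fun k hk => by
    by_contra hn
    obtain ⟨ℓ, hℓ, hker⟩ := Submodule.exists_le_ker_of_notMem hn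
    refine hℓ ?_
    refine coeff_eq_zero_of_forall_units (c := fun k => ℓ (C k)) (fun t => ?_) hk
    have h1 := congrArg ℓ (hC t)
    rw [map_smul, map_sum, LinearMap.mem_ker.1 (hker (𝓗.adLam_mem_lieU hA t)), smul_zero] at h1
    simpa using h1.symm
  have hw : ∀ k < L, ∀ s : ℂˣ, 𝓗.adLam s (C k) = (s : ℂ) ^ ((k : ℤ) - N) • C k :=
      fun k hk s => by
    have h1 : ∀ t : ℂˣ, ∑ k ∈ Finset.range L, (t : ℂ) ^ k •
        ((s : ℂ) ^ k • C k - (s : ℂ) ^ N • 𝓗.adLam s (C k)) = 0 := fun t => by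
      have h2 : ∑ k ∈ Finset.range L, (t : ℂ) ^ k • ((s : ℂ) ^ k • C k) =
          ((s : ℂ) * t) ^ N • 𝓗.adLam (s * t) A := by
        rw [← Units.val_mul, hC]
        refine Finset.sum_congr rfl fun k _ => ?_
        rw [smul_smul, Units.val_mul, mul_pow, mul_comm]
      have h3 : ∑ k ∈ Finset.range L, (t : ℂ) ^ k • ((s : ℂ) ^ N • 𝓗.adLam s (C k)) =
          ((s : ℂ) * t) ^ N • 𝓗.adLam (s * t) A := by
        rw [adLam_mul, mul_pow, mul_smul, ← adLam_smul 𝓗 s ((t : ℂ) ^ N), hC, adLam_sum,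
          Finset.smul_sum]
        refine Finset.sum_congr rfl fun k _ => ?_
        rw [adLam_smul, smul_comm]
      simp only [smul_sub, Finset.sum_sub_distrib, h2, h3, sub_self]
    have h4 := sub_eq_zero.1 (matrix_coeff_eq_zero_of_forall_units h1 hk)
    rw [zpow_sub₀ s.ne_zero, zpow_natCast, zpow_natCast, div_eq_inv_mul, mul_smul, h4,
      inv_smul_smul₀ (pow_ne_zero _ s.ne_zero)]
  have hz : ∀ k < L, k ≤ N → C k = 0 := fun k hk hkN => by
    by_contra hne
    have := 𝓗.weights_pos ((k : ℤ) - N) (C k) (hmem k hk) hne (hw k hk)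
    omega
  let C' : ℕ → CMat n := fun k => if k < L then C k else 0
  refine ⟨L, fun k => C' (N + 1 + k), fun t => ?_⟩
  have h1 : ∑ k ∈ Finset.range L, (t : ℂ) ^ k • C k =
      ∑ k ∈ Finset.range (N + 1 + L), (t : ℂ) ^ k • C' k := by
    rw [← Finset.sum_subset (Finset.range_mono (show L ≤ N + 1 + L by omega))]
    · refine Finset.sum_congr rfl fun k hk => ?_
      simp [C', Finset.mem_range.1 hk]
    · intro k _ hk
      have : ¬ k < L := by simpa using hk
      simp [C', this]
  have h2 : ∑ k ∈ Finset.range (N + 1), (t : ℂ) ^ k • C' k = 0 :=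
    Finset.sum_eq_zero fun k hk => by
      by_cases hkL : k < L
      · have : k ≤ N := by have := Finset.mem_range.1 hk; omega
        simp [C', hkL, hz k hkL this]
      · simp [C', hkL]
  have h3 := hC t
  rw [h1, Finset.sum_range_add, h2, zero_add] at h3
  have h4 : ∀ k, (t : ℂ) ^ (N + 1 + k) • C' (N + 1 + k) =
      (t : ℂ) ^ N • ((t : ℂ) ^ (k + 1) • C' (N + 1 + k)) := fun k => by
    rw [smul_smul, ← pow_add]; congr 2; ring
  simp only [h4, ← Finset.smul_sum] at h3
  exact smul_right_injective _ (pow_ne_zero N t.ne_zero) h3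

end InternallyGradedGroup

/-- The unit `exp w` of `ℂ`. -/
noncomputable def expUnit (w : ℂ) : ℂˣ := Units.mk0 (Complex.exp w) (Complex.exp_ne_zero _)

@[simp] theorem expUnit_coe (w : ℂ) : (expUnit w : ℂ) = Complex.exp w := rfl

theorem expUnit_add (v w : ℂ) : expUnit (v + w) = expUnit v * expUnit w :=
  Units.ext (Complex.exp_add v w)

theorem expUnit_zero : expUnit 0 = 1 := Units.ext Complex.exp_zero

theorem expUnit_neg (w : ℂ) : expUnit (-w) = (expUnit w)⁻¹ := by
  rw [eq_inv_iff_mul_eq_one, ← expUnit_add, neg_add_cancel, expUnit_zero]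

theorem exists_expUnit_eq (t : ℂˣ) : ∃ w, expUnit w = t :=
  ⟨Complex.log t, Units.ext (Complex.exp_log t.ne_zero)⟩

theorem norm_expUnit_mul_I (θ : ℝ) : ‖(expUnit (θ * Complex.I) : ℂ)‖ = 1 :=
  Complex.norm_exp_ofReal_mul_I θ

namespace InternallyGradedGroup

variable (𝓗 : InternallyGradedGroup n)

theorem tendsto_adLam_atBot {A : CMat n} (hA : A ∈ 𝓗.lieU) :
    Tendsto (fun s : ℝ => 𝓗.adLam (expUnit s) A) atBot (𝓝 0) := by
  obtain ⟨L, C, hC⟩ := 𝓗.exists_adLam_eq_sum hA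
  simp only [hC]
  have h0 : Tendsto (fun s : ℝ => (expUnit s : ℂ)) atBot (𝓝 0) := by
    have := (Complex.continuous_ofReal.tendsto 0).comp Real.tendsto_exp_atBot
    refine (this.congr fun s => ?_)
    simp
  have h1 : Tendsto (fun s : ℝ => ∑ k ∈ Finset.range L, (expUnit s : ℂ) ^ (k + 1) • C k) atBot
      (𝓝 (∑ k ∈ Finset.range L, (0 : ℂ) ^ (k + 1) • C k)) :=
    tendsto_finsetSum _ fun k _ => (h0.pow (k + 1)).smul_const (C k)
  simpa using h1

theorem continuous_adLam {A : CMat n} (hA : A ∈ 𝓗.lieU) :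
    Continuous fun s : ℝ => 𝓗.adLam (expUnit s) A := by
  obtain ⟨L, C, hC⟩ := 𝓗.exists_adLam_eq_sum hA
  simp only [hC, expUnit_coe]
  fun_prop

/-- A compact group of unipotent matrices is trivial: the polynomial `z ↦ exp (z A)` is bounded on
the natural numbers, hence constant. -/
theorem eq_one_of_mem_U_of_mem_Q {v : CGL n} (hU : v ∈ 𝓗.U) (hQ : v ∈ 𝓗.Q) : v = 1 := by
  obtain ⟨A, hA, rfl⟩ := 𝓗.exists_expGL_eq hU
  refine Units.ext ?_
  ext i j
  obtain ⟨p, hp'⟩ := isPolyMat_exp_smul (𝓗.isNilpotent_of_mem hA) i j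
  have hp : ∀ z : ℂ, (expGL (z • A) : CMat n) i j = p.eval z := hp'
  have hcont : Continuous fun g : CGL n => ((g : CMat n) i j) :=
    (continuous_apply_apply (ρ := fun _ _ => ℂ) i j).comp isOpenEmbedding_glVal.continuous
  obtain ⟨R, hR⟩ := (𝓗.Q_compact.image hcont).isBounded.exists_norm_le
  have hb : ∀ k : ℕ, ‖p.eval (k : ℂ)‖ ≤ R := fun k => by
    rw [← hp, Nat.cast_smul_eq_nsmul, expGL_nsmul]
    exact hR _ ⟨_, 𝓗.Q.pow_mem hQ k, rfl⟩
  have hdeg : ¬ 0 < p.degree := fun hd => by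
    have h1 : Tendsto (fun k : ℕ => ‖p.eval (k : ℂ)‖) atTop atTop :=
      p.tendsto_norm_atTop hd (by simpa using tendsto_natCast_atTop_atTop)
    obtain ⟨k, hk⟩ := (h1.eventually (eventually_gt_atTop R)).exists
    exact absurd (hb k) (not_le.2 hk)
  have hc := Polynomial.eq_C_of_degree_le_zero (not_lt.1 hdeg)
  have h1 := hp 1
  have h0 := hp 0
  rw [hc, Polynomial.eval_C] at h0 h1
  rw [one_smul] at h1
  rw [zero_smul, expGL_zero] at h0
  rw [h1, ← h0]

/-- Elements of `Q` commute with `lam (S¹)`: the commutator lies in `U` as `lam` is central in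
`R ≅ H / U`, and it lies in the compact group `Q`. -/
theorem commute_of_mem_Q {q : CGL n} (hq : q ∈ 𝓗.Q) {t : ℂˣ} (ht : ‖(t : ℂ)‖ = 1) :
    q * (𝓗.lam t : CGL n) = (𝓗.lam t : CGL n) * q := by
  have h1 : q * (𝓗.lam t : CGL n) * q⁻¹ * (𝓗.lam t : CGL n)⁻¹ ∈ 𝓗.Q :=
    𝓗.Q.mul_mem (𝓗.Q.mul_mem (𝓗.Q.mul_mem hq (𝓗.lam_circle t ht)) (𝓗.Q.inv_mem hq))
      (𝓗.Q.inv_mem (𝓗.lam_circle t ht))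
  have h2 : q * (𝓗.lam t : CGL n) * q⁻¹ * (𝓗.lam t : CGL n)⁻¹ ∈ 𝓗.U := by
    obtain ⟨u, hu, r, hr, rfl⟩ := 𝓗.U_mul_R q (𝓗.Q_le hq)
    have h3 : u * r * (𝓗.lam t : CGL n) * (u * r)⁻¹ * (𝓗.lam t : CGL n)⁻¹ =
        u * ((𝓗.lam t : CGL n) * u⁻¹ * (𝓗.lam t : CGL n)⁻¹) := by
      have h4 := 𝓗.lam_central t r hr
      rw [mul_assoc u r, ← h4]
      group
    rw [h3]
    exact 𝓗.U.mul_mem hu (𝓗.U_unipotent.normal _ (𝓗.lam t).2 _ (𝓗.U.inv_mem hu))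
  have h5 := 𝓗.eq_one_of_mem_U_of_mem_Q h2 h1
  rwa [mul_inv_eq_one, mul_inv_eq_iff_eq_mul] at h5

end InternallyGradedGroup

end Graded

/-! ### The derivative of a homomorphism of algebraic groups -/

section Derivative

theorem toSub_coe {n : ℕ} {S : Subgroup (CGL n)} {g : CGL n} (hg : g ∈ S) :
    (toSub S g : CGL n) = g := by simp [toSub, hg]

theorem toSub_coe_self {n : ℕ} {S : Subgroup (CGL n)} (g : S) : toSub S (g : CGL n) = g :=
  Subtype.ext (toSub_coe g.2)

theorem toSub_mul {n : ℕ} {S : Subgroup (CGL n)} {g h : CGL n} (hg : g ∈ S) (hh : h ∈ S) :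
    toSub S (g * h) = toSub S g * toSub S h :=
  Subtype.ext (by rw [toSub_coe (S.mul_mem hg hh), Subgroup.coe_mul, toSub_coe hg, toSub_coe hh])

theorem toSub_inv {n : ℕ} {S : Subgroup (CGL n)} {g : CGL n} (hg : g ∈ S) :
    toSub S g⁻¹ = (toSub S g)⁻¹ :=
  Subtype.ext (by rw [toSub_coe (S.inv_mem hg), Subgroup.coe_inv, toSub_coe hg])

theorem toSub_one {n : ℕ} {S : Subgroup (CGL n)} : toSub S (1 : CGL n) = 1 :=
  Subtype.ext (by rw [toSub_coe S.one_mem, Subgroup.coe_one])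

theorem exists_linear_hasDerivAt_mvPolynomial_eval {σ : Type*} (P : MvPolynomial σ ℂ)
    (x : σ → ℂ) : ∃ ℓ : (σ → ℂ) →ₗ[ℂ] ℂ, ∀ (c : ℝ → σ → ℂ) (v : σ → ℂ), c 0 = x →
      (∀ i, HasDerivAt (fun t => c t i) (v i) 0) →
      HasDerivAt (fun t => MvPolynomial.eval (c t) P) (ℓ v) 0 := by
  induction P using MvPolynomial.induction_on with
  | C a => exact ⟨0, fun c v _ _ => by simpa using hasDerivAt_const (0 : ℝ) a⟩
  | add p q hp hq =>
    obtain ⟨ℓ, hℓ⟩ := hp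
    obtain ⟨ℓ', hℓ'⟩ := hq
    exact ⟨ℓ + ℓ', fun c v h0 hv => by
      simp only [map_add, LinearMap.add_apply]
      exact (hℓ c v h0 hv).add (hℓ' c v h0 hv)⟩
  | mul_X p i hp =>
    obtain ⟨ℓ, hℓ⟩ := hp
    refine ⟨x i • ℓ + MvPolynomial.eval x p • LinearMap.proj i, fun c v h0 hv => ?_⟩
    have := (hℓ c v h0 hv).mul (hv i)
    rw [h0] at this
    have e : (x i • ℓ + MvPolynomial.eval x p • LinearMap.proj i : (σ → ℂ) →ₗ[ℂ] ℂ) v =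
        ℓ v * x i + MvPolynomial.eval x p * v i := by
      simp [mul_comm]
    rw [e]
    simp only [map_mul, MvPolynomial.eval_X]
    exact this

theorem differentiable_mvPolynomial_eval {σ : Type*} {f : σ → ℂ → ℂ}
    (hf : ∀ i, Differentiable ℂ (f i)) (q : MvPolynomial σ ℂ) :
    Differentiable ℂ fun z => MvPolynomial.eval (fun i => f i z) q := by
  induction q using MvPolynomial.induction_on with
  | C a => simp
  | add p q hp hq =>
    simp only [map_add]
    exact hp.add hq
  | mul_X p i hp =>
    simp only [map_mul, MvPolynomial.eval_X]
    exact hp.mul (hf i)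

/-- A regular function has, in the directions of the Lie algebra, a derivative at the identity that
extends complex-linearly to all matrices. -/
theorem IsRegularFun.exists_linear_hasDerivAt {n : ℕ} {H : Subgroup (CGL n)} {f : H → ℂ}
    (hf : IsRegularFun f) : ∃ ℓ : CMat n →ₗ[ℂ] ℂ, ∀ A ∈ lieSet H,
      HasDerivAt (fun t : ℝ => f (toSub H (expGL (t • A)))) (ℓ A) 0 := by
  obtain ⟨P, hP⟩ := hf
  obtain ⟨ℓ, hℓ⟩ := exists_linear_hasDerivAt_mvPolynomial_eval P
    (Sum.elim (fun ij => (1 : CMat n) ij.1 ij.2) (fun ij => (1 : CMat n) ij.1 ij.2))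
  let J : CMat n →ₗ[ℂ] ((Fin n × Fin n) ⊕ (Fin n × Fin n) → ℂ) :=
    { toFun := fun A => Sum.elim (fun ij => A ij.1 ij.2) (fun ij => -A ij.1 ij.2)
      map_add' := fun A B => by
        funext i; rcases i with i | i
        · simp
        · simp [add_comm]
      map_smul' := fun c A => by
        funext i; rcases i with i | i <;> simp }
  refine ⟨ℓ ∘ₗ J, fun A hA => ?_⟩
  have h1 : ∀ t : ℝ, f (toSub H (expGL (t • A))) = MvPolynomial.eval
      (Sum.elim (fun ij => (expGL (t • A) : CMat n) ij.1 ij.2)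
        (fun ij => (expGL (t • (-A)) : CMat n) ij.1 ij.2)) P := fun t => by
    rw [hP, toSub_coe (hA t), ← expGL_neg, smul_neg]
  simp only [h1]
  refine hℓ _ (J A) ?_ ?_
  · simp [expGL_zero]
  · rintro (i | i)
    · exact hasDerivAt_matrix_exp_smul (𝕜 := ℝ) A i.1 i.2
    · exact hasDerivAt_matrix_exp_smul (𝕜 := ℝ) (-A) i.1 i.2

namespace InternallyGradedGroup

variable {n : ℕ} (𝓗 : InternallyGradedGroup n)

theorem differentiable_lam_expUnit (i j : Fin n) :
    Differentiable ℂ fun w => ((𝓗.lam (expUnit w) : CGL n) : CMat n) i j := by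
  obtain ⟨P, hP⟩ := 𝓗.lam_regular i j
  have h : ∀ w, ((𝓗.lam (expUnit w) : CGL n) : CMat n) i j = MvPolynomial.eval
      (fun k => (![fun w => Complex.exp w, fun w => Complex.exp (-w)] : Fin 2 → ℂ → ℂ) k w) P :=
      fun w => by
    rw [hP, ← expUnit_neg]
    congr 2
    funext k
    fin_cases k <;> simp
  simp only [h]
  refine differentiable_mvPolynomial_eval (fun k => ?_) P
  fin_cases k
  · exact Complex.differentiable_exp
  · exact Complex.differentiable_exp.comp differentiable_neg

theorem exists_lam_eq_expGL : ∃ L : CMat n, ∀ w : ℂ, (𝓗.lam (expUnit w) : CGL n) = expGL (w • L) :=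
  ⟨Matrix.of fun i j => deriv (fun w => ((𝓗.lam (expUnit w) : CGL n) : CMat n) i j) 0,
    eq_expGL_of_hasDerivAt_zero (p := fun w => (𝓗.lam (expUnit w) : CGL n))
      (fun s t => by simp only [expUnit_add, map_mul, Subgroup.coe_mul])
      fun i j => (𝓗.differentiable_lam_expUnit i j 0).hasDerivAt⟩

theorem lam_circle_eq_expGL (θ : ℝ) :
    (𝓗.lam (expUnit (θ * Complex.I)) : CGL n) = expGL (θ • 𝓗.circleGen) := by
  obtain ⟨L, hL⟩ := 𝓗.exists_lam_eq_expGL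
  have h1 : ∀ θ : ℝ, (𝓗.lam (expUnit (θ * Complex.I)) : CGL n) = expGL (θ • (Complex.I • L)) :=
    fun θ => by rw [hL, mul_smul, Complex.coe_smul]
  have h2 : 𝓗.circleGen = Complex.I • L := by
    ext i j
    refine HasDerivAt.deriv ?_
    have h3 : (fun θ : ℝ => ((𝓗.lam (expUnit (θ * Complex.I)) : CGL n) : CMat n) i j) =
        fun θ : ℝ => (expGL (θ • (Complex.I • L)) : CMat n) i j := by
      funext θ; rw [h1]
    exact h3 ▸ hasDerivAt_matrix_exp_smul (𝕜 := ℝ) (Complex.I • L) i j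
  rw [h1, h2]

theorem circleGen_mem_Q : 𝓗.circleGen ∈ lieSet 𝓗.Q := fun t => by
  rw [← lam_circle_eq_expGL]
  exact 𝓗.lam_circle _ (norm_expUnit_mul_I t)

theorem lieQ_le {A : CMat n} (hA : A ∈ lieSet 𝓗.Q) : A ∈ lieSet 𝓗.H := fun t => 𝓗.Q_le (hA t)

end InternallyGradedGroup

namespace HamiltonianHAction

variable {n m : ℕ}
  {EY : Type*} [NormedAddCommGroup EY] [NormedSpace ℂ EY]
  {Y : Type*} [TopologicalSpace Y] [ChartedSpace EY Y]
  {EX : Type*} [NormedAddCommGroup EX] [NormedSpace ℂ EX]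
  {X : Type*} [TopologicalSpace X] [ChartedSpace EX X]
  (D : HamiltonianHAction n m EY Y EX X)

/-- The derivative of `ρ` exists on the Lie algebra of `H` and extends complex-linearly to all
matrices. -/
theorem exists_linear_dRho : ∃ ℓ : CMat n →ₗ[ℂ] CMat m, ∀ A ∈ lieSet D.grp.H,
    D.dRho A = ℓ A ∧ ∀ i j, HasDerivAt (fun t : ℝ =>
      ((D.rho (toSub D.grp.H (expGL (t • A))) : CGL m) : CMat m) i j) (ℓ A i j) 0 := by
  choose ℓ hℓ using fun i j => (D.rho_regular i j).exists_linear_hasDerivAt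
  refine ⟨{ toFun := fun A => Matrix.of fun i j => ℓ i j A
            map_add' := fun A B => by ext i j; simp
            map_smul' := fun c A => by ext i j; simp }, fun A hA => ⟨?_, fun i j => hℓ i j A hA⟩⟩
  ext i j
  exact (hℓ i j A hA).deriv

/-- The complex-linear extension of the derivative of `ρ` to all matrices. -/
noncomputable def dRhoLin : CMat n →ₗ[ℂ] CMat m := D.exists_linear_dRho.choose

theorem dRho_eq {A : CMat n} (hA : A ∈ lieSet D.grp.H) : D.dRho A = D.dRhoLin A :=
  (D.exists_linear_dRho.choose_spec A hA).1

theorem rho_expGL {A : CMat n} (hA : A ∈ lieSet D.grp.H) (t : ℝ) :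
    (D.rho (toSub D.grp.H (expGL (t • A))) : CGL m) = expGL (t • D.dRho A) := by
  rw [D.dRho_eq hA]
  refine eq_expGL_of_hasDerivAt_zero
    (p := fun t : ℝ => (D.rho (toSub D.grp.H (expGL (t • A))) : CGL m)) (fun s t => ?_)
    (D.exists_linear_dRho.choose_spec A hA).2 t
  rw [expGL_add_smul, toSub_mul (hA s) (hA t), map_mul, Subgroup.coe_mul]

theorem rho_expGL_one {A : CMat n} (hA : A ∈ lieSet D.grp.H) :
    (D.rho (toSub D.grp.H (expGL A)) : CGL m) = expGL (D.dRho A) := by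
  simpa using D.rho_expGL hA 1

theorem dRho_mem {A : CMat n} (hA : A ∈ lieSet D.grp.H) : D.dRho A ∈ lieSet D.amb.G := fun t => by
  rw [← D.rho_expGL hA]
  exact (D.rho _).2

theorem dRho_mem_K {A : CMat n} (hA : A ∈ lieSet D.grp.Q) : D.dRho A ∈ lieSet D.amb.K := fun t => by
  rw [← D.rho_expGL (D.grp.lieQ_le hA)]
  refine D.rho_Q _ ?_
  rw [toSub_coe (D.grp.Q_le (hA t))]
  exact hA t

theorem dRho_conj {A : CMat n} (hA : A ∈ lieSet D.grp.H) (h : D.grp.H) :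
    D.dRho (((h : CGL n) : CMat n) * A * (((h : CGL n)⁻¹ : CGL n) : CMat n)) =
      ((D.rho h : CGL m) : CMat m) * D.dRho A * (((D.rho h : CGL m)⁻¹ : CGL m) : CMat m) := by
  have e : ∀ t : ℝ, t • (((h : CGL n) : CMat n) * A * (((h : CGL n)⁻¹ : CGL n) : CMat n)) =
      ((h : CGL n) : CMat n) * (t • A) * (((h : CGL n)⁻¹ : CGL n) : CMat n) := fun t => by
    rw [Matrix.mul_smul, Matrix.smul_mul]
  have hA' : ((h : CGL n) : CMat n) * A * (((h : CGL n)⁻¹ : CGL n) : CMat n) ∈ lieSet D.grp.H :=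
      fun t => by
    rw [e, expGL_conj]
    exact D.grp.H.mul_mem (D.grp.H.mul_mem h.2 (hA t)) (D.grp.H.inv_mem h.2)
  refine expGL_smul_injective fun t => ?_
  have e2 : t • (((D.rho h : CGL m) : CMat m) * D.dRho A *
      (((D.rho h : CGL m)⁻¹ : CGL m) : CMat m)) = ((D.rho h : CGL m) : CMat m) * (t • D.dRho A) *
      (((D.rho h : CGL m)⁻¹ : CGL m) : CMat m) := by
    rw [Matrix.mul_smul, Matrix.smul_mul]
  have e3 : toSub D.grp.H ((h : CGL n) * expGL (t • A) * (h : CGL n)⁻¹) =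
      h * toSub D.grp.H (expGL (t • A)) * h⁻¹ := by
    rw [toSub_mul (D.grp.H.mul_mem h.2 (hA t)) (D.grp.H.inv_mem h.2), toSub_mul h.2 (hA t),
      toSub_coe_self, toSub_inv h.2, toSub_coe_self]
  rw [← D.rho_expGL hA', e, expGL_conj, e3, e2, expGL_conj, ← D.rho_expGL hA, map_mul, map_mul,
    map_inv]
  rfl

/-- The generator of the circle `ρ (lam (S¹))` in the Lie algebra of `K`. -/
noncomputable def gen : CMat m := D.dRho D.grp.circleGen

theorem gen_mem : D.gen ∈ lieSet D.amb.K := D.dRho_mem_K D.grp.circleGen_mem_Q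

theorem rho_lam_circle (θ : ℝ) :
    (D.rho (D.grp.lam (expUnit (θ * Complex.I))) : CGL m) = expGL (θ • D.gen) := by
  rw [gen, ← D.rho_expGL (D.grp.lieQ_le D.grp.circleGen_mem_Q), ← D.grp.lam_circle_eq_expGL,
    toSub_coe_self]

/-- The homomorphism `w ↦ ρ (lam (exp w))` is holomorphic, hence an exponential, and its generator is
determined by its restriction to the circle. -/
theorem rho_lam_expUnit (w : ℂ) :
    (D.rho (D.grp.lam (expUnit w)) : CGL m) = expGL (w • (-Complex.I • D.gen)) := by
  have hd : ∀ i j, Differentiable ℂ fun w =>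
      ((D.rho (D.grp.lam (expUnit w)) : CGL m) : CMat m) i j := fun i j => by
    obtain ⟨P, hP⟩ := D.rho_regular i j
    have h : ∀ w, ((D.rho (D.grp.lam (expUnit w)) : CGL m) : CMat m) i j = MvPolynomial.eval
        (fun k => (Sum.elim
          (fun ij w => ((D.grp.lam (expUnit w) : CGL n) : CMat n) ij.1 ij.2)
          (fun ij w => ((D.grp.lam (expUnit (-w)) : CGL n) : CMat n) ij.1 ij.2) :
            (Fin n × Fin n) ⊕ (Fin n × Fin n) → ℂ → ℂ) k w) P := fun w => by
      refine (hP _).trans ?_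
      rw [D.grp.lam_inv_coe, ← expUnit_neg]
      congr 2
      funext k
      rcases k with k | k <;> rfl
    simp only [h]
    refine differentiable_mvPolynomial_eval (fun k => ?_) P
    rcases k with k | k
    · exact D.grp.differentiable_lam_expUnit k.1 k.2
    · exact (D.grp.differentiable_lam_expUnit k.1 k.2).comp differentiable_neg
  have hL := eq_expGL_of_hasDerivAt_zero (𝕜 := ℂ)
    (p := fun w => (D.rho (D.grp.lam (expUnit w)) : CGL m))
    (A := Matrix.of fun i j => deriv (fun w =>
      ((D.rho (D.grp.lam (expUnit w)) : CGL m) : CMat m) i j) 0)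
    (fun s t => by simp only [expUnit_add, map_mul, Subgroup.coe_mul])
    fun i j => (hd i j 0).hasDerivAt
  set L : CMat m := Matrix.of fun i j => deriv (fun w =>
      ((D.rho (D.grp.lam (expUnit w)) : CGL m) : CMat m) i j) 0
  have h2 : D.gen = Complex.I • L := expGL_smul_injective fun θ => by
    rw [← D.rho_lam_circle, hL, mul_smul, Complex.coe_smul]
  rw [hL, h2, smul_smul (-Complex.I)]
  simp

/-- A character is trivial on the Lie algebra of the unipotent radical: there `χ (exp (z A))` is a
polynomial in `z` with polynomial inverse. -/
theorem dChar_eq_zero {χ : D.grp.H →* ℂˣ} (hχ : IsRegularFun fun h => (χ h : ℂ)) {A : CMat n}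
    (hA : A ∈ D.grp.lieU) : D.dChar χ A = 0 := by
  obtain ⟨P, hP⟩ := hχ
  have hmem : ∀ z : ℂ, expGL (z • A) ∈ D.grp.H := fun z =>
    D.grp.U_unipotent.le (D.grp.expGL_smul_mem hA z)
  have hpoly : IsPolyFun fun z : ℂ => (χ (toSub D.grp.H (expGL (z • A))) : ℂ) := by
    have h : ∀ z : ℂ, (χ (toSub D.grp.H (expGL (z • A))) : ℂ) = MvPolynomial.eval
        (fun k => (Sum.elim (fun ij z => (expGL (z • A) : CMat n) ij.1 ij.2)
          (fun ij z => (expGL (z • (-A)) : CMat n) ij.1 ij.2) :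
            (Fin n × Fin n) ⊕ (Fin n × Fin n) → ℂ → ℂ) k z) P := fun z => by
      refine (hP _).trans ?_
      rw [toSub_coe (hmem z), ← expGL_neg, ← smul_neg]
      congr 2
      funext k
      rcases k with k | k <;> rfl
    simp only [h]
    refine IsPolyFun.mvPolynomial_eval (fun k => ?_) P
    rcases k with k | k
    · exact isPolyMat_exp_smul (D.grp.isNilpotent_of_mem hA) k.1 k.2
    · exact isPolyMat_exp_smul (D.grp.isNilpotent_of_mem hA).neg k.1 k.2
  obtain ⟨p, hp⟩ := hpoly
  have hroot : ∀ z, p.eval z ≠ 0 := fun z => by rw [← hp]; exact Units.ne_zero _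
  have hdeg : ¬ 0 < p.degree := fun hd => by
    obtain ⟨z, hz⟩ := Complex.exists_root hd
    exact hroot z hz
  have hc := Polynomial.eq_C_of_degree_le_zero (not_lt.1 hdeg)
  have hconst : (fun t : ℝ => (χ (toSub D.grp.H (expGL (t • A))) : ℂ)) = fun _ => p.coeff 0 := by
    funext t
    have := hp t
    rw [hc, Polynomial.eval_C] at this
    simpa using this
  rw [dChar, hconst, deriv_const]

/-- `Q` commutes with `lam (S¹)`, so its image fixes the generator of `ρ (lam (S¹))`. -/
theorem rho_commute_gen {q : D.grp.H} (hq : (q : CGL n) ∈ D.grp.Q) :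
    ((D.rho q : CGL m) : CMat m) * D.gen * (((D.rho q : CGL m)⁻¹ : CGL m) : CMat m) = D.gen := by
  refine expGL_smul_injective fun θ => ?_
  rw [← Matrix.smul_mul, ← Matrix.mul_smul, expGL_conj, ← D.rho_lam_circle]
  have h := D.grp.commute_of_mem_Q hq (norm_expUnit_mul_I θ)
  have h2 : q * D.grp.lam (expUnit (θ * Complex.I)) = D.grp.lam (expUnit (θ * Complex.I)) * q :=
    Subtype.ext h
  rw [mul_inv_eq_iff_eq_mul]
  have h3 := congrArg (fun x => (D.rho x : CGL m)) h2
  simpa using h3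

end HamiltonianHAction

end Derivative

/-! ### Complex manifolds as real manifolds -/

section RealStructure

variable {E : Type*} [NormedAddCommGroup E] [NormedSpace ℂ E]
  {M : Type*} [TopologicalSpace M] [ChartedSpace E M]
  {E' : Type*} [NormedAddCommGroup E'] [NormedSpace ℂ E']
  {M' : Type*} [TopologicalSpace M'] [ChartedSpace E' M']

theorem HasMFDerivAt.real_of_complex {f : M → M'} {x : M} {f' : E →L[ℂ] E'}
    (h : HasMFDerivAt 𝓘(ℂ, E) 𝓘(ℂ, E') f x f') :
    HasMFDerivAt 𝓘(ℝ, E) 𝓘(ℝ, E') f x (f'.restrictScalars ℝ : E →L[ℝ] E') := by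
  refine ⟨h.1, ?_⟩
  have h2 : HasFDerivWithinAt (writtenInExtChartAt 𝓘(ℂ, E) 𝓘(ℂ, E') x f) f' (range 𝓘(ℂ, E))
    (extChartAt 𝓘(ℂ, E) x x) := h.2
  exact h2.restrictScalars ℝ

theorem HasMFDerivAt.real_of_complex_prod {V : Type*} [NormedAddCommGroup V] [NormedSpace ℂ V]
    {f : V × M → M'} {x : V × M} {f' : V × E →L[ℂ] E'}
    (h : HasMFDerivAt (𝓘(ℂ, V).prod 𝓘(ℂ, E)) 𝓘(ℂ, E') f x f') :
    HasMFDerivAt (𝓘(ℝ, V).prod 𝓘(ℝ, E)) 𝓘(ℝ, E') f x (f'.restrictScalars ℝ : V × E →L[ℝ] E') := by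
  refine ⟨h.1, ?_⟩
  have h2 : HasFDerivWithinAt (writtenInExtChartAt (𝓘(ℂ, V).prod 𝓘(ℂ, E)) 𝓘(ℂ, E') x f) f'
    (range (𝓘(ℂ, V).prod 𝓘(ℂ, E))) (extChartAt (𝓘(ℂ, V).prod 𝓘(ℂ, E)) x x) := h.2
  exact h2.restrictScalars ℝ

theorem ContMDiffAt.real_of_complex {f : M → M'} {x : M} {n : WithTop ℕ∞}
    (h : ContMDiffAt 𝓘(ℂ, E) 𝓘(ℂ, E') n f x) : ContMDiffAt 𝓘(ℝ, E) 𝓘(ℝ, E') n f x := by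
  rw [contMDiffAt_iff] at h ⊢
  refine ⟨h.1, ?_⟩
  exact h.2.restrict_scalars ℝ

theorem ContMDiffAt.real_of_complex_prod {V : Type*} [NormedAddCommGroup V] [NormedSpace ℂ V]
    {f : V × M → M'} {x : V × M} {n : WithTop ℕ∞}
    (h : ContMDiffAt (𝓘(ℂ, V).prod 𝓘(ℂ, E)) 𝓘(ℂ, E') n f x) :
    ContMDiffAt (𝓘(ℝ, V).prod 𝓘(ℝ, E)) 𝓘(ℝ, E') n f x := by
  rw [contMDiffAt_iff] at h ⊢
  refine ⟨h.1, ?_⟩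
  exact h.2.restrict_scalars ℝ

theorem mem_contDiffGroupoid_real_of_complex {e : OpenPartialHomeomorph E E} {n : WithTop ℕ∞}
    (he : e ∈ contDiffGroupoid n 𝓘(ℂ, E)) : e ∈ contDiffGroupoid n 𝓘(ℝ, E) := by
  have h1 : ContDiffOn ℂ n (𝓘(ℂ, E) ∘ e ∘ 𝓘(ℂ, E).symm) (𝓘(ℂ, E).symm ⁻¹' e.source ∩
    range 𝓘(ℂ, E)) := he.1
  have h2 : ContDiffOn ℂ n (𝓘(ℂ, E) ∘ e.symm ∘ 𝓘(ℂ, E).symm) (𝓘(ℂ, E).symm ⁻¹' e.target ∩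
    range 𝓘(ℂ, E)) := he.2
  exact ⟨h1.restrict_scalars ℝ, h2.restrict_scalars ℝ⟩

variable (E M) in
theorem isManifold_real_of_complex [IsManifold 𝓘(ℂ, E) ω M] : IsManifold 𝓘(ℝ, E) ω M := by
  refine IsManifold.mk' (gr := ⟨fun {e e'} he he' => ?_⟩)
  exact mem_contDiffGroupoid_real_of_complex
    (HasGroupoid.compatible (G := contDiffGroupoid ω 𝓘(ℂ, E)) he he')

open Manifold in
/-- An immersion has a local left inverse. -/
theorem Manifold.IsImmersionAt.exists_left_inverse {f : M → M'} {x : M}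
    [IsManifold 𝓘(ℂ, E) ω M] [IsManifold 𝓘(ℂ, E') ω M']
    (h : IsImmersionAt 𝓘(ℂ, E) 𝓘(ℂ, E') ω f x) :
    ∃ r : M' → M, ContMDiffAt 𝓘(ℂ, E') 𝓘(ℂ, E) ω r (f x) ∧ ∀ᶠ y in 𝓝 x, r (f y) = y := by
  obtain ⟨F, i1, i2, h⟩ := h
  have hx : x ∈ h.domChart.source := h.mem_domChart_source
  have hmaps := h.mapsto_domChart_source_codChart_source
  have hw : ∀ y ∈ h.domChart.source, h.codChart (f y) = h.equiv (h.domChart y, 0) :=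
      fun y hy => by
    have h1 := h.writtenInCharts (show h.domChart y ∈ (h.domChart.extend 𝓘(ℂ, E)).target by
      simpa [OpenPartialHomeomorph.extend] using h.domChart.map_source hy)
    simpa [h.domChart.left_inv hy] using h1
  refine ⟨fun y => h.domChart.symm (h.equiv.symm (h.codChart y)).1, ?_, ?_⟩
  · have hd : ContMDiffAt 𝓘(ℂ, E) 𝓘(ℂ, E) ω h.domChart.symm
        (h.equiv.symm (h.codChart (f x))).1 := by
      rw [hw x hx, ContinuousLinearEquiv.symm_apply_apply]
      exact contMDiffOn_symm_of_mem_maximalAtlas h.domChart_mem_maximalAtlas |>.contMDiffAt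
        (h.domChart.open_target.mem_nhds (h.domChart.map_source hx))
    have hl : ContMDiffAt 𝓘(ℂ, E') 𝓘(ℂ, E) ω
        (fun v : E' => (h.equiv.symm v).1) (h.codChart (f x)) :=
      ((contDiff_fst.comp h.equiv.symm.contDiff).contDiffAt).contMDiffAt
    have hc : ContMDiffAt 𝓘(ℂ, E') 𝓘(ℂ, E') ω h.codChart (f x) :=
      contMDiffAt_of_mem_maximalAtlas h.codChart_mem_maximalAtlas h.mem_codChart_source
    exact ContMDiffAt.comp (f x) hd (hl.comp (f x) hc)
  · filter_upwards [h.domChart.open_source.mem_nhds hx] with y hy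
    rw [hw y hy, ContinuousLinearEquiv.symm_apply_apply]
    exact h.domChart.left_inv hy

end RealStructure

/-! ### Hamiltonian actions: infinitesimal action and moment maps -/

section Action

variable {m : ℕ} {E : Type*} [NormedAddCommGroup E] [NormedSpace ℂ E]
  {Y : Type*} [TopologicalSpace Y] [ChartedSpace E Y]

namespace HamiltonianReductiveAction

variable (𝓨 : HamiltonianReductiveAction m E Y)

/-- The action of a matrix in `G`. -/
noncomputable def actG (g : CGL m) (y : Y) : Y := 𝓨.act (toSub 𝓨.G g) y

theorem actG_coe (g : 𝓨.G) (y : Y) : 𝓨.actG g y = 𝓨.act g y := by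
  rw [actG, toSub_coe_self]

theorem actG_one (y : Y) : 𝓨.actG 1 y = y := by
  rw [actG, toSub_one, map_one, Equiv.Perm.one_apply]

theorem actG_mul {g h : CGL m} (hg : g ∈ 𝓨.G) (hh : h ∈ 𝓨.G) (y : Y) :
    𝓨.actG (g * h) y = 𝓨.actG g (𝓨.actG h y) := by
  rw [actG, toSub_mul hg hh, map_mul, Equiv.Perm.mul_apply]; rfl

theorem continuous_entries {n : ℕ} :
    Continuous fun (g : CGL n) => fun (i j : Fin n) => (g : CMat n) i j :=
  isOpenEmbedding_glVal.continuous

theorem continuous_act : Continuous fun q : 𝓨.G × Y => 𝓨.act q.1 q.2 := by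
  refine continuous_iff_continuousAt.2 fun ⟨g, y⟩ => ?_
  obtain ⟨F, hF, hFact⟩ := 𝓨.act_holomorphic g y
  have h1 : ContinuousAt (fun q : 𝓨.G × Y =>
      ((fun i j => ((q.1 : CGL m) : CMat m) i j : Fin m → Fin m → ℂ), q.2)) (g, y) :=
    ((continuous_entries.comp (continuous_subtype_val.comp continuous_fst)).prodMk
      continuous_snd).continuousAt
  have h2 : ContinuousAt F (fun i j => ((g : CGL m) : CMat m) i j, y) := hF.continuousAt
  exact (ContinuousAt.comp (f := fun q : 𝓨.G × Y =>
      ((fun i j => ((q.1 : CGL m) : CMat m) i j : Fin m → Fin m → ℂ), q.2)) h2 h1).congr hFact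

theorem continuous_actG {Z : Type*} [TopologicalSpace Z] {g : Z → CGL m} (hg : Continuous g)
    (hgG : ∀ z, g z ∈ 𝓨.G) {y : Z → Y} (hy : Continuous y) :
    Continuous fun z => 𝓨.actG (g z) (y z) := by
  have h1 : (fun z => 𝓨.actG (g z) (y z)) =
      (fun q : 𝓨.G × Y => 𝓨.act q.1 q.2) ∘ fun z => ((⟨g z, hgG z⟩ : 𝓨.G), y z) := by
    funext z
    simp only [actG, Function.comp]
    congr 2
    exact Subtype.ext (toSub_coe (hgG z))
  rw [h1]
  exact 𝓨.continuous_act.comp ((Continuous.subtype_mk hg hgG).prodMk hy)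

/-- Near the identity the action, in exponential coordinates, is smooth. -/
theorem contMDiffAt_actG_expGL {W : Type*} [NormedAddCommGroup W] [NormedSpace ℝ W]
    [FiniteDimensional ℝ W] (L : W →ₗ[ℝ] CMat m) (hL : ∀ w, L w ∈ lieSet 𝓨.G) (y : Y) :
    ContMDiffAt (𝓘(ℝ, W).prod 𝓘(ℝ, E)) 𝓘(ℝ, E) ω
      (fun p : W × Y => 𝓨.actG (expGL (L p.1)) p.2) (0, y) := by
  obtain ⟨F, hF, hFact⟩ := 𝓨.act_holomorphic 1 y
  have h0 : (fun i j => (((1 : 𝓨.G) : CGL m) : CMat m) i j : Fin m → Fin m → ℂ) =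
      fun i j => NormedSpace.exp (L 0) i j := by
    rw [map_zero, NormedSpace.exp_zero]; rfl
  rw [h0] at hF
  have hL' : Continuous L := LinearMap.continuous_of_finiteDimensional L
  have h1 : ContMDiffAt (𝓘(ℝ, W).prod 𝓘(ℝ, E)) (𝓘(ℝ, Fin m → Fin m → ℂ).prod 𝓘(ℝ, E)) ω
      (fun p : W × Y => ((fun i j => NormedSpace.exp (L p.1) i j : Fin m → Fin m → ℂ), p.2))
      (0, y) :=
    ((contDiff_matrix_exp L).contMDiff.contMDiffAt.comp (0, y) contMDiffAt_fst).prodMk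
      contMDiffAt_snd
  have h2 := ContMDiffAt.comp (0, y) hF.real_of_complex_prod h1
  refine h2.congr_of_eventuallyEq ?_
  have h3 : Tendsto (fun p : W × Y => (toSub 𝓨.G (expGL (L p.1)), p.2)) (𝓝 (0, y))
      (𝓝 ((1 : 𝓨.G), y)) := by
    have hc : Continuous fun p : W × Y =>
        ((⟨expGL (L p.1), expGL_mem_of_mem_lieSet (hL p.1)⟩ : 𝓨.G), p.2) :=
      (Continuous.subtype_mk (continuous_expGL.comp (hL'.comp continuous_fst)) _).prodMk
        continuous_snd
    have h4 := hc.tendsto (0, y)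
    have h5 : (fun p : W × Y => (toSub 𝓨.G (expGL (L p.1)), p.2)) = fun p : W × Y =>
        ((⟨expGL (L p.1), expGL_mem_of_mem_lieSet (hL p.1)⟩ : 𝓨.G), p.2) := by
      funext p
      exact Prod.ext (Subtype.ext (toSub_coe (expGL_mem_of_mem_lieSet (hL p.1)))) rfl
    have h6 : (⟨expGL (L (0 : W)), expGL_mem_of_mem_lieSet (hL 0)⟩ : 𝓨.G) = 1 :=
      Subtype.ext (by simp [expGL_zero])
    rw [h5]
    simpa only [h6] using h4
  filter_upwards [h3.eventually hFact] with p hp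
  simp only [toSub_coe (expGL_mem_of_mem_lieSet (hL p.1))] at hp
  exact hp.symm

theorem mdifferentiable_act (g : 𝓨.G) : MDifferentiable 𝓘(ℝ, E) 𝓘(ℝ, E) (𝓨.act g) := fun y => by
  obtain ⟨F, hF, hFact⟩ := 𝓨.act_holomorphic g y
  have h1 : ContMDiffAt 𝓘(ℝ, E) (𝓘(ℝ, Fin m → Fin m → ℂ).prod 𝓘(ℝ, E)) ω
      (fun y' : Y => ((fun i j => ((g : CGL m) : CMat m) i j : Fin m → Fin m → ℂ), y')) y :=
    contMDiffAt_const.prodMk contMDiffAt_id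
  have h2 := ContMDiffAt.comp y hF.real_of_complex_prod h1
  refine (h2.congr_of_eventuallyEq ?_).mdifferentiableAt (by simp)
  have h3 : Tendsto (fun y' : Y => (g, y')) (𝓝 y) (𝓝 (g, y)) :=
    (Continuous.prodMk_right g).tendsto y
  filter_upwards [h3.eventually hFact] with p hp
  exact hp.symm

/-- The velocity at `y` of the one-parameter group generated by `a`. -/
noncomputable def vel (a : CMat m) (y : Y) : E :=
  (mfderiv 𝓘(ℝ, ℝ) 𝓘(ℝ, E) (fun t : ℝ => 𝓨.actG (expGL (t • a)) y) 0 : ℝ →L[ℝ] E) 1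

/-- As the action is holomorphic, the infinitesimal action is complex-linear. -/
theorem exists_linear_vel (y : Y) : ∃ ℓ : CMat m →ₗ[ℂ] E, ∀ a ∈ lieSet 𝓨.G,
    HasMFDerivAt 𝓘(ℝ, ℝ) 𝓘(ℝ, E) (fun t : ℝ => 𝓨.actG (expGL (t • a)) y) 0
      (ContinuousLinearMap.smulRight (1 : ℝ →L[ℝ] ℝ) (ℓ a) : ℝ →L[ℝ] E) := by
  obtain ⟨F, hF, hFact⟩ := 𝓨.act_holomorphic 1 y
  have hF' := (hF.mdifferentiableAt (by simp)).hasMFDerivAt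
  set F' : (Fin m → Fin m → ℂ) × E →L[ℂ] E :=
    mfderiv (𝓘(ℂ, Fin m → Fin m → ℂ).prod 𝓘(ℂ, E)) 𝓘(ℂ, E) F
      (fun i j => (((1 : 𝓨.G) : CGL m) : CMat m) i j, y)
  have hFr := HasMFDerivAt.real_of_complex_prod (f' := F') hF'
  let ℓ : CMat m →ₗ[ℂ] E :=
    { toFun := fun a => F' (fun i j => a i j, 0)
      map_add' := fun a b => by
        rw [← map_add]; congr 1; ext <;> simp
      map_smul' := fun c a => by
        rw [RingHom.id_apply, ← map_smul]; congr 1; ext <;> simp }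
  refine ⟨ℓ, fun a ha => ?_⟩
  have hc1 : HasDerivAt (fun t : ℝ => (fun i j => NormedSpace.exp (t • a) i j : Fin m → Fin m → ℂ))
      (fun i j => a i j) 0 :=
    hasDerivAt_pi.2 fun i => hasDerivAt_pi.2 fun j => hasDerivAt_matrix_exp_smul (𝕜 := ℝ) a i j
  have hc2 : HasMFDerivAt 𝓘(ℝ, ℝ) (𝓘(ℝ, Fin m → Fin m → ℂ).prod 𝓘(ℝ, E))
      (fun t : ℝ => ((fun i j => NormedSpace.exp (t • a) i j : Fin m → Fin m → ℂ), y)) 0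
      (((ContinuousLinearMap.smulRight (1 : ℝ →L[ℝ] ℝ) (fun i j => a i j : Fin m → Fin m → ℂ)) :
        ℝ →L[ℝ] (Fin m → Fin m → ℂ)).prod (0 : ℝ →L[ℝ] E)) :=
    hc1.hasFDerivAt.hasMFDerivAt.prodMk (hasMFDerivAt_const y 0)
  have h0 : (fun i j => (((1 : 𝓨.G) : CGL m) : CMat m) i j : Fin m → Fin m → ℂ) =
      fun i j => NormedSpace.exp ((0 : ℝ) • a) i j := by
    rw [zero_smul, NormedSpace.exp_zero]; rfl
  rw [h0] at hFr
  have h2 := HasMFDerivAt.comp (0 : ℝ) hFr hc2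
  have h3 := h2.congr_of_eventuallyEq (f₁ := fun t : ℝ => 𝓨.actG (expGL (t • a)) y) ?_
  · refine HasMFDerivAt.congr_mfderiv h3 ?_
    refine ContinuousLinearMap.ext_ring ?_
    change F' ((1 : ℝ) • (fun i j => a i j), 0) = (1 : ℝ) • F' (fun i j => a i j, 0)
    rw [one_smul, one_smul]
  · have h3 : Tendsto (fun t : ℝ => (toSub 𝓨.G (expGL (t • a)), y)) (𝓝 0)
        (𝓝 ((1 : 𝓨.G), y)) := by
      have hc : Continuous fun t : ℝ => ((⟨expGL (t • a), ha t⟩ : 𝓨.G), y) :=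
        (Continuous.subtype_mk (continuous_expGL.comp (continuous_id.smul continuous_const))
          _).prodMk continuous_const
      have h4 := hc.tendsto 0
      have h5 : (fun t : ℝ => (toSub 𝓨.G (expGL (t • a)), y)) = fun t : ℝ =>
          ((⟨expGL (t • a), ha t⟩ : 𝓨.G), y) := by
        funext t
        exact Prod.ext (Subtype.ext (toSub_coe (ha t))) rfl
      have h6 : (⟨expGL ((0 : ℝ) • a), ha 0⟩ : 𝓨.G) = 1 :=
        Subtype.ext (by simp [expGL_zero])
      rw [h5]
      simpa only [h6] using h4
    filter_upwards [h3.eventually hFact] with t ht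
    simp only [toSub_coe (ha t)] at ht
    exact ht.symm

/-- The complex-linear extension of the infinitesimal action at `y` to all matrices. -/
noncomputable def velLin (y : Y) : CMat m →ₗ[ℂ] E := (𝓨.exists_linear_vel y).choose

theorem hasMFDerivAt_actG_zero {a : CMat m} (ha : a ∈ lieSet 𝓨.G) (y : Y) :
    HasMFDerivAt 𝓘(ℝ, ℝ) 𝓘(ℝ, E) (fun t : ℝ => 𝓨.actG (expGL (t • a)) y) 0
      (ContinuousLinearMap.smulRight (1 : ℝ →L[ℝ] ℝ) (𝓨.vel a y) : ℝ →L[ℝ] E) := by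
  have h := (𝓨.exists_linear_vel y).choose_spec a ha
  have h2 : 𝓨.vel a y = (𝓨.exists_linear_vel y).choose a := by
    rw [vel, h.mfderiv]
    exact one_smul ℝ _
  rw [h2]
  exact h

theorem vel_eq {a : CMat m} (ha : a ∈ lieSet 𝓨.G) (y : Y) : 𝓨.vel a y = 𝓨.velLin y a := by
  rw [vel, ((𝓨.exists_linear_vel y).choose_spec a ha).mfderiv]
  exact one_smul ℝ _

theorem actG_add_smul {a : CMat m} (ha : a ∈ lieSet 𝓨.G) (s t : ℝ) (y : Y) :
    𝓨.actG (expGL ((s + t) • a)) y = 𝓨.actG (expGL (s • a)) (𝓨.actG (expGL (t • a)) y) := by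
  rw [expGL_add_smul, 𝓨.actG_mul (ha s) (ha t)]

theorem hasMFDerivAt_actG {a : CMat m} (ha : a ∈ lieSet 𝓨.G) (y : Y) (s : ℝ) :
    HasMFDerivAt 𝓘(ℝ, ℝ) 𝓘(ℝ, E) (fun t : ℝ => 𝓨.actG (expGL (t • a)) y) s
      (ContinuousLinearMap.smulRight (1 : ℝ →L[ℝ] ℝ)
        (𝓨.vel a (𝓨.actG (expGL (s • a)) y)) : ℝ →L[ℝ] E) := by
  have h1 := 𝓨.hasMFDerivAt_actG_zero ha (𝓨.actG (expGL (s • a)) y)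
  have h2 : HasMFDerivAt 𝓘(ℝ, ℝ) 𝓘(ℝ, ℝ) (fun t : ℝ => t - s) s (1 : ℝ →L[ℝ] ℝ) :=
    ((hasFDerivAt_id s).sub_const s).hasMFDerivAt
  rw [← sub_self s] at h1
  have h3 := HasMFDerivAt.comp (f := fun t : ℝ => t - s) s h1 h2
  have h4 : (fun t : ℝ => 𝓨.actG (expGL (t • a)) y) =
      (fun t : ℝ => 𝓨.actG (expGL (t • a)) (𝓨.actG (expGL (s • a)) y)) ∘ fun t => t - s := by
    funext t
    simp only [Function.comp]
    rw [← 𝓨.actG_add_smul ha, sub_add_cancel]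
  rw [h4]
  exact h3

theorem eq_of_hasMFDerivAt_zero [IsManifold 𝓘(ℝ, E) ω Y] {γ : ℝ → Y}
    (h : ∀ t, HasMFDerivAt 𝓘(ℝ, ℝ) 𝓘(ℝ, E) γ t (0 : ℝ →L[ℝ] E)) (s t : ℝ) : γ s = γ t := by
  have hloc : IsLocallyConstant γ := (IsLocallyConstant.iff_eventually_eq γ).2 fun t₀ => by
    have hsrc : γ ⁻¹' (chartAt E (γ t₀)).source ∈ 𝓝 t₀ :=
      (h t₀).continuousAt.preimage_mem_nhds
        ((chartAt E (γ t₀)).open_source.mem_nhds (mem_chart_source E (γ t₀)))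
    obtain ⟨r, hr, hball⟩ := Metric.mem_nhds_iff.1 hsrc
    have hd : ∀ t ∈ Metric.ball t₀ r, HasFDerivAt (chartAt E (γ t₀) ∘ γ) (0 : ℝ →L[ℝ] E) t :=
        fun t ht => by
      have h1 : MDifferentiableAt 𝓘(ℝ, E) 𝓘(ℝ, E) (chartAt E (γ t₀)) (γ t) :=
        (contMDiffAt_of_mem_maximalAtlas (n := ω) (I := 𝓘(ℝ, E))
          (IsManifold.chart_mem_maximalAtlas (γ t₀)) (hball ht)).mdifferentiableAt (by simp)
      have h2 := HasMFDerivAt.comp t h1.hasMFDerivAt (h t)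
      have h3 := h2.hasFDerivAt
      have h4 : (mfderiv 𝓘(ℝ, E) 𝓘(ℝ, E) (chartAt E (γ t₀)) (γ t) : E →L[ℝ] E).comp
        (0 : ℝ →L[ℝ] E) = 0 := ContinuousLinearMap.comp_zero _
      exact h4 ▸ h3
    filter_upwards [Metric.ball_mem_nhds t₀ hr] with t ht
    have hconst : (chartAt E (γ t₀) ∘ γ) t = (chartAt E (γ t₀) ∘ γ) t₀ :=
      (convex_ball t₀ r).is_const_of_fderivWithin_eq_zero (𝕜 := ℝ)
        (fun x hx => (hd x hx).differentiableAt.differentiableWithinAt)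
        (fun x hx => (hd x hx).hasFDerivWithinAt.fderivWithin
          (Metric.isOpen_ball.uniqueDiffWithinAt hx))
        ht (Metric.mem_ball_self hr)
    exact (chartAt E (γ t₀)).injOn (hball ht) (mem_chart_source E (γ t₀)) hconst
  exact hloc.apply_eq_of_preconnectedSpace s t

/-- A zero of the vector field generated by `a` is fixed by the one-parameter group. -/
theorem actG_eq_of_vel_eq_zero [IsManifold 𝓘(ℝ, E) ω Y] {a : CMat m} (ha : a ∈ lieSet 𝓨.G)
    {y : Y} (hv : 𝓨.vel a y = 0) (t : ℝ) : 𝓨.actG (expGL (t • a)) y = y := by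
  have h0 := 𝓨.hasMFDerivAt_actG_zero ha y
  rw [hv, ContinuousLinearMap.smulRight_zero] at h0
  have h1 : ∀ s, HasMFDerivAt 𝓘(ℝ, ℝ) 𝓘(ℝ, E) (fun t : ℝ => 𝓨.actG (expGL (t • a)) y) s
      (0 : ℝ →L[ℝ] E) := fun s => by
    obtain ⟨d, h2⟩ : ∃ d : E →L[ℝ] E, HasMFDerivAt 𝓘(ℝ, E) 𝓘(ℝ, E)
        (𝓨.act (toSub 𝓨.G (expGL (s • a)))) (𝓨.actG (expGL ((0 : ℝ) • a)) y) d :=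
      ⟨_, (𝓨.mdifferentiable_act _ _).hasMFDerivAt⟩
    have h3 := HasMFDerivAt.comp (0 : ℝ) h2 h0
    have h4 : HasMFDerivAt 𝓘(ℝ, ℝ) 𝓘(ℝ, ℝ) (fun t : ℝ => t - s) s (1 : ℝ →L[ℝ] ℝ) :=
      ((hasFDerivAt_id s).sub_const s).hasMFDerivAt
    rw [← sub_self s] at h3
    have h5 := HasMFDerivAt.comp (f := fun t : ℝ => t - s) s h3 h4
    have h6 : (fun t : ℝ => 𝓨.actG (expGL (t • a)) y) =
        ((𝓨.act (toSub 𝓨.G (expGL (s • a))) ∘ fun t : ℝ => 𝓨.actG (expGL (t • a)) y) ∘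
          fun t : ℝ => t - s) := by
      funext t
      simp only [Function.comp]
      have := 𝓨.actG_add_smul ha s (t - s) y
      rw [add_sub_cancel] at this
      exact this
    rw [h6]
    refine HasMFDerivAt.congr_mfderiv h5 ?_
    refine ContinuousLinearMap.ext fun x => ?_
    exact d.map_zero
  rw [eq_of_hasMFDerivAt_zero h1 t 0, zero_smul, expGL_zero, actG_one]

theorem muK_of_mem {a : CMat m} (ha : a ∈ lieSet 𝓨.K) (y : Y) :
    𝓨.muK y a = 𝓨.mu y ⟨a, ha⟩ := dif_pos ha

theorem contMDiff_muK {a : CMat m} (ha : a ∈ lieSet 𝓨.K) :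
    ContMDiff 𝓘(ℝ, E) 𝓘(ℝ, ℝ) ∞ fun y => 𝓨.muK y a := by
  simp only [𝓨.muK_of_mem ha]
  exact 𝓨.mu_smooth ⟨a, ha⟩

theorem mfderiv_muK {a : CMat m} (ha : a ∈ lieSet 𝓨.K) (y : Y) (ξ : E) :
    (mfderiv 𝓘(ℝ, E) 𝓘(ℝ, ℝ) (fun y' => 𝓨.muK y' a) y : E →L[ℝ] ℝ) ξ =
      𝓨.form y ![𝓨.vel a y, ξ] := by
  have e : (fun y' => 𝓨.muK y' a) = fun y' => 𝓨.mu y' ⟨a, ha⟩ := funext (𝓨.muK_of_mem ha)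
  rw [e]
  exact 𝓨.mu_deriv ⟨a, ha⟩ y ξ

theorem exists_hasMFDerivAt_muK {a : CMat m} (ha : a ∈ lieSet 𝓨.K) (y : Y) :
    ∃ μ' : E →L[ℝ] ℝ, HasMFDerivAt 𝓘(ℝ, E) 𝓘(ℝ, ℝ) (fun y' => 𝓨.muK y' a) y μ' ∧
      ∀ ξ, μ' ξ = 𝓨.form y ![𝓨.vel a y, ξ] :=
  ⟨_, ((𝓨.contMDiff_muK ha).mdifferentiable (by simp) y).hasMFDerivAt, 𝓨.mfderiv_muK ha y⟩

theorem hasDerivAt_comp_curve {F : Type*} [NormedAddCommGroup F] [NormedSpace ℝ F] {φ : Y → F}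
    {γ : ℝ → Y} {s : ℝ} {φ' : E →L[ℝ] F} {v : E} (hφ : HasMFDerivAt 𝓘(ℝ, E) 𝓘(ℝ, F) φ (γ s) φ')
    (hγ : HasMFDerivAt 𝓘(ℝ, ℝ) 𝓘(ℝ, E) γ s
      (ContinuousLinearMap.smulRight (1 : ℝ →L[ℝ] ℝ) v : ℝ →L[ℝ] E)) :
    HasDerivAt (fun t => φ (γ t)) (φ' v) s := by
  have h : HasFDerivAt (fun t => φ (γ t))
      (φ'.comp (ContinuousLinearMap.smulRight (1 : ℝ →L[ℝ] ℝ) v)) s :=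
    (HasMFDerivAt.comp s hφ hγ).hasFDerivAt
  simpa using h.hasDerivAt

theorem muK_sum_smul {ι : Type*} (s : Finset ι) {a : ι → CMat m} (ha : ∀ i, a i ∈ lieSet 𝓨.K)
    (c : ι → ℝ) (y : Y) : 𝓨.muK y (∑ i ∈ s, c i • a i) = ∑ i ∈ s, c i * 𝓨.muK y (a i) := by
  let 𝔨 := lieAlgebra 𝓨.K 𝓨.complexification.compact.isClosed
  have h1 : ∑ i ∈ s, c i • a i ∈ lieSet 𝓨.K :=
    𝔨.sum_mem fun i _ => 𝔨.smul_mem _ (ha i)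
  have h2 : (⟨_, h1⟩ : 𝔨) = ∑ i ∈ s, c i • (⟨a i, ha i⟩ : 𝔨) :=
    Subtype.ext (by simp)
  rw [𝓨.muK_of_mem h1, h2, map_sum]
  simp only [map_smul, smul_eq_mul, 𝓨.muK_of_mem (ha _)]

theorem muK_conj {a : CMat m} (ha : a ∈ lieSet 𝓨.K) {k : 𝓨.G} (hk : (k : CGL m) ∈ 𝓨.K) (y : Y) :
    𝓨.muK (𝓨.act k y) (((k : CGL m) : CMat m) * a * (((k : CGL m)⁻¹ : CGL m) : CMat m)) =
      𝓨.muK y a := by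
  have hb : ((k : CGL m) : CMat m) * a * (((k : CGL m)⁻¹ : CGL m) : CMat m) ∈ lieSet 𝓨.K :=
      fun t => by
    rw [← Matrix.smul_mul, ← Matrix.mul_smul, expGL_conj]
    exact 𝓨.K.mul_mem (𝓨.K.mul_mem hk (ha t)) (𝓨.K.inv_mem hk)
  rw [𝓨.muK_of_mem hb, 𝓨.muK_of_mem ha]
  exact 𝓨.mu_equivariant k hk y _ _ rfl

theorem neg_I_smul_mem {B : CMat m} (hB : B ∈ lieSet 𝓨.K) : -Complex.I • B ∈ lieSet 𝓨.G := by
  have h : -B ∈ lieSet 𝓨.K :=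
    (lieAlgebra 𝓨.K 𝓨.complexification.compact.isClosed).neg_mem hB
  have := 𝓨.complexification.I_smul_mem_lieSet h
  rwa [smul_neg, ← neg_smul] at this

/-- Along the flow of `-i B` the function `μ(B)` grows with the squared length of the vector field
generated by `B`. -/
theorem hasDerivAt_muK_flow {B : CMat m} (hB : B ∈ lieSet 𝓨.K) (y : Y) (s : ℝ) :
    HasDerivAt (fun s : ℝ => 𝓨.muK (𝓨.actG (expGL (s • (-Complex.I • B))) y) B)
      (𝓨.form (𝓨.actG (expGL (s • (-Complex.I • B))) y)
        ![Complex.I • 𝓨.vel B (𝓨.actG (expGL (s • (-Complex.I • B))) y),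
          𝓨.vel B (𝓨.actG (expGL (s • (-Complex.I • B))) y)]) s := by
  have ha := 𝓨.neg_I_smul_mem hB
  set y' := 𝓨.actG (expGL (s • (-Complex.I • B))) y
  have h1 := 𝓨.hasMFDerivAt_actG ha y s
  obtain ⟨μ', h2, hμ'⟩ := 𝓨.exists_hasMFDerivAt_muK hB y'
  refine HasDerivAt.congr_deriv (hasDerivAt_comp_curve (φ := fun y => 𝓨.muK y B) h2 h1) ?_
  have hv : 𝓨.vel (-Complex.I • B) y' = -Complex.I • 𝓨.vel B y' := by
    rw [𝓨.vel_eq ha, 𝓨.vel_eq (𝓨.complexification.mem_lieSet_of_mem hB), map_smul]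
  have h5 := 𝓨.kahler.type_one_one y' (𝓨.vel B y') (-Complex.I • 𝓨.vel B y')
  have h6 : Complex.I • -Complex.I • 𝓨.vel B y' = 𝓨.vel B y' := by
    rw [smul_smul]; simp
  rw [h6] at h5
  rw [h5, hμ', hv]

theorem form_I_smul_nonneg (y : Y) (v : E) : 0 ≤ 𝓨.form y ![Complex.I • v, v] := by
  by_cases hv : v = 0
  · subst hv
    rw [smul_zero]
    have := (𝓨.form y).map_coord_zero (m := ![0, 0]) 0 rfl
    exact this.ge
  · exact (𝓨.kahler.positive y v hv).le

theorem monotone_muK_flow {B : CMat m} (hB : B ∈ lieSet 𝓨.K) (y : Y) :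
    Monotone fun s : ℝ => 𝓨.muK (𝓨.actG (expGL (s • (-Complex.I • B))) y) B :=
  monotone_of_hasDerivAt_nonneg (𝓨.hasDerivAt_muK_flow hB y) fun _ => 𝓨.form_I_smul_nonneg _ _

/-- Minima of `μ(B)` along the flow of `-i B` are fixed by the complex one-parameter group
generated by `B`. -/
theorem vel_eq_zero_of_forall_le {B : CMat m} (hB : B ∈ lieSet 𝓨.K) {y : Y}
    (h : ∀ s : ℝ, 𝓨.muK y B ≤ 𝓨.muK (𝓨.actG (expGL (s • (-Complex.I • B))) y) B) :
    𝓨.vel B y = 0 := by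
  by_contra hv
  have h0 : 𝓨.actG (expGL ((0 : ℝ) • (-Complex.I • B))) y = y := by
    rw [zero_smul, expGL_zero, actG_one]
  have h1 := 𝓨.hasDerivAt_muK_flow hB y 0
  have h2 : IsLocalMin (fun s : ℝ => 𝓨.muK (𝓨.actG (expGL (s • (-Complex.I • B))) y) B) 0 :=
    Eventually.of_forall fun s => by
      simp only [h0]
      exact h s
  have h3 := h2.hasDerivAt_eq_zero h1
  rw [h0] at h3
  exact (𝓨.kahler.positive y _ hv).ne' h3

end HamiltonianReductiveAction

end Action

/-! ### The minimum of the moment map of the circle -/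

section Minimum

theorem skewPart_of_skew {n : ℕ} {A : CMat n} (hA : A.conjTranspose = -A) : skewPart A = A := by
  rw [skewPart, hA, sub_neg_eq_add, ← two_smul ℂ, smul_smul]
  norm_num

theorem skewPart_conj {n : ℕ} {U : CGL n} (hU : (U : CMat n) ∈ Matrix.unitaryGroup (Fin n) ℂ)
    (A : CMat n) : skewPart ((U : CMat n) * A * ((U⁻¹ : CGL n) : CMat n)) =
      (U : CMat n) * skewPart A * ((U⁻¹ : CGL n) : CMat n) := by
  have hi : ((U⁻¹ : CGL n) : CMat n) = (U : CMat n).conjTranspose :=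
    Units.inv_eq_of_mul_eq_one_left (Matrix.mem_unitaryGroup_iff'.1 hU)
  simp only [skewPart, hi, Matrix.conjTranspose_mul, Matrix.conjTranspose_conjTranspose,
    Matrix.mul_smul, Matrix.smul_mul, Matrix.mul_sub, Matrix.sub_mul, Matrix.mul_assoc]

theorem HamiltonianReductiveAction.tendsto_actG_expGL {m : ℕ}
    {E : Type*} [NormedAddCommGroup E] [NormedSpace ℂ E]
    {Y : Type*} [TopologicalSpace Y] [ChartedSpace E Y] (𝓨 : HamiltonianReductiveAction m E Y)
    {Z : Type*} {l : Filter Z} {a : Z → CMat m} (h : Tendsto a l (𝓝 0))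
    (ha : ∀ z, a z ∈ lieSet 𝓨.G) (y : Y) :
    Tendsto (fun z => 𝓨.actG (expGL (a z)) y) l (𝓝 y) := by
  have h1 : Tendsto (fun z => toSub 𝓨.G (expGL (a z))) l (𝓝 1) := by
    rw [tendsto_subtype_rng]
    have h2 := (continuous_expGL.tendsto (0 : CMat m)).comp h
    rw [expGL_zero] at h2
    refine h2.congr fun z => ?_
    rw [toSub_coe (expGL_mem_of_mem_lieSet (ha z))]
    rfl
  have h3 : Continuous fun g : 𝓨.G => 𝓨.act g y := 𝓨.continuous_act.comp (Continuous.prodMk_left y)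
  have h4 := (h3.tendsto 1).comp h1
  rw [map_one, Equiv.Perm.one_apply] at h4
  exact h4

namespace HamiltonianHAction

variable {n m : ℕ}
  {EY : Type*} [NormedAddCommGroup EY] [NormedSpace ℂ EY]
  {Y : Type*} [TopologicalSpace Y] [ChartedSpace EY Y]
  {EX : Type*} [NormedAddCommGroup EX] [NormedSpace ℂ EX]
  {X : Type*} [TopologicalSpace X] [ChartedSpace EX X]
  (D : HamiltonianHAction n m EY Y EX X)

/-- The moment map of the circle `lam (S¹)`, without the constant contributed by the character. -/
noncomputable def height (y : Y) : ℝ := D.amb.muK y D.gen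

theorem exists_muLamY_eq (χ : D.grp.H →* ℂˣ) (c : ℝ) :
    ∃ C : ℝ, ∀ y, D.muLamY χ c y = D.height y + C := by
  refine ⟨((c / Complex.I) * D.dChar χ D.grp.circleGen).re, fun y => ?_⟩
  have h := skewPart_of_skew
    (conjTranspose_eq_neg_of_mem_lieSet D.amb.complexification.unitary D.gen_mem)
  rw [muLamY, muHY, HamiltonianReductiveAction.muG, ← gen, h]
  simp [height]

theorem rho_lam_mem (w : ℂ) : w • (-Complex.I • D.gen) ∈ lieSet D.amb.G := fun t => by
  rw [← Complex.coe_smul, smul_smul, ← D.rho_lam_expUnit]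
  exact (D.rho _).2

theorem act_rho_lam (w : ℂ) (y : Y) : D.amb.act (D.rho (D.grp.lam (expUnit w))) y =
    D.amb.actG (expGL (w • (-Complex.I • D.gen))) y := by
  rw [← D.rho_lam_expUnit, D.amb.actG_coe]

theorem act_rho_lam_real (s : ℝ) (y : Y) : D.amb.act (D.rho (D.grp.lam (expUnit s))) y =
    D.amb.actG (expGL (s • (-Complex.I • D.gen))) y := by
  rw [D.act_rho_lam, Complex.coe_smul]

/-- The moment map of the circle increases along the flow of `lam t`, `t > 0`. -/
theorem monotone_height (y : Y) :
    Monotone fun s : ℝ => D.height (D.amb.act (D.rho (D.grp.lam (expUnit s))) y) := by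
  simp only [D.act_rho_lam_real]
  exact D.amb.monotone_muK_flow D.gen_mem y

/-- Minima along a `lam`-orbit are fixed points. -/
theorem act_rho_lam_of_forall_le [IsManifold 𝓘(ℂ, EY) ω Y] {y : Y}
    (h : ∀ t : ℂˣ, D.height y ≤ D.height (D.amb.act (D.rho (D.grp.lam t)) y)) (t : ℂˣ) :
    D.amb.act (D.rho (D.grp.lam t)) y = y := by
  have : IsManifold 𝓘(ℝ, EY) ω Y := isManifold_real_of_complex EY Y
  have hv : D.amb.vel D.gen y = 0 := by
    refine D.amb.vel_eq_zero_of_forall_le D.gen_mem fun s => ?_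
    rw [← D.act_rho_lam_real]
    exact h _
  obtain ⟨w, rfl⟩ := exists_expUnit_eq t
  have hw : D.amb.vel (w • (-Complex.I • D.gen)) y = 0 := by
    rw [D.amb.vel_eq (D.rho_lam_mem w), map_smul, map_smul,
      ← D.amb.vel_eq (D.amb.complexification.mem_lieSet_of_mem D.gen_mem), hv, smul_zero, smul_zero]
  have := D.amb.actG_eq_of_vel_eq_zero (D.rho_lam_mem w) hw 1
  rwa [one_smul, ← D.act_rho_lam] at this

/-- The points of `X` at which the moment map of the circle is minimal. -/
def base : Set X := {x | ∀ x', D.height (D.incl x) ≤ D.height (D.incl x')}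

theorem act_lam_of_mem_base [IsManifold 𝓘(ℂ, EY) ω Y] {z : X} (hz : z ∈ D.base) (t : ℂˣ) :
    D.amb.act (D.rho (D.grp.lam t)) (D.incl z) = D.incl z :=
  D.act_rho_lam_of_forall_le (fun t => by rw [← D.act_incl]; exact hz _) t

theorem Zmin_eq [IsManifold 𝓘(ℂ, EY) ω Y] (χ : D.grp.H →* ℂˣ) (c : ℝ) : D.Zmin χ c = D.base := by
  obtain ⟨C, hC⟩ := D.exists_muLamY_eq χ c
  ext x
  simp only [Zmin, base, muLam, hC, add_le_add_iff_right, mem_ofPred_eq, and_iff_right_iff_imp]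
  intro h t
  refine D.incl_embedding.isEmbedding.injective ?_
  rw [D.act_incl]
  exact D.act_lam_of_mem_base h t

/-- The stability condition for the action of `U`, in terms of the minimum of the moment map and of
the Lie algebra of `U`. -/
structure IsStable : Prop where
  minimal : ∀ z ∈ D.base, ∀ y, D.height (D.incl z) ≤ D.height y
  free : ∀ z ∈ D.base, ∀ u : D.grp.H, (u : CGL n) ∈ D.grp.U → D.act u z = z → u = 1

theorem isStable_of_semistableEqStableU [IsManifold 𝓘(ℂ, EY) ω Y] {χ : D.grp.H →* ℂˣ} {c : ℝ}
    (h : D.SemistableEqStableU χ c) : D.IsStable := by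
  obtain ⟨C, hC⟩ := D.exists_muLamY_eq χ c
  rw [SemistableEqStableU, D.Zmin_eq] at h
  refine ⟨fun z hz y => ?_, h.2⟩
  have := (h.1 z hz).2 y
  simpa only [hC, add_le_add_iff_right] using this

theorem dRho_mem_of_mem_lieU {A : CMat n} (hA : A ∈ D.grp.lieU) : D.dRho A ∈ lieSet D.amb.G :=
  D.dRho_mem (D.grp.lieU_le hA)

theorem dRho_adLam {A : CMat n} (hA : A ∈ D.grp.lieU) (t : ℂˣ) : D.dRho (D.grp.adLam t A) =
    ((D.rho (D.grp.lam t) : CGL m) : CMat m) * D.dRho A *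
      (((D.rho (D.grp.lam t) : CGL m)⁻¹ : CGL m) : CMat m) :=
  D.dRho_conj (D.grp.lieU_le hA) (D.grp.lam t)

theorem tendsto_dRho_adLam {A : CMat n} (hA : A ∈ D.grp.lieU) :
    Tendsto (fun s : ℝ => D.dRho (D.grp.adLam (expUnit s) A)) atBot (𝓝 0) := by
  have h : ∀ s : ℝ, D.dRho (D.grp.adLam (expUnit s) A) =
      D.dRhoLin (D.grp.adLam (expUnit s) A) := fun s =>
    D.dRho_eq (D.grp.lieU_le (D.grp.adLam_mem_lieU hA _))
  simp only [h]
  have hc : Continuous D.dRhoLin := by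
    have : FiniteDimensional ℂ (CMat n) := inferInstanceAs (FiniteDimensional ℂ (Fin n → Fin n → ℂ))
    exact LinearMap.continuous_of_finiteDimensional _
  have h2 := (hc.tendsto 0).comp (D.grp.tendsto_adLam_atBot hA)
  rw [map_zero] at h2
  exact h2

/-- At a minimum on `Y` of the moment map of the circle, the adjoint of the Lie algebra of `ρ(U)`
acts trivially. Indeed it has negative weights, so the flow of `lam t` for `t → ∞` contracts its
orbits; as the moment map increases along this flow, these orbits consist of minima, which are fixed
by the flow. -/
theorem vel_conjTranspose_eq_zero [IsManifold 𝓘(ℂ, EY) ω Y] [T2Space Y] (hD : D.IsStable) {z : X}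
    (hz : z ∈ D.base) {A : CMat n} (hA : A ∈ D.grp.lieU) :
    D.amb.vel (D.dRho A).conjTranspose (D.incl z) = 0 := by
  set a := D.dRho A
  have hN : a.conjTranspose ∈ lieSet D.amb.G :=
    D.amb.complexification.conjTranspose_mem_lieSet (D.dRho_mem_of_mem_lieU hA)
  have hskew : D.gen.conjTranspose = -D.gen :=
    conjTranspose_eq_neg_of_mem_lieSet D.amb.complexification.unitary D.gen_mem
  have hgH : ∀ s : ℝ, ((D.rho (D.grp.lam (expUnit s)) : CGL m) : CMat m).conjTranspose =
      ((D.rho (D.grp.lam (expUnit s)) : CGL m) : CMat m) := fun s => by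
    rw [D.rho_lam_expUnit, expGL_coe, ← Matrix.exp_conjTranspose]
    simp [Matrix.conjTranspose_smul, hskew]
  have hinv : ∀ s : ℝ, ((D.rho (D.grp.lam (expUnit s)) : CGL m)⁻¹ : CGL m) =
      (D.rho (D.grp.lam (expUnit (-s : ℝ))) : CGL m) := fun s => by
    rw [Complex.ofReal_neg, expUnit_neg, map_inv, map_inv]; rfl
  have hconj : ∀ s : ℝ, ((D.rho (D.grp.lam (expUnit s)) : CGL m) : CMat m) * a.conjTranspose *
      (((D.rho (D.grp.lam (expUnit s)) : CGL m)⁻¹ : CGL m) : CMat m) =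
      (D.dRho (D.grp.adLam (expUnit (-s : ℝ)) A)).conjTranspose := fun s => by
    rw [D.dRho_adLam hA, hinv, hinv, neg_neg, Matrix.conjTranspose_mul, Matrix.conjTranspose_mul,
      hgH, hgH, Matrix.mul_assoc]
  have hfix : ∀ t : ℝ, D.amb.actG (expGL (t • a.conjTranspose)) (D.incl z) = D.incl z := fun t => by
    set y := D.amb.actG (expGL (t • a.conjTranspose)) (D.incl z) with hy
    have hflow : ∀ s : ℝ, D.amb.act (D.rho (D.grp.lam (expUnit s))) y = D.amb.actG (expGL
        (t • (D.dRho (D.grp.adLam (expUnit (-s : ℝ)) A)).conjTranspose)) (D.incl z) := fun s => by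
      rw [← hconj, ← Matrix.smul_mul, ← Matrix.mul_smul, expGL_conj, D.amb.actG_mul
        (D.amb.G.mul_mem (D.rho _).2 (hN t)) (D.amb.G.inv_mem (D.rho _).2),
        D.amb.actG_mul (D.rho _).2 (hN t), hinv, D.amb.actG_coe, D.amb.actG_coe,
        D.act_lam_of_mem_base hz]
    have hlim : Tendsto (fun s : ℝ => D.amb.act (D.rho (D.grp.lam (expUnit s))) y) atTop
        (𝓝 (D.incl z)) := by
      simp only [hflow]
      have h1 : Tendsto (fun s : ℝ => t • (D.dRho
          (D.grp.adLam (expUnit (-s : ℝ)) A)).conjTranspose) atTop (𝓝 0) := by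
        have h2 := (D.tendsto_dRho_adLam hA).comp tendsto_neg_atTop_atBot
        have h3 : Continuous fun M : CMat m => t • M.conjTranspose :=
          continuous_id.matrix_conjTranspose.const_smul t
        have h4 := (h3.tendsto 0).comp h2
        rw [Matrix.conjTranspose_zero, smul_zero] at h4
        exact h4
      refine D.amb.tendsto_actG_expGL h1 (fun s t' => ?_) _
      rw [smul_smul]
      exact D.amb.complexification.conjTranspose_mem_lieSet (D.dRho_mem_of_mem_lieU
            (D.grp.adLam_mem_lieU hA _)) _
    have hheight : Continuous D.height := (D.amb.contMDiff_muK D.gen_mem).continuous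
    have hle : D.height y ≤ D.height (D.incl z) := by
      refine ge_of_tendsto ((hheight.tendsto _).comp hlim) ?_
      filter_upwards [eventually_ge_atTop 0] with s hs
      have h1 := D.monotone_height y hs
      have h2 : expUnit ((0 : ℝ) : ℂ) = 1 := by simp [expUnit_zero]
      simp only [h2, map_one, Equiv.Perm.one_apply] at h1
      exact h1
    have hfixed := D.act_rho_lam_of_forall_le (y := y)
      fun t => hle.trans (hD.minimal z hz _)
    simp only [hfixed] at hlim
    exact tendsto_nhds_unique tendsto_const_nhds hlim
  have hconst : (fun t : ℝ => D.amb.actG (expGL (t • a.conjTranspose)) (D.incl z)) =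
      fun _ => D.incl z := funext hfix
  rw [HamiltonianReductiveAction.vel, hconst, mfderiv_const]
  rfl

/-- At a minimum the skew-Hermitian part of an element of the Lie algebra of `ρ(U)` acts as half of
this element. -/
theorem vel_skewPart [IsManifold 𝓘(ℂ, EY) ω Y] [T2Space Y] (hD : D.IsStable) {z : X}
    (hz : z ∈ D.base) {A : CMat n} (hA : A ∈ D.grp.lieU) :
    (2 : ℝ) • D.amb.vel (skewPart (D.dRho A)) (D.incl z) = D.amb.vel (D.dRho A) (D.incl z) := by
  have ha := D.dRho_mem_of_mem_lieU hA
  have h1 := D.vel_conjTranspose_eq_zero hD hz hA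
  have hb := D.amb.complexification.mem_lieSet_of_mem (D.amb.complexification.skewPart_mem ha)
  rw [D.amb.vel_eq (D.amb.complexification.conjTranspose_mem_lieSet ha),
    conjTranspose_eq_neg_skewPart_add, map_add, map_neg, neg_add_eq_zero] at h1
  rw [D.amb.vel_eq hb, D.amb.vel_eq ha]
  conv_rhs => rw [skewPart_add_I_smul (D.dRho A), map_add, ← h1]
  rw [two_smul]

/-- The action of an element of the Lie algebra of `U`, exponentiated. -/
noncomputable def expAct (A : CMat n) (x : X) : X := D.act (toSub D.grp.H (expGL A)) x

theorem incl_expAct {A : CMat n} (hA : A ∈ D.grp.lieU) (x : X) :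
    D.incl (D.expAct A x) = D.amb.actG (expGL (D.dRho A)) (D.incl x) := by
  rw [expAct, D.act_incl, ← D.rho_expGL_one (D.grp.lieU_le hA), D.amb.actG_coe]

theorem eq_zero_of_expAct_eq (hD : D.IsStable) {z : X} (hz : z ∈ D.base) {A : CMat n}
    (hA : A ∈ D.grp.lieU) (h : D.expAct A z = z) : A = 0 := by
  have hm := D.grp.U_unipotent.le (D.grp.expGL_mem_U hA)
  refine D.grp.eq_zero_of_expGL_eq_one hA ?_
  have h1 := hD.free z hz _ (by rw [toSub_coe hm]; exact D.grp.expGL_mem_U hA) h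
  rw [← toSub_coe hm, h1]; rfl

theorem eq_zero_of_vel_eq_zero [IsManifold 𝓘(ℂ, EY) ω Y] (hD : D.IsStable) {z : X}
    (hz : z ∈ D.base) {A : CMat n} (hA : A ∈ D.grp.lieU)
    (h : D.amb.vel (D.dRho A) (D.incl z) = 0) : A = 0 := by
  have : IsManifold 𝓘(ℝ, EY) ω Y := isManifold_real_of_complex EY Y
  refine D.eq_zero_of_expAct_eq hD hz hA (D.incl_embedding.isEmbedding.injective ?_)
  rw [D.incl_expAct hA]
  simpa using D.amb.actG_eq_of_vel_eq_zero (D.dRho_mem_of_mem_lieU hA) h 1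

end HamiltonianHAction

end Minimum

/-! ### The moment map of the unipotent group near its minimal zeros -/

section MomentMap

/-- The contraction of a two-form with a vector in its second slot. -/
def ContinuousAlternatingMap.contractRight {E : Type*} [NormedAddCommGroup E] [NormedSpace ℝ E]
    (η : E [⋀^Fin 2]→L[ℝ] ℝ) (ξ : E) : E →ₗ[ℝ] ℝ where
  toFun v := η ![v, ξ]
  map_add' v w := η.vecCons_add ![ξ] v w
  map_smul' c v := η.vecCons_smul ![ξ] c v

namespace HamiltonianHAction

variable {n m : ℕ}
  {EY : Type*} [NormedAddCommGroup EY] [NormedSpace ℂ EY]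
  {Y : Type*} [TopologicalSpace Y] [ChartedSpace EY Y]
  {EX : Type*} [NormedAddCommGroup EX] [NormedSpace ℂ EX]
  {X : Type*} [TopologicalSpace X] [ChartedSpace EX X]
  (D : HamiltonianHAction n m EY Y EX X)

instance finite_lieU : Module.Finite ℝ D.grp.lieU := by
  have : FiniteDimensional ℂ (CMat n) := inferInstanceAs (FiniteDimensional ℂ (Fin n → Fin n → ℂ))
  exact Module.Finite.trans ℂ D.grp.lieU

/-- Coordinates on the Lie algebra of `U`, as a real vector space. -/
abbrev ParamU : Type := Fin (Module.finrank ℝ D.grp.lieU) → ℝ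

/-- A real basis of the Lie algebra of `U`. -/
noncomputable def basisU (j : Fin (Module.finrank ℝ D.grp.lieU)) : CMat n :=
  Module.finBasis ℝ D.grp.lieU j

theorem basisU_mem (j : Fin (Module.finrank ℝ D.grp.lieU)) : D.basisU j ∈ D.grp.lieU :=
  (Module.finBasis ℝ D.grp.lieU j).2

/-- The element of the Lie algebra of `U` with given coordinates. -/
noncomputable def param : D.ParamU →ₗ[ℝ] CMat n :=
  (D.grp.lieU.subtype.restrictScalars ℝ).comp
    (Module.finBasis ℝ D.grp.lieU).equivFun.symm.toLinearMap

theorem param_apply (a : D.ParamU) : D.param a = ∑ j, a j • D.basisU j := by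
  simp [param, Module.Basis.equivFun_symm_apply, basisU]

theorem param_mem (a : D.ParamU) : D.param a ∈ D.grp.lieU :=
  ((Module.finBasis ℝ D.grp.lieU).equivFun.symm a).2

theorem param_injective : Function.Injective D.param :=
  Subtype.val_injective.comp (Module.finBasis ℝ D.grp.lieU).equivFun.symm.injective

theorem exists_param_eq {A : CMat n} (hA : A ∈ D.grp.lieU) : ∃ a, D.param a = A :=
  ⟨(Module.finBasis ℝ D.grp.lieU).equivFun ⟨A, hA⟩, by simp [param]⟩

/-- The derivative of `ρ` in coordinates on the Lie algebra of `U`. -/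
noncomputable def paramRho : D.ParamU →ₗ[ℝ] CMat m :=
  (D.dRhoLin.restrictScalars ℝ).comp D.param

theorem paramRho_eq (a : D.ParamU) : D.paramRho a = D.dRho (D.param a) :=
  (D.dRho_eq (D.grp.lieU_le (D.param_mem a))).symm

theorem paramRho_mem (a : D.ParamU) : D.paramRho a ∈ lieSet D.amb.G := by
  rw [paramRho_eq]
  exact D.dRho_mem_of_mem_lieU (D.param_mem a)

/-- The skew-Hermitian part of the image of an element of a basis of the Lie algebra of `U`. -/
noncomputable def skewBasis (j : Fin (Module.finrank ℝ D.grp.lieU)) : CMat m :=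
  skewPart (D.dRho (D.basisU j))

theorem skewBasis_mem (j : Fin (Module.finrank ℝ D.grp.lieU)) :
    D.skewBasis j ∈ lieSet D.amb.K :=
  D.amb.complexification.skewPart_mem (D.dRho_mem_of_mem_lieU (D.basisU_mem j))

/-- The moment map of `U` in coordinates. As the Lie algebra of `U` is complex, the real parts of
its values determine it. -/
noncomputable def mom (y : Y) : D.ParamU := fun j => D.amb.muK y (D.skewBasis j)

theorem skewPart_dRho_param (a : D.ParamU) :
    skewPart (D.dRho (D.param a)) = ∑ j, a j • D.skewBasis j := by
  have h : ∀ j, D.dRhoLin (D.basisU j) = D.dRho (D.basisU j) := fun j =>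
    (D.dRho_eq (D.grp.lieU_le (D.basisU_mem j))).symm
  rw [← D.paramRho_eq, paramRho, LinearMap.comp_apply, param_apply, map_sum]
  simp only [map_smul, LinearMap.restrictScalars_apply, h, skewPart,
    skewBasis, Matrix.conjTranspose_sum, Matrix.conjTranspose_smul, ← Finset.sum_sub_distrib,
    Finset.smul_sum, star_trivial, ← smul_sub]
  exact Finset.sum_congr rfl fun j _ => smul_comm _ _ _

theorem muK_skewPart_param (y : Y) (a : D.ParamU) :
    D.amb.muK y (skewPart (D.dRho (D.param a))) = ∑ j, a j * D.mom y j := by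
  rw [skewPart_dRho_param, D.amb.muK_sum_smul _ D.skewBasis_mem]
  rfl

theorem mom_eq_zero_iff (y : Y) :
    D.mom y = 0 ↔ ∀ A ∈ D.grp.lieU, D.amb.muK y (skewPart (D.dRho A)) = 0 := by
  constructor
  · intro h A hA
    obtain ⟨a, rfl⟩ := D.exists_param_eq hA
    simp [muK_skewPart_param, h]
  · exact fun h => funext fun j => h _ (D.basisU_mem j)

theorem contMDiff_mom : ContMDiff 𝓘(ℝ, EY) 𝓘(ℝ, D.ParamU) ∞ D.mom :=
  contMDiff_pi_space.2 fun j => D.amb.contMDiff_muK (D.skewBasis_mem j)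

theorem exists_hasMFDerivAt_mom (y : Y) :
    ∃ μ' : EY →L[ℝ] D.ParamU, HasMFDerivAt 𝓘(ℝ, EY) 𝓘(ℝ, D.ParamU) D.mom y μ' ∧
      ∀ ξ j, μ' ξ j = D.amb.form y ![D.amb.vel (D.skewBasis j) y, ξ] := by
  obtain ⟨μ', h⟩ : ∃ μ' : EY →L[ℝ] D.ParamU, HasMFDerivAt 𝓘(ℝ, EY) 𝓘(ℝ, D.ParamU) D.mom y μ' :=
    ⟨_, (D.contMDiff_mom.mdifferentiable (by simp) y).hasMFDerivAt⟩
  refine ⟨μ', h, fun ξ j => ?_⟩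
  obtain ⟨ν', h1, h2⟩ := D.amb.exists_hasMFDerivAt_muK (D.skewBasis_mem j) y
  have h3 : HasMFDerivAt 𝓘(ℝ, D.ParamU) 𝓘(ℝ, ℝ) (fun a : D.ParamU => a j) (D.mom y)
      (ContinuousLinearMap.proj (R := ℝ) (φ := fun _ => ℝ) j : D.ParamU →L[ℝ] ℝ) :=
    (ContinuousLinearMap.proj (R := ℝ) (φ := fun _ => ℝ) j).hasFDerivAt.hasMFDerivAt
  have h4 := h1.mfderiv.symm.trans (HasMFDerivAt.comp y h3 h).mfderiv
  rw [← h2, h4]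
  rfl

/-- At a minimum, a vector killed by the derivative of the moment map of `U` is symplectically
orthogonal to the orbit of `U`. -/
theorem form_vel_eq_zero [IsManifold 𝓘(ℂ, EY) ω Y] [T2Space Y] (hD : D.IsStable) {z : X}
    (hz : z ∈ D.base) {ξ : EY}
    (h : ∀ j, D.amb.form (D.incl z) ![D.amb.vel (D.skewBasis j) (D.incl z), ξ] = 0)
    {A : CMat n} (hA : A ∈ D.grp.lieU) :
    D.amb.form (D.incl z) ![D.amb.vel (D.dRho A) (D.incl z), ξ] = 0 := by
  set ℓ := (D.amb.form (D.incl z)).contractRight ξ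
  have hj : ∀ j, ℓ (D.amb.velLin (D.incl z) (D.dRhoLin (D.basisU j))) = 0 := fun j => by
    have hm := D.basisU_mem j
    rw [← D.dRho_eq (D.grp.lieU_le hm), ← D.amb.vel_eq (D.dRho_mem_of_mem_lieU hm),
      ← D.vel_skewPart hD hz hm, map_smul]
    have : ℓ (D.amb.vel (skewPart (D.dRho (D.basisU j))) (D.incl z)) = 0 := h j
    rw [this, smul_zero]
  obtain ⟨a, rfl⟩ := D.exists_param_eq hA
  change ℓ _ = 0
  rw [D.amb.vel_eq (D.dRho_mem_of_mem_lieU hA), D.dRho_eq (D.grp.lieU_le hA), param_apply]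
  have e : ∀ B, ℓ (D.amb.velLin (D.incl z) (D.dRhoLin B)) = (ℓ.comp
    (((D.amb.velLin (D.incl z)).comp D.dRhoLin).restrictScalars ℝ)) B := fun _ => rfl
  rw [e, map_sum]
  refine Finset.sum_eq_zero fun j _ => ?_
  rw [map_smul, ← e, hj, smul_zero]

theorem vel_I_smul (y : Y) {A : CMat n} (hA : A ∈ D.grp.lieU) :
    D.amb.vel (D.dRho (Complex.I • A)) y = Complex.I • D.amb.vel (D.dRho A) y := by
  have hA' : Complex.I • A ∈ D.grp.lieU := D.grp.lieU.smul_mem _ hA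
  rw [D.amb.vel_eq (D.dRho_mem_of_mem_lieU hA), D.amb.vel_eq (D.dRho_mem_of_mem_lieU hA'),
    D.dRho_eq (D.grp.lieU_le hA), D.dRho_eq (D.grp.lieU_le hA'), map_smul, map_smul]

/-- At a minimum the moment map of `U` is a local diffeomorphism along the orbit of `U`. -/
theorem eq_zero_of_form_vel_eq_zero [IsManifold 𝓘(ℂ, EY) ω Y] [T2Space Y] (hD : D.IsStable) {z : X}
    (hz : z ∈ D.base) {a : D.ParamU}
    (h : ∀ j, D.amb.form (D.incl z) ![D.amb.vel (D.skewBasis j) (D.incl z),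
      D.amb.vel (D.paramRho a) (D.incl z)] = 0) : a = 0 := by
  rw [D.paramRho_eq] at h
  have hA := D.param_mem a
  have h1 := D.form_vel_eq_zero hD hz h (D.grp.lieU.smul_mem Complex.I hA)
  rw [D.vel_I_smul _ hA] at h1
  have h2 : D.amb.vel (D.dRho (D.param a)) (D.incl z) = 0 := by
    by_contra hv
    exact (D.amb.kahler.positive _ _ hv).ne' h1
  have h3 := D.eq_zero_of_vel_eq_zero hD hz hA h2
  exact D.param_injective (by rw [h3, map_zero])

/-- In the chart at `z`, the map which sends `(a, x)` to `(μ (exp a · x), x)`, where `μ` is the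
moment map of `U`. -/
noncomputable def momShift (z : X) (p : D.ParamU × EX) : D.ParamU × EX :=
  (D.mom (D.amb.actG (expGL (D.paramRho p.1)) (D.incl ((chartAt EX z).symm p.2))), p.2)

theorem contMDiff_incl : ContMDiff 𝓘(ℂ, EX) 𝓘(ℂ, EY) ω D.incl :=
  D.incl_embedding.isImmersion.contMDiff

theorem contDiffAt_momShift [IsManifold 𝓘(ℂ, EX) ω X] (z : X) :
    ContDiffAt ℝ ∞ (D.momShift z) (0, chartAt EX z z) := by
  have : IsManifold 𝓘(ℝ, EX) ω X := isManifold_real_of_complex EX X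
  have h1 : ContMDiffAt 𝓘(ℝ, EX) 𝓘(ℝ, EX) ω (chartAt EX z).symm (chartAt EX z z) :=
    contMDiffOn_symm_of_mem_maximalAtlas (IsManifold.chart_mem_maximalAtlas z) |>.contMDiffAt
      ((chartAt EX z).open_target.mem_nhds (mem_chart_target EX z))
  have h2 : ContMDiffAt 𝓘(ℝ, D.ParamU × EX) 𝓘(ℝ, EY) ω
      (fun p : D.ParamU × EX => D.incl ((chartAt EX z).symm p.2)) (0, chartAt EX z z) :=
    ContMDiffAt.comp _ (D.contMDiff_incl _).real_of_complex
      (ContMDiffAt.comp (0, chartAt EX z z) h1 (contDiff_snd.contDiffAt.contMDiffAt))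
  have h3 : ContMDiffAt 𝓘(ℝ, D.ParamU × EX) (𝓘(ℝ, D.ParamU).prod 𝓘(ℝ, EY)) ω
      (fun p : D.ParamU × EX => (p.1, D.incl ((chartAt EX z).symm p.2))) (0, chartAt EX z z) :=
    (contDiff_fst.contDiffAt.contMDiffAt).prodMk h2
  have h4 := ContMDiffAt.comp (0, chartAt EX z z)
    (D.amb.contMDiffAt_actG_expGL D.paramRho D.paramRho_mem _) h3
  have h5 := ContMDiffAt.comp (0, chartAt EX z z) (D.contMDiff_mom _) (h4.of_le (by simp))
  exact h5.contDiffAt.prodMk contDiffAt_snd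

theorem exists_openPartialHomeomorph_momShift [FiniteDimensional ℂ EX] [IsManifold 𝓘(ℂ, EX) ω X]
    [IsManifold 𝓘(ℂ, EY) ω Y] [T2Space Y] (hD : D.IsStable) {z : X} (hz : z ∈ D.base) :
    ∃ Θ : OpenPartialHomeomorph (D.ParamU × EX) (D.ParamU × EX),
      ⇑Θ = D.momShift z ∧ (0, chartAt EX z z) ∈ Θ.source := by
  have : FiniteDimensional ℝ EX := FiniteDimensional.complexToReal EX
  have hs := (D.contDiffAt_momShift z).hasStrictFDerivAt (by simp)
  set G' := fderiv ℝ (D.momShift z) (0, chartAt EX z z) with hG'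
  have hsnd : ∀ p, (G' p).2 = p.2 := fun p => by
    have h1 := hasFDerivAt_snd.comp (0, chartAt EX z z) hs.hasFDerivAt
    have h2 : HasFDerivAt (fun p : D.ParamU × EX => p.2) (ContinuousLinearMap.snd ℝ D.ParamU EX)
      (0, chartAt EX z z) := hasFDerivAt_snd
    exact congrArg (fun L : D.ParamU × EX →L[ℝ] EX => L p) (h1.unique h2)
  have hfst : ∀ a : D.ParamU, ∀ j, (G' (a, 0)).1 j = D.amb.form (D.incl z)
      ![D.amb.vel (D.skewBasis j) (D.incl z), D.amb.vel (D.paramRho a) (D.incl z)] :=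
      fun a j => by
    have hc : HasDerivAt (fun t : ℝ => ((t • a, chartAt EX z z) : D.ParamU × EX)) (a, 0) 0 := by
      have := ((hasDerivAt_id (0 : ℝ)).smul_const a).prodMk
        (hasDerivAt_const (0 : ℝ) (chartAt EX z z))
      simpa using this
    have h0 : ((0 : ℝ) • a, chartAt EX z z) = ((0 : D.ParamU), chartAt EX z z) := by rw [zero_smul]
    have h1 : HasFDerivAt (D.momShift z) G' ((0 : ℝ) • a, chartAt EX z z) := by
      rw [h0]; exact hs.hasFDerivAt
    have h2 := h1.comp_hasDerivAt 0 hc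
    obtain ⟨μ', h3, h4⟩ := D.exists_hasMFDerivAt_mom (D.incl z)
    have h5 := D.amb.hasMFDerivAt_actG_zero (D.paramRho_mem a) (D.incl z)
    have h6 : D.amb.actG (expGL ((0 : ℝ) • D.paramRho a)) (D.incl z) = D.incl z := by
      rw [zero_smul, expGL_zero, D.amb.actG_one]
    have h7 := HamiltonianReductiveAction.hasDerivAt_comp_curve (s := 0) (φ := D.mom)
      (γ := fun t : ℝ => D.amb.actG (expGL (t • D.paramRho a)) (D.incl z))
      (by rw [h6]; exact h3) h5
    have h8 : HasDerivAt (fun t : ℝ => (D.momShift z (t • a, chartAt EX z z)).1) (G' (a, 0)).1 0 :=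
      h2.fst
    have h9 := h8.unique (f := fun t : ℝ => (D.momShift z (t • a, chartAt EX z z)).1)
      (h7.congr_of_eventuallyEq (Eventually.of_forall fun t => by
        simp only [momShift, map_smul, (chartAt EX z).left_inv (mem_chart_source EX z)]))
    rw [h9, h4]
  have hinj : Function.Injective G' := by
    rw [injective_iff_map_eq_zero]
    rintro ⟨a, v⟩ h
    have hv : v = 0 := by
      have := hsnd (a, v)
      rw [h] at this
      exact this.symm
    subst hv
    have ha : a = 0 := D.eq_zero_of_form_vel_eq_zero hD hz fun j => by
      rw [← hfst, h]; rfl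
    rw [ha]; rfl
  let e : (D.ParamU × EX) ≃L[ℝ] (D.ParamU × EX) :=
    (LinearEquiv.ofInjectiveEndo G'.toLinearMap hinj).toContinuousLinearEquiv
  have he : (e : D.ParamU × EX →L[ℝ] D.ParamU × EX) = G' :=
    ContinuousLinearMap.ext fun p => rfl
  rw [← he] at hs
  exact ⟨hs.toOpenPartialHomeomorph _, rfl, hs.mem_toOpenPartialHomeomorph_source⟩

theorem momShift_chart {z x : X} (hx : x ∈ (chartAt EX z).source) (a : D.ParamU) :
    D.momShift z (a, chartAt EX z x) =
      (D.mom (D.incl (D.expAct (D.param a) x)), chartAt EX z x) := by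
  rw [momShift, (chartAt EX z).left_inv hx, D.incl_expAct (D.param_mem a), D.paramRho_eq]

theorem expAct_zero (x : X) : D.expAct 0 x = x := by
  rw [expAct, expGL_zero, toSub_one, map_one, Equiv.Perm.one_apply]

theorem continuous_expAct_param : Continuous fun p : D.ParamU × X => D.expAct (D.param p.1) p.2 := by
  rw [D.incl_embedding.isEmbedding.continuous_iff]
  have h : D.incl ∘ (fun p : D.ParamU × X => D.expAct (D.param p.1) p.2) =
      fun p => D.amb.actG (expGL (D.paramRho p.1)) (D.incl p.2) := by
    funext p
    rw [Function.comp, D.incl_expAct (D.param_mem _), D.paramRho_eq]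
  rw [h]
  refine D.amb.continuous_actG ?_ (fun p => expGL_mem_of_mem_lieSet (D.paramRho_mem _)) ?_
  · exact continuous_expGL.comp
      ((LinearMap.continuous_of_finiteDimensional D.paramRho).comp continuous_fst)
  · exact D.incl_embedding.isEmbedding.continuous.comp continuous_snd

/-- Near a minimum, small elements of `U` move the zeros of the moment map of `U` off the zero
set. -/
theorem exists_locally_free [FiniteDimensional ℂ EX] [IsManifold 𝓘(ℂ, EX) ω X]
    [IsManifold 𝓘(ℂ, EY) ω Y] [T2Space Y] (hD : D.IsStable) {z : X} (hz : z ∈ D.base) :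
    ∃ r > 0, ∀ᶠ x in 𝓝 z, ∀ a : D.ParamU, ‖a‖ < r → D.mom (D.incl x) = 0 →
      D.mom (D.incl (D.expAct (D.param a) x)) = 0 → a = 0 := by
  obtain ⟨Θ, hΘ, hsrc⟩ := D.exists_openPartialHomeomorph_momShift hD hz
  obtain ⟨U, hU, V, hV, hUV⟩ := mem_nhds_prod_iff.1 (Θ.open_source.mem_nhds hsrc)
  obtain ⟨r, hr, hrU⟩ := Metric.mem_nhds_iff.1 hU
  have hφ := (chartAt EX z).continuousAt (mem_chart_source EX z)
  refine ⟨r, hr, ?_⟩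
  filter_upwards [hφ hV, (chartAt EX z).open_source.mem_nhds (mem_chart_source EX z)] with
    x hx hxs a ha h0 h1
  have hm : ∀ b : D.ParamU, ‖b‖ < r → (b, chartAt EX z x) ∈ Θ.source := fun b hb =>
    hUV ⟨hrU (by simpa using hb), hx⟩
  have h2 := Θ.injOn (hm a ha) (hm 0 (by simpa using hr)) (by
    rw [hΘ, D.momShift_chart hxs, D.momShift_chart hxs, h1, map_zero, D.expAct_zero, h0])
  exact (Prod.ext_iff.1 h2).1

/-- Near a minimum, the points close to a zero of the moment map of `U` can be moved by `U` to zeros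
of the moment map close to this zero. -/
theorem eventually_locally_transversal [FiniteDimensional ℂ EX] [IsManifold 𝓘(ℂ, EX) ω X]
    [IsManifold 𝓘(ℂ, EY) ω Y] [T2Space Y] (hD : D.IsStable) {z : X} (hz : z ∈ D.base) :
    ∀ᶠ x in 𝓝 z, D.mom (D.incl x) = 0 → ∀ O ∈ 𝓝 x, ∀ᶠ x' in 𝓝 x, ∃ a : D.ParamU,
      D.expAct (D.param a) x' ∈ O ∧ D.mom (D.incl (D.expAct (D.param a) x')) = 0 := by
  obtain ⟨Θ, hΘ, hsrc⟩ := D.exists_openPartialHomeomorph_momShift hD hz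
  have hφ := (chartAt EX z).continuousAt (mem_chart_source EX z)
  have h1 : ∀ᶠ x in 𝓝 z, ((0 : D.ParamU), chartAt EX z x) ∈ Θ.source :=
    (continuousAt_const.prodMk hφ) (Θ.open_source.mem_nhds hsrc)
  filter_upwards [h1, (chartAt EX z).open_source.mem_nhds (mem_chart_source EX z)] with
    x hx hxs h0 O hO
  have hx0 : Θ (0, chartAt EX z x) = (0, chartAt EX z x) := by
    rw [hΘ, D.momShift_chart hxs, map_zero, D.expAct_zero, h0]
  have hxt : ((0 : D.ParamU), chartAt EX z x) ∈ Θ.target := hx0 ▸ Θ.map_source hx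
  have hxi : Θ.symm (0, chartAt EX z x) = (0, chartAt EX z x) := by
    conv_lhs => rw [← hx0]
    exact Θ.left_inv hx
  have hφx := (chartAt EX z).continuousAt hxs
  have hpair : Tendsto (fun x' => ((0 : D.ParamU), chartAt EX z x')) (𝓝 x)
      (𝓝 (0, chartAt EX z x)) := continuousAt_const.prodMk hφx
  have hinv : Tendsto (fun x' => (Θ.symm (0, chartAt EX z x')).1) (𝓝 x) (𝓝 0) := by
    have h2 := (Θ.continuousAt_symm hxt).tendsto.comp hpair
    rw [hxi] at h2
    exact (continuous_fst.tendsto _).comp h2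
  have hact : Tendsto (fun x' => D.expAct (D.param (Θ.symm (0, chartAt EX z x')).1) x') (𝓝 x)
      (𝓝 x) := by
    have h2 := (D.continuous_expAct_param.tendsto (0, x)).comp (hinv.prodMk_nhds tendsto_id)
    simp only [map_zero, D.expAct_zero] at h2
    exact h2
  filter_upwards [hact hO, hpair (Θ.open_target.mem_nhds hxt),
    (chartAt EX z).open_source.mem_nhds hxs] with x' h2 h3 h4
  refine ⟨(Θ.symm (0, chartAt EX z x')).1, h2, ?_⟩
  have h5 := Θ.right_inv h3
  rw [hΘ] at h5
  have h6 : (Θ.symm (0, chartAt EX z x')).2 = chartAt EX z x' := (Prod.ext_iff.1 h5).2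
  have h7 : Θ.symm (0, chartAt EX z x') = ((Θ.symm (0, chartAt EX z x')).1, chartAt EX z x') :=
    Prod.ext rfl h6
  rw [h7, D.momShift_chart h4] at h5
  exact (Prod.ext_iff.1 h5).1

end HamiltonianHAction

end MomentMap

/-! ### Charts adapted to zero sets and Kähler forms on them -/

section Charts

/-- The zero set of a smooth map with surjective derivative is, in a suitable local chart whose
derivative at the base point is the identity, the kernel of this derivative. -/
theorem exists_straightening {E F : Type*} [NormedAddCommGroup E] [NormedSpace ℝ E]
    [CompleteSpace E] [NormedAddCommGroup F] [NormedSpace ℝ F]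
    {h : E → F} {s : Set E} (hs : IsOpen s) (hh : ContDiffOn ℝ ∞ h s) {e₀ : E} (he₀ : e₀ ∈ s)
    {h' : E →L[ℝ] F} (hd : HasFDerivAt h h' e₀) (R : F →L[ℝ] E) (hR : ∀ w, h' (R w) = w) :
    ∃ Ψ ∈ contDiffGroupoid ∞ 𝓘(ℝ, E), e₀ ∈ Ψ.source ∧
      (∀ e ∈ Ψ.source, h e = 0 ↔ Ψ e ∈ LinearMap.ker h'.toLinearMap) ∧
      HasFDerivAt Ψ.symm (ContinuousLinearMap.id ℝ E) (Ψ e₀) := by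
  set ψ : E → E := fun e => (e - e₀) + R (h e - h' (e - e₀)) with hψ
  have hψs : ContDiffOn ℝ ∞ ψ s := by
    have h1 : ContDiffOn ℝ ∞ (fun e : E => e - e₀) s := (contDiff_id.sub contDiff_const).contDiffOn
    exact h1.add (R.contDiff.comp_contDiffOn (hh.sub (h'.contDiff.comp_contDiffOn h1)))
  have hψd : HasFDerivAt ψ (ContinuousLinearMap.id ℝ E) e₀ := by
    have h1 : HasFDerivAt (fun e : E => e - e₀) (ContinuousLinearMap.id ℝ E) e₀ :=
      (hasFDerivAt_id e₀).sub_const e₀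
    have h2 := h1.add (R.hasFDerivAt.comp e₀ (hd.sub (h'.hasFDerivAt.comp e₀ h1)))
    refine h2.congr_fderiv ?_
    ext w
    simp
  have hker : ∀ e, h' (ψ e) = h e := fun e => by
    simp only [hψ, map_add, hR, map_sub]
    abel
  have hψ0 : ContDiffAt ℝ ∞ ψ e₀ := hψs.contDiffAt (hs.mem_nhds he₀)
  have hstrict : HasStrictFDerivAt ψ ((ContinuousLinearEquiv.refl ℝ E : E ≃L[ℝ] E) : E →L[ℝ] E)
      e₀ := hψ0.hasStrictFDerivAt' hψd (by simp)
  -- the open set on which the derivative is invertible, so that the inverse map is smooth there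
  set t : Set E := s ∩ fderiv ℝ ψ ⁻¹' range ((↑) : (E ≃L[ℝ] E) → E →L[ℝ] E) with ht
  have hto : IsOpen t := (hψs.continuousOn_fderiv_of_isOpen hs (by simp)).isOpen_inter_preimage hs
    ContinuousLinearEquiv.isOpen
  set Ψ := (hstrict.toOpenPartialHomeomorph ψ).restr t with hΨ
  have hcoe : ⇑Ψ = ψ := rfl
  have hsrc : Ψ.source ⊆ t := fun e he => by
    rw [hΨ, OpenPartialHomeomorph.restr_source, hto.interior_eq] at he
    exact he.2
  have he₀t : e₀ ∈ t := ⟨he₀, ContinuousLinearEquiv.refl ℝ E, hψd.fderiv.symm⟩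
  have he₀Ψ : e₀ ∈ Ψ.source := by
    rw [hΨ, OpenPartialHomeomorph.restr_source, hto.interior_eq]
    exact ⟨hstrict.mem_toOpenPartialHomeomorph_source, he₀t⟩
  refine ⟨Ψ, ?_, he₀Ψ, fun e _ => ?_, ?_⟩
  · rw [contDiffGroupoid, mem_groupoid_of_pregroupoid]
    constructor
    · change ContDiffOn ℝ ∞ ψ (Ψ.source ∩ range id)
      exact hψs.mono fun e he => (hsrc he.1).1
    · change ContDiffOn ℝ ∞ Ψ.symm (Ψ.target ∩ range id)
      intro e he
      obtain ⟨h1, L, hL⟩ := hsrc (Ψ.map_target he.1)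
      have h2 : ContDiffAt ℝ ∞ ψ (Ψ.symm e) := hψs.contDiffAt (hs.mem_nhds h1)
      refine (Ψ.contDiffAt_symm (f₀' := L) he.1 ?_ h2).contDiffWithinAt
      rw [hL]
      exact (h2.differentiableAt (by simp)).hasFDerivAt
  · rw [hcoe, LinearMap.mem_ker, ContinuousLinearMap.coe_coe, hker]
  · have h1 : HasFDerivAt Ψ ((ContinuousLinearEquiv.refl ℝ E : E ≃L[ℝ] E) : E →L[ℝ] E)
        (Ψ.symm (Ψ e₀)) := by
      rw [Ψ.left_inv he₀Ψ]; exact hψd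
    exact Ψ.hasFDerivAt_symm (Ψ.map_source he₀Ψ) h1

variable {E : Type*} [NormedAddCommGroup E] [NormedSpace ℂ E]
  {M : Type*} [TopologicalSpace M] [ChartedSpace E M]

theorem trans_mem_maximalAtlas {φ : OpenPartialHomeomorph M E} {Ψ : OpenPartialHomeomorph E E}
    [IsManifold 𝓘(ℝ, E) ∞ M] (hφ : φ ∈ IsManifold.maximalAtlas 𝓘(ℝ, E) ∞ M)
    (hΨ : Ψ ∈ contDiffGroupoid ∞ 𝓘(ℝ, E)) :
    φ ≫ₕ Ψ ∈ IsManifold.maximalAtlas 𝓘(ℝ, E) ∞ M := by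
  rw [IsManifold.mem_maximalAtlas_iff, mem_maximalAtlas_iff]
  intro e he
  have he' := IsManifold.subset_maximalAtlas (I := 𝓘(ℝ, E)) (n := ∞) he
  constructor
  · rw [OpenPartialHomeomorph.trans_symm_eq_symm_trans_symm, OpenPartialHomeomorph.trans_assoc]
    exact StructureGroupoid.trans _ (StructureGroupoid.symm _ hΨ)
      (IsManifold.compatible_of_mem_maximalAtlas hφ he')
  · rw [← OpenPartialHomeomorph.trans_assoc]
    exact StructureGroupoid.trans _ (IsManifold.compatible_of_mem_maximalAtlas he' hφ) hΨ

/-- The tangent vectors of a subset which is a linear subspace in a chart. -/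
theorem mem_tangentVectors_iff [IsManifold 𝓘(ℝ, E) ∞ M] {χ : OpenPartialHomeomorph M E}
    (hχ : χ ∈ IsManifold.maximalAtlas 𝓘(ℝ, E) ∞ M) {V : Submodule ℝ E}
    (hV : IsClosed (V : Set E)) {S : Set M} (hS : ∀ y ∈ χ.source, y ∈ S ↔ χ y ∈ V) {x : M}
    (hx : x ∈ χ.source) (hxS : x ∈ S) {L : E →L[ℝ] E}
    (hL : HasMFDerivAt 𝓘(ℝ, E) 𝓘(ℝ, E) χ.symm (χ x) L) (v : E) :
    v ∈ tangentVectors E S x ↔ ∃ w ∈ V, L w = v := by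
  constructor
  · rintro ⟨γ, h0, hγS, hγ, rfl⟩
    subst h0
    obtain ⟨γ', hγ'⟩ : ∃ γ' : ℝ →L[ℝ] E, HasMFDerivAt 𝓘(ℝ, ℝ) 𝓘(ℝ, E) γ 0 γ' :=
      ⟨_, hγ.hasMFDerivAt⟩
    obtain ⟨D, hD⟩ : ∃ D : E →L[ℝ] E, HasMFDerivAt 𝓘(ℝ, E) 𝓘(ℝ, E) χ (γ 0) D :=
      ⟨_, ((contMDiffAt_of_mem_maximalAtlas hχ hx).mdifferentiableAt (by simp)).hasMFDerivAt⟩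
    have hc := HasMFDerivAt.comp (0 : ℝ) hD hγ'
    have hcf : HasFDerivAt (χ ∘ γ) (D.comp γ') 0 := hc.hasFDerivAt
    have hcd : HasDerivAt (χ ∘ γ) (D (γ' 1)) 0 := by simpa using hcf.hasDerivAt
    have hev : ∀ᶠ t in 𝓝 (0 : ℝ), γ t ∈ χ.source :=
      hγ.continuousAt (χ.open_source.mem_nhds hx)
    have hw : D (γ' 1) ∈ V := by
      have hs := hasDerivAt_iff_tendsto_slope.1 hcd
      refine hV.mem_of_tendsto hs ?_
      filter_upwards [hev.filter_mono nhdsWithin_le_nhds] with t ht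
      rw [slope_def_module]
      exact V.smul_mem _ (V.sub_mem ((hS _ ht).1 (hγS t)) ((hS _ hx).1 hxS))
    refine ⟨_, hw, ?_⟩
    have h1 := HasMFDerivAt.comp (f := χ ∘ γ) (0 : ℝ) hL hc
    have h2 := h1.congr_of_eventuallyEq (f₁ := γ) (by
      filter_upwards [hev] with t ht
      exact (χ.left_inv ht).symm)
    have h3 : γ' = L.comp (D.comp γ') := hasMFDerivAt_unique hγ' h2
    rw [hγ'.mfderiv]
    exact (congrArg (fun T : ℝ →L[ℝ] E => T 1) h3).symm
  · rintro ⟨w, hw, rfl⟩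
    have hc : HasDerivAt (fun t : ℝ => χ x + t • w) w 0 := by
      simpa using ((hasDerivAt_id (0 : ℝ)).smul_const w).const_add (χ x)
    have h0 : χ x + (0 : ℝ) • w = χ x := by simp
    have hev : ∀ᶠ t in 𝓝 (0 : ℝ), χ x + t • w ∈ χ.target := by
      refine hc.continuousAt (χ.open_target.mem_nhds ?_)
      rw [h0]
      exact χ.map_source hx
    have hin : ∀ t : ℝ, χ x + t • w ∈ χ.target → χ.symm (χ x + t • w) ∈ S := fun t ht => by
      rw [hS _ (χ.map_target ht), χ.right_inv ht]
      exact V.add_mem ((hS _ hx).1 hxS) (V.smul_mem _ hw)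
    have hm : HasMFDerivAt 𝓘(ℝ, ℝ) 𝓘(ℝ, E) (fun t : ℝ => χ.symm (χ x + t • w)) 0
        (L.comp (ContinuousLinearMap.smulRight (1 : ℝ →L[ℝ] ℝ) w)) := by
      have hL' : HasMFDerivAt 𝓘(ℝ, E) 𝓘(ℝ, E) χ.symm (χ x + (0 : ℝ) • w) L := by
        rw [h0]; exact hL
      exact HasMFDerivAt.comp (f := fun t : ℝ => χ x + t • w) (0 : ℝ) hL'
        hc.hasFDerivAt.hasMFDerivAt
    classical
    set γ : ℝ → M := fun t => if χ x + t • w ∈ χ.target then χ.symm (χ x + t • w) else x with hγ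
    have hm2 := hm.congr_of_eventuallyEq (f₁ := γ) (by
      filter_upwards [hev] with t ht
      simp only [hγ, if_pos ht])
    refine ⟨γ, ?_, fun t => ?_, hm2.mdifferentiableAt, ?_⟩
    · simp only [hγ, h0, if_pos (χ.map_source hx), χ.left_inv hx]
    · by_cases ht : χ x + t • w ∈ χ.target
      · simp only [hγ, if_pos ht]; exact hin t ht
      · simp only [hγ, if_neg ht]; exact hxS
    · rw [hm2.mfderiv]
      change L ((1 : ℝ) • w) = L w
      rw [one_smul]

/-- Near a point at which the derivative of a smooth map `J` to a Kähler manifold is injective and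
complex-linear, the pull-back of the Kähler form is positive on complex lines. -/
theorem IsKahlerForm.eventually_pos [IsManifold 𝓘(ℝ, E) ω M] {form : M → E [⋀^Fin 2]→L[ℝ] ℝ}
    (hform : IsKahlerForm form) {F : Type*} [NormedAddCommGroup F] [NormedSpace ℂ F]
    [FiniteDimensional ℂ F] {J : F → M} {e₀ : F}
    (hJ : ContMDiffAt 𝓘(ℝ, F) 𝓘(ℝ, E) ∞ J e₀) {d : F →L[ℂ] E}
    (hd : HasMFDerivAt 𝓘(ℝ, F) 𝓘(ℝ, E) J e₀ (d.restrictScalars ℝ : F →L[ℝ] E))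
    (hinj : Function.Injective d) :
    ∀ᶠ e in 𝓝 e₀, ∀ D : F →L[ℝ] E, HasMFDerivAt 𝓘(ℝ, F) 𝓘(ℝ, E) J e D →
      ∀ w, w ≠ 0 → 0 < form (J e) ![D (Complex.I • w), D w] := by
  have : FiniteDimensional ℝ F := FiniteDimensional.complexToReal F
  have : ProperSpace F := FiniteDimensional.proper ℝ F
  set ψ := chartAt E (J e₀) with hψ
  have hψm : ψ ∈ IsManifold.maximalAtlas 𝓘(ℝ, E) ω M := IsManifold.chart_mem_maximalAtlas _
  have hsrc : J e₀ ∈ ψ.source := mem_chart_source E (J e₀)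
  set Jt : F → E := ψ ∘ J with hJt
  have hJtd : ContDiffAt ℝ ∞ Jt e₀ :=
    (ContMDiffAt.comp e₀ ((contMDiffAt_of_mem_maximalAtlas hψm hsrc).of_le (by simp)) hJ).contDiffAt
  -- the pull-back of the form, evaluated on tangent vectors, through the chart `ψ`
  set Ω : F → F → ℝ := fun e w => formInChart form ψ (Jt e)
    ![fderiv ℝ Jt e (Complex.I • w), fderiv ℝ Jt e w] with hΩ
  have hpull : ∀ e, J e ∈ ψ.source → ∀ D : F →L[ℝ] E, HasMFDerivAt 𝓘(ℝ, F) 𝓘(ℝ, E) J e D →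
      ∀ w, Ω e w = form (J e) ![D (Complex.I • w), D w] := fun e he D hD w => by
    obtain ⟨A, hA⟩ : ∃ A : E →L[ℝ] E, HasMFDerivAt 𝓘(ℝ, E) 𝓘(ℝ, E) ψ (J e) A :=
      ⟨_, ((contMDiffAt_of_mem_maximalAtlas hψm he).mdifferentiableAt (by simp)).hasMFDerivAt⟩
    obtain ⟨B, hB⟩ : ∃ B : E →L[ℝ] E, HasMFDerivAt 𝓘(ℝ, E) 𝓘(ℝ, E) ψ.symm (ψ (J e)) B :=
      ⟨_, (((contMDiffOn_symm_of_mem_maximalAtlas hψm).contMDiffAt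
        (ψ.open_target.mem_nhds (ψ.map_source he))).mdifferentiableAt (by simp)).hasMFDerivAt⟩
    have h1 := HasMFDerivAt.comp e hA hD
    have h1' : HasFDerivAt Jt (A.comp D) e := h1.hasFDerivAt
    have h2 : fderiv ℝ Jt e = A.comp D := h1'.fderiv
    have h3 := HasMFDerivAt.comp (f := ψ ∘ J) e hB h1
    have h4 := h3.congr_of_eventuallyEq (f₁ := J) (by
      filter_upwards [hD.continuousAt (ψ.open_source.mem_nhds he)] with e' he'
      exact (ψ.left_inv he').symm)
    have h5 : D = B.comp (A.comp D) := hasMFDerivAt_unique hD h4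
    have h6 : (realDeriv ψ.symm (ψ (J e)) : E →L[ℝ] E) = B := hB.mfderiv
    have h7 : Jt e = ψ (J e) := rfl
    simp only [hΩ]
    rw [h2, h7, formInChart, ContinuousAlternatingMap.compContinuousLinearMap_apply, h6,
      ψ.left_inv he]
    congr 1
    funext i
    fin_cases i
    · exact (congrArg (fun T : F →L[ℝ] E => T (Complex.I • w)) h5).symm
    · exact (congrArg (fun T : F →L[ℝ] E => T w) h5).symm
  have hcont : ∀ w, ContinuousAt (fun p : F × F => Ω p.1 p.2) (e₀, w) := fun w => by
    have hJc : ContinuousAt (fun p : F × F => Jt p.1) (e₀, w) :=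
      ContinuousAt.comp (g := Jt) (f := Prod.fst) (x := (e₀, w)) hJtd.continuousAt continuousAt_fst
    have hf : ContinuousAt (formInChart form ψ) (Jt e₀) :=
      (hform.smooth (J e₀)).continuousOn.continuousAt (ψ.open_target.mem_nhds (ψ.map_source hsrc))
    have h1 : ContinuousAt (fun p : F × F => formInChart form ψ (Jt p.1)) (e₀, w) :=
      ContinuousAt.comp (g := formInChart form ψ) (f := fun p : F × F => Jt p.1) (x := (e₀, w)) hf hJc
    have h2 : ContinuousAt (fun p : F × F => fderiv ℝ Jt p.1) (e₀, w) :=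
      ContinuousAt.comp (g := fderiv ℝ Jt) (f := Prod.fst) (x := (e₀, w)) ((hJtd.fderiv_right (m := 0) (by simp)).continuousAt)
        continuousAt_fst
    have h3 : ContinuousAt (fun p : F × F => ![fderiv ℝ Jt p.1 (Complex.I • p.2),
        fderiv ℝ Jt p.1 p.2]) (e₀, w) := by
      refine continuousAt_pi.2 fun i => ?_
      fin_cases i
      · exact h2.clm_apply (continuousAt_snd.const_smul Complex.I)
      · exact h2.clm_apply continuousAt_snd
    exact ContinuousAt.eval h1 h3
  have hsphere : ∀ᶠ e in 𝓝 e₀, ∀ w ∈ Metric.sphere (0 : F) 1, 0 < Ω e w := by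
    refine (isCompact_sphere (0 : F) 1).eventually_forall_of_forall_eventually fun w hw => ?_
    refine (hcont w).eventually (isOpen_Ioi.mem_nhds ?_)
    change 0 < Ω e₀ w
    rw [hpull e₀ hsrc _ hd]
    have hw0 : w ≠ 0 := by
      rintro rfl
      simp at hw
    have hdw : d w ≠ 0 := fun h => hw0 (hinj (by rw [h, map_zero]))
    have := hform.positive (J e₀) (d w) hdw
    rwa [← map_smul] at this
  filter_upwards [hsphere, hJ.continuousAt (ψ.open_source.mem_nhds hsrc)] with e h1 h2 D hD w hw
  have hn : 0 < ‖w‖ := norm_pos_iff.2 hw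
  have h3 := h1 (‖w‖⁻¹ • w) (by simp [norm_smul, hn.ne'])
  rw [hpull e h2 D hD, smul_comm, D.map_smul, D.map_smul] at h3
  have h4 : form (J e) ![‖w‖⁻¹ • D (Complex.I • w), ‖w‖⁻¹ • D w] =
      ‖w‖⁻¹ * (‖w‖⁻¹ * form (J e) ![D (Complex.I • w), D w]) := by
    have := (form (J e)).map_smul_univ (fun _ => ‖w‖⁻¹) ![D (Complex.I • w), D w]
    have e1 : (fun i => ‖w‖⁻¹ • ![D (Complex.I • w), D w] i) =
        ![‖w‖⁻¹ • D (Complex.I • w), ‖w‖⁻¹ • D w] := by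
      funext i; fin_cases i <;> rfl
    rw [e1] at this
    rw [this, Fin.prod_univ_two, smul_eq_mul, mul_assoc]
  rw [h4] at h3
  have hi : 0 < ‖w‖⁻¹ := inv_pos.2 hn
  exact (pos_iff_pos_of_mul_pos (a := ‖w‖⁻¹) (by
    exact (pos_iff_pos_of_mul_pos h3).1 hi)).1 hi

end Charts

/-! ### The zero set of the moment map of `U` near the minimum -/

section ZeroSet

namespace HamiltonianHAction

variable {n m : ℕ}
  {EY : Type*} [NormedAddCommGroup EY] [NormedSpace ℂ EY]
  {Y : Type*} [TopologicalSpace Y] [ChartedSpace EY Y]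
  {EX : Type*} [NormedAddCommGroup EX] [NormedSpace ℂ EX]
  {X : Type*} [TopologicalSpace X] [ChartedSpace EX X]
  (D : HamiltonianHAction n m EY Y EX X)

/-- The derivative of the inclusion in the chart at `z` is complex-linear and injective, and its
image contains the tangent vectors of the orbit of `U`. -/
theorem exists_deriv_incl [IsManifold 𝓘(ℂ, EX) ω X] [IsManifold 𝓘(ℂ, EY) ω Y] (z : X) :
    ∃ d : EX →L[ℂ] EY, HasMFDerivAt 𝓘(ℂ, EX) 𝓘(ℂ, EY)
        (fun e => D.incl ((chartAt EX z).symm e)) (chartAt EX z z) d ∧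
      Function.Injective d ∧
      ∀ A ∈ D.grp.lieU, ∃ w, d w = D.amb.vel (D.dRho A) (D.incl z) := by
  set φ := chartAt EX z with hφ
  have hφm : φ ∈ IsManifold.maximalAtlas 𝓘(ℂ, EX) ω X := IsManifold.chart_mem_maximalAtlas z
  have hz : z ∈ φ.source := mem_chart_source EX z
  have hzt : φ z ∈ φ.target := φ.map_source hz
  have hsymm : ContMDiffAt 𝓘(ℂ, EX) 𝓘(ℂ, EX) ω φ.symm (φ z) :=
    (contMDiffOn_symm_of_mem_maximalAtlas hφm).contMDiffAt (φ.open_target.mem_nhds hzt)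
  have hJ := ContMDiffAt.comp (φ z) (D.contMDiff_incl _) hsymm
  obtain ⟨d, hd⟩ : ∃ d : EX →L[ℂ] EY, HasMFDerivAt 𝓘(ℂ, EX) 𝓘(ℂ, EY)
      (fun e => D.incl (φ.symm e)) (φ z) d := ⟨_, (hJ.mdifferentiableAt (by simp)).hasMFDerivAt⟩
  obtain ⟨r, hr, hrz⟩ := (D.incl_embedding.isImmersion.isImmersionAt z).exists_left_inverse
  have hφr : ContMDiffAt 𝓘(ℂ, EY) 𝓘(ℂ, EX) ω (fun y => φ (r y)) (D.incl z) := by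
    refine ContMDiffAt.comp _ ?_ hr
    rw [hrz.self_of_nhds]
    exact contMDiffAt_of_mem_maximalAtlas hφm hz
  obtain ⟨ℓ, hℓ⟩ : ∃ ℓ : EY →L[ℂ] EX, HasMFDerivAt 𝓘(ℂ, EY) 𝓘(ℂ, EX)
      (fun y => φ (r y)) (D.incl z) ℓ := ⟨_, (hφr.mdifferentiableAt (by simp)).hasMFDerivAt⟩
  have hzz : D.incl (φ.symm (φ z)) = D.incl z := by rw [φ.left_inv hz]
  have hcomp : ∀ w, ℓ (d w) = w := by
    have h1 : HasMFDerivAt 𝓘(ℂ, EY) 𝓘(ℂ, EX) (fun y => φ (r y)) (D.incl (φ.symm (φ z))) ℓ := by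
      rw [hzz]; exact hℓ
    have h2' := HasMFDerivAt.comp (φ z) h1 hd
    have h2 : HasFDerivAt (fun e => φ (r (D.incl (φ.symm e)))) (ℓ.comp d) (φ z) := h2'.hasFDerivAt
    have h3 : HasFDerivAt (fun e : EX => e) (ℓ.comp d) (φ z) := h2.congr_of_eventuallyEq (by
      have h4 : Tendsto φ.symm (𝓝 (φ z)) (𝓝 z) := by
        have := (φ.continuousAt_symm hzt).tendsto
        rwa [φ.left_inv hz] at this
      filter_upwards [h4.eventually hrz, φ.open_target.mem_nhds hzt] with e he het
      rw [he, φ.right_inv het])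
    intro w
    exact congrArg (fun T : EX →L[ℂ] EX => T w) (h3.unique (hasFDerivAt_id (φ z)))
  refine ⟨d, hd, Function.LeftInverse.injective hcomp, fun A hA => ?_⟩
  have hA' := D.dRho_mem_of_mem_lieU hA
  set γ : ℝ → Y := fun t => D.amb.actG (expGL (t • D.dRho A)) (D.incl z) with hγdef
  have hγ : HasMFDerivAt 𝓘(ℝ, ℝ) 𝓘(ℝ, EY) γ 0 (ContinuousLinearMap.smulRight (1 : ℝ →L[ℝ] ℝ)
      (D.amb.vel (D.dRho A) (D.incl z)) : ℝ →L[ℝ] EY) :=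
    D.amb.hasMFDerivAt_actG_zero hA' (D.incl z)
  have hγ0 : γ 0 = D.incl z := by simp only [hγdef, zero_smul, expGL_zero, D.amb.actG_one]
  -- the curve lies in `X`
  have hγX : ∀ t : ℝ, γ t = D.incl (D.expAct (t • A) z) := fun t => by
    have hm : t • A ∈ D.grp.lieU := (D.grp.lieU.restrictScalars ℝ).smul_mem t hA
    rw [D.incl_expAct hm, D.dRho_eq (D.grp.lieU_le hm), D.dRhoLin.map_smul_of_tower,
      ← D.dRho_eq (D.grp.lieU_le hA)]
  have hc : Tendsto (fun t : ℝ => D.expAct (t • A) z) (𝓝 0) (𝓝 z) := by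
    rw [D.incl_embedding.isEmbedding.tendsto_nhds_iff]
    have h1 := hγ.continuousAt.tendsto
    rw [hγ0] at h1
    exact h1.congr hγX
  have hℓr : HasMFDerivAt 𝓘(ℝ, EY) 𝓘(ℝ, EX) (fun y => φ (r y)) (γ 0)
      (ℓ.restrictScalars ℝ : EY →L[ℝ] EX) := by
    rw [hγ0]; exact hℓ.real_of_complex
  have h1 := HasMFDerivAt.comp (0 : ℝ) hℓr hγ
  have hdr : HasMFDerivAt 𝓘(ℝ, EX) 𝓘(ℝ, EY) (fun e => D.incl (φ.symm e)) (φ (r (γ 0)))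
      (d.restrictScalars ℝ : EX →L[ℝ] EY) := by
    rw [hγ0, hrz.self_of_nhds]
    exact hd.real_of_complex
  have h2 := HasMFDerivAt.comp (f := (fun y => φ (r y)) ∘ γ) (0 : ℝ) hdr h1
  have h3 := h2.congr_of_eventuallyEq (f₁ := γ) (by
    filter_upwards [hc.eventually hrz, hc (φ.open_source.mem_nhds hz)] with t ht hts
    simp only [Function.comp, hγX]
    rw [ht, φ.left_inv hts])
  have h4 := hasMFDerivAt_unique hγ h3
  refine ⟨ℓ (D.amb.vel (D.dRho A) (D.incl z)), ?_⟩
  have h5 := congrArg (fun T : ℝ →L[ℝ] EY => T 1) h4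
  have h6 : (1 : ℝ) • D.amb.vel (D.dRho A) (D.incl z) =
      d (ℓ ((1 : ℝ) • D.amb.vel (D.dRho A) (D.incl z))) := h5
  rw [one_smul] at h6
  exact h6.symm

/-- The zeros of the moment map of `U` below a level of the moment map of the circle. -/
def zerosBelow (c : ℝ) : Set X := {x | D.mom (D.incl x) = 0 ∧ D.height (D.incl x) < c}

theorem continuous_height : Continuous fun x => D.height (D.incl x) :=
  (D.amb.contMDiff_muK D.gen_mem).continuous.comp D.incl_embedding.isEmbedding.continuous

theorem continuous_mom : Continuous fun x => D.mom (D.incl x) :=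
  D.contMDiff_mom.continuous.comp D.incl_embedding.isEmbedding.continuous

/-- Near the minimum, the zero set of the moment map of `U` is a symplectic submanifold: the tangent
spaces at the minimum are complex, as they are the orthogonal complements of the complex tangent
spaces of the orbits of `U`. -/
theorem eventually_symplectic_zerosBelow [FiniteDimensional ℂ EX] [IsManifold 𝓘(ℂ, EX) ω X]
    [IsManifold 𝓘(ℂ, EY) ω Y] [T2Space Y] (hD : D.IsStable) {z : X} (hz : z ∈ D.base) :
    ∀ᶠ x in 𝓝 z, ∀ c, x ∈ D.zerosBelow c →
      (∃ φ ∈ IsManifold.maximalAtlas 𝓘(ℝ, EX) ∞ X, x ∈ φ.source ∧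
        ∃ V : Submodule ℝ EX, ∀ y ∈ φ.source, y ∈ D.zerosBelow c ↔ φ y ∈ V) ∧
      ∀ v ∈ tangentVectors EX (D.zerosBelow c) x, v ≠ 0 →
        ∃ w ∈ tangentVectors EX (D.zerosBelow c) x, D.formX x ![v, w] ≠ 0 := by
  have : FiniteDimensional ℝ EX := FiniteDimensional.complexToReal EX
  have : CompleteSpace EX := FiniteDimensional.complete ℝ EX
  have : IsManifold 𝓘(ℝ, EX) ω X := isManifold_real_of_complex EX X
  have : IsManifold 𝓘(ℝ, EX) ∞ X := IsManifold.of_le (n := ω) (by simp)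
  have : IsManifold 𝓘(ℝ, EY) ω Y := isManifold_real_of_complex EY Y
  obtain ⟨d, hd, hinj, hrange⟩ := D.exists_deriv_incl z
  set φ := chartAt EX z with hφ
  have hφm : φ ∈ IsManifold.maximalAtlas 𝓘(ℝ, EX) ∞ X := IsManifold.chart_mem_maximalAtlas z
  have hzs : z ∈ φ.source := mem_chart_source EX z
  have hzt : φ z ∈ φ.target := φ.map_source hzs
  obtain ⟨μ', hμ, hμ'⟩ := D.exists_hasMFDerivAt_mom (D.incl z)
  have hinclr : ContMDiff 𝓘(ℝ, EX) 𝓘(ℝ, EY) ω D.incl := fun x => (D.contMDiff_incl x).real_of_complex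
  set h : EX → D.ParamU := fun e => D.mom (D.incl (φ.symm e)) with hh
  have hsm : ContDiffOn ℝ ∞ h φ.target := by
    rw [← contMDiffOn_iff_contDiffOn]
    exact D.contMDiff_mom.comp_contMDiffOn ((hinclr.of_le (by simp)).comp_contMDiffOn
      (contMDiffOn_symm_of_mem_maximalAtlas hφm))
  set h' : EX →L[ℝ] D.ParamU := μ'.comp (d.restrictScalars ℝ) with hh'
  have hhd : HasFDerivAt h h' (φ z) := by
    have h1 : HasMFDerivAt 𝓘(ℝ, EY) 𝓘(ℝ, D.ParamU) D.mom (D.incl (φ.symm (φ z))) μ' := by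
      rw [φ.left_inv hzs]; exact hμ
    exact (HasMFDerivAt.comp (φ z) h1 hd.real_of_complex).hasFDerivAt
  have hsurj : Function.Surjective h' := by
    set T : D.ParamU →ₗ[ℝ] D.ParamU := μ'.toLinearMap.comp
      (((D.amb.velLin (D.incl z)).restrictScalars ℝ).comp D.paramRho) with hT
    have hTv : ∀ a, T a = μ' (D.amb.vel (D.paramRho a) (D.incl z)) := fun a => by
      rw [D.amb.vel_eq (D.paramRho_mem a)]; rfl
    have hTinj : Function.Injective T := by
      rw [injective_iff_map_eq_zero]
      intro a ha
      refine D.eq_zero_of_form_vel_eq_zero hD hz fun j => ?_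
      rw [← hμ', ← hTv, ha]; rfl
    intro b
    obtain ⟨a, rfl⟩ := (LinearMap.injective_iff_surjective.1 hTinj) b
    obtain ⟨w, hw⟩ := hrange _ (D.param_mem a)
    refine ⟨w, ?_⟩
    rw [hTv, D.paramRho_eq, ← hw]; rfl
  obtain ⟨R, hR⟩ := h'.toLinearMap.exists_rightInverse_of_surjective (LinearMap.range_eq_top.2 hsurj)
  obtain ⟨Ψ, hΨ, hΨs, hΨker, hΨd⟩ := exists_straightening φ.open_target hsm hzt hhd
    (LinearMap.toContinuousLinearMap R) fun w => congrArg (fun T : D.ParamU →ₗ[ℝ] D.ParamU => T w) hR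
  set V : Submodule ℝ EX := LinearMap.ker h'.toLinearMap with hV
  have hVI : ∀ w ∈ V, Complex.I • w ∈ V := fun w hw => by
    rw [hV, LinearMap.mem_ker] at hw ⊢
    have h1 : μ' (d w) = 0 := hw
    have h2 := fun A hA => D.form_vel_eq_zero hD hz (ξ := d w) (fun j => by
      rw [← hμ', h1]; rfl) (A := A) hA
    refine funext fun j => ?_
    change μ' (d (Complex.I • w)) j = 0
    rw [hμ', map_smul]
    have hb := D.basisU_mem j
    have h3 := h2 _ (D.grp.lieU.smul_mem Complex.I hb)
    rw [D.vel_I_smul _ hb, ← D.vel_skewPart hD hz hb, smul_comm] at h3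
    set η := D.amb.form (D.incl z)
    set b := D.amb.vel (D.skewBasis j) (D.incl z)
    have h4 : (2 : ℝ) • η ![Complex.I • b, d w] = 0 := by
      rw [← h3]
      exact (η.vecCons_smul ![d w] 2 (Complex.I • b)).symm
    have h5 : η ![Complex.I • b, d w] = 0 := by simpa using h4
    have h6 := D.amb.kahler.type_one_one (D.incl z) (Complex.I • b) (d w)
    rw [smul_smul, Complex.I_mul_I, h5] at h6
    have h7 := η.vecCons_smul ![Complex.I • d w] (-1) b
    have h8 : ((-1 : ℝ)) • b = (-1 : ℂ) • b := by simp
    rw [h8] at h7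
    have h9 : η ![(-1 : ℂ) • b, Complex.I • d w] = (-1 : ℝ) • η ![b, Complex.I • d w] := h7
    rw [h9] at h6
    simpa using h6
  -- the adapted chart
  set χ := φ ≫ₕ Ψ with hχ
  have hχm : χ ∈ IsManifold.maximalAtlas 𝓘(ℝ, EX) ∞ X := trans_mem_maximalAtlas hφm hΨ
  have hχz : z ∈ χ.source := by
    rw [hχ, OpenPartialHomeomorph.trans_source]
    exact ⟨hzs, hΨs⟩
  have hχV : ∀ y ∈ χ.source, D.mom (D.incl y) = 0 ↔ χ y ∈ V := fun y hy => by
    rw [hχ, OpenPartialHomeomorph.trans_source] at hy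
    have := hΨker (φ y) hy.2
    simp only [hh, φ.left_inv hy.1] at this
    exact this
  have hsymm : ∀ x ∈ χ.source, ContMDiffAt 𝓘(ℝ, EX) 𝓘(ℝ, EX) ∞ χ.symm (χ x) := fun x hx =>
    (contMDiffOn_symm_of_mem_maximalAtlas hχm).contMDiffAt
      (χ.open_target.mem_nhds (χ.map_source hx))
  set J : EX → Y := fun e => D.incl (χ.symm e) with hJ
  have hJz : ContMDiffAt 𝓘(ℝ, EX) 𝓘(ℝ, EY) ∞ J (χ z) :=
    ContMDiffAt.comp (χ z) ((hinclr _).of_le (by simp)) (hsymm z hχz)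
  have hJd : HasMFDerivAt 𝓘(ℝ, EX) 𝓘(ℝ, EY) J (χ z) (d.restrictScalars ℝ : EX →L[ℝ] EY) := by
    have h1 : HasMFDerivAt 𝓘(ℝ, EX) 𝓘(ℝ, EY) (fun e => D.incl (φ.symm e)) (Ψ.symm (Ψ (φ z)))
        (d.restrictScalars ℝ : EX →L[ℝ] EY) := by
      rw [Ψ.left_inv hΨs]; exact hd.real_of_complex
    have h2 := HasMFDerivAt.comp (Ψ (φ z)) h1 hΨd.hasMFDerivAt
    exact h2
  have hpos := D.amb.kahler.eventually_pos hJz hJd hinj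
  filter_upwards [χ.open_source.mem_nhds hχz, (χ.continuousAt hχz).eventually hpos] with
    x hx hxpos c hxc
  -- the adapted chart, restricted to the points below the level
  have hopen : IsOpen {y | D.height (D.incl y) < c} := isOpen_Iio.preimage D.continuous_height
  set χ' := χ.restr {y | D.height (D.incl y) < c} with hχ'
  have hχ'm : χ' ∈ IsManifold.maximalAtlas 𝓘(ℝ, EX) ∞ X := by
    rw [IsManifold.mem_maximalAtlas_iff] at hχm ⊢
    exact restr_mem_maximalAtlas _ hχm hopen
  have hsrc : χ'.source = χ.source ∩ {y | D.height (D.incl y) < c} := by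
    rw [hχ', OpenPartialHomeomorph.restr_source, hopen.interior_eq]
  have hx' : x ∈ χ'.source := by
    rw [hsrc]; exact ⟨hx, hxc.2⟩
  have hχ'V : ∀ y ∈ χ'.source, y ∈ D.zerosBelow c ↔ χ' y ∈ V := fun y hy => by
    rw [hsrc] at hy
    exact (and_iff_left hy.2).trans (hχV y hy.1)
  refine ⟨⟨χ', hχ'm, hx', V, hχ'V⟩, fun v hv hv0 => ?_⟩
  obtain ⟨L, hL⟩ : ∃ L : EX →L[ℝ] EX, HasMFDerivAt 𝓘(ℝ, EX) 𝓘(ℝ, EX) χ.symm (χ x) L :=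
    ⟨_, ((hsymm x hx).mdifferentiableAt (by simp)).hasMFDerivAt⟩
  have htan := mem_tangentVectors_iff hχ'm V.closed_of_finiteDimensional hχ'V hx' hxc hL
  obtain ⟨w, hw, rfl⟩ := (htan v).1 hv
  have hw0 : w ≠ 0 := by
    rintro rfl
    exact hv0 (map_zero L)
  refine ⟨L (Complex.I • w), (htan _).2 ⟨_, hVI w hw, rfl⟩, ?_⟩
  obtain ⟨ι, hι⟩ : ∃ ι : EX →L[ℝ] EY, HasMFDerivAt 𝓘(ℝ, EX) 𝓘(ℝ, EY) D.incl x ι :=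
    ⟨_, ((hinclr x).mdifferentiableAt (by simp)).hasMFDerivAt⟩
  have hι' : HasMFDerivAt 𝓘(ℝ, EX) 𝓘(ℝ, EY) D.incl (χ.symm (χ x)) ι := by
    rw [χ.left_inv hx]; exact hι
  have h1 := hxpos _ (HasMFDerivAt.comp (χ x) hι' hL) w hw0
  have h2 : J (χ x) = D.incl x := by
    simp only [hJ, χ.left_inv hx]
  have h3 : (realDeriv D.incl x : EX →L[ℝ] EY) = ι := hι.mfderiv
  rw [h2] at h1
  have h4 : D.formX x ![L w, L (Complex.I • w)] =
      D.amb.form (D.incl x) ![ι (L w), ι (L (Complex.I • w))] := by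
    rw [formX, h3, ContinuousAlternatingMap.compContinuousLinearMap_apply]
    congr 1
    funext i
    fin_cases i <;> rfl
  have h5 : D.amb.form (D.incl x) ![ι (L (Complex.I • w)), ι (L w)] =
      -D.amb.form (D.incl x) ![ι (L w), ι (L (Complex.I • w))] := by
    have := (D.amb.form (D.incl x)).map_swap ![ι (L w), ι (L (Complex.I • w))]
      (show (0 : Fin 2) ≠ 1 by simp)
    refine Eq.trans ?_ this
    refine congrArg (D.amb.form (D.incl x)) (funext fun i => ?_)
    fin_cases i <;> simp
  rw [h4]
  have h6 : 0 < D.amb.form (D.incl x) ![ι (L (Complex.I • w)), ι (L w)] := h1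
  rw [h5] at h6
  exact (neg_pos.1 h6).ne

end HamiltonianHAction

end ZeroSet

/-! ### The slice -/

section Slice

namespace HamiltonianHAction

variable {n m : ℕ}
  {EY : Type*} [NormedAddCommGroup EY] [NormedSpace ℂ EY]
  {Y : Type*} [TopologicalSpace Y] [ChartedSpace EY Y]
  {EX : Type*} [NormedAddCommGroup EX] [NormedSpace ℂ EX]
  {X : Type*} [TopologicalSpace X] [ChartedSpace EX X]
  (D : HamiltonianHAction n m EY Y EX X)

theorem mem_base_of_height_le {w : ℝ} (hw : IsLeast (range fun x => D.height (D.incl x)) w) {x : X}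
    (hx : D.height (D.incl x) ≤ w) : x ∈ D.base := fun x' => hx.trans (hw.2 ⟨x', rfl⟩)

theorem isClosed_base : IsClosed D.base := by
  simp only [base, ofPred_forall]
  exact isClosed_iInter fun x' => isClosed_le D.continuous_height continuous_const

/-- A property which holds near the minimum holds below some level. -/
theorem exists_level [CompactSpace X] {w : ℝ}
    (hw : IsLeast (range fun x => D.height (D.incl x)) w) {P : X → Prop}
    (hP : ∀ z ∈ D.base, ∀ᶠ x in 𝓝 z, P x) :
    ∃ η > 0, ∀ x, D.height (D.incl x) < w + η → P x := by
  set N : Set X := {x | ∀ᶠ y in 𝓝 x, P y}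
  have hN : IsOpen N := isOpen_setOfPred_eventually_nhds
  rcases Nᶜ.eq_empty_or_nonempty with he | hne
  · refine ⟨1, one_pos, fun x _ => ?_⟩
    have hx : x ∈ N := by
      rw [compl_empty_iff] at he
      rw [he]; trivial
    exact Eventually.self_of_nhds (p := P) hx
  · obtain ⟨x₁, hx₁, hmin⟩ :=
      hN.isClosed_compl.isCompact.exists_isMinOn hne D.continuous_height.continuousOn
    refine ⟨D.height (D.incl x₁) - w, ?_, fun x hx => ?_⟩
    · refine sub_pos.2 (not_le.1 fun hle => hx₁ ?_)
      exact hP x₁ (D.mem_base_of_height_le hw hle)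
    · by_contra hn
      have hxN : x ∈ Nᶜ := fun h => hn (Eventually.self_of_nhds (p := P) h)
      have := isMinOn_iff.1 hmin x hxN
      linarith

theorem act_expAct (h : D.grp.H) {A : CMat n} (hA : A ∈ D.grp.lieU) (x : X) :
    D.act h (D.expAct A x) =
      D.expAct ((h : CGL n) * A * ((h : CGL n)⁻¹ : CGL n)) (D.act h x) := by
  have hm := D.grp.U_unipotent.le (D.grp.expGL_mem_U hA)
  have hm' := D.grp.U_unipotent.le (D.grp.expGL_mem_U (D.grp.conj_mem_lieU hA h.2))
  have e : h * toSub D.grp.H (expGL A) =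
      toSub D.grp.H (expGL ((h : CGL n) * A * ((h : CGL n)⁻¹ : CGL n))) * h := by
    refine Subtype.ext ?_
    rw [Subgroup.coe_mul, Subgroup.coe_mul, toSub_coe hm, toSub_coe hm', expGL_conj,
      inv_mul_cancel_right]
  rw [expAct, expAct, ← Equiv.Perm.mul_apply, ← map_mul, e, map_mul, Equiv.Perm.mul_apply]

theorem act_lam_expAct (t : ℂˣ) {A : CMat n} (hA : A ∈ D.grp.lieU) (x : X) :
    D.act (D.grp.lam t) (D.expAct A x) = D.expAct (D.grp.adLam t A) (D.act (D.grp.lam t) x) :=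
  D.act_expAct _ hA x

theorem act_lam_eq_of_mem_base [IsManifold 𝓘(ℂ, EY) ω Y] {z : X} (hz : z ∈ D.base) (t : ℂˣ) :
    D.act (D.grp.lam t) z = z := by
  refine D.incl_embedding.isEmbedding.injective ?_
  rw [D.act_incl, D.act_lam_of_mem_base hz]

/-- The orbits of `U` meet the minimum at most once, as `lam t` for `t → 0` contracts them and
fixes the minimum. -/
theorem eq_zero_of_expAct_mem_base [IsManifold 𝓘(ℂ, EY) ω Y] [T2Space Y] (hD : D.IsStable) {z : X}
    (hz : z ∈ D.base) {A : CMat n} (hA : A ∈ D.grp.lieU) (hAz : D.expAct A z ∈ D.base) : A = 0 := by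
  refine D.eq_zero_of_expAct_eq hD hz hA (D.incl_embedding.isEmbedding.injective ?_)
  have h1 := D.amb.tendsto_actG_expGL (D.tendsto_dRho_adLam hA)
    (fun s => D.dRho_mem_of_mem_lieU (D.grp.adLam_mem_lieU hA _)) (D.incl z)
  refine tendsto_nhds_unique (tendsto_const_nhds.congr fun s : ℝ => ?_) h1
  rw [← D.incl_expAct (D.grp.adLam_mem_lieU hA _)]
  conv_rhs => rw [← D.act_lam_eq_of_mem_base hz (expUnit s)]
  rw [← D.act_lam_expAct _ hA, D.act_lam_eq_of_mem_base hAz]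

theorem height_act_lam_le {s : ℝ} (hs : s ≤ 0) (x : X) :
    D.height (D.incl (D.act (D.grp.lam (expUnit s)) x)) ≤ D.height (D.incl x) := by
  have h1 := D.monotone_height (D.incl x) hs
  have h2 : expUnit ((0 : ℝ) : ℂ) = 1 := by simp [expUnit_zero]
  simp only [h2, map_one, Equiv.Perm.one_apply] at h1
  rwa [D.act_incl]

theorem exists_coordinates : ∃ ν : CMat n →ₗ[ℝ] D.ParamU, Continuous ν ∧ ∀ a, ν (D.param a) = a := by
  obtain ⟨ν, hν⟩ := D.param.exists_leftInverse_of_injective (LinearMap.ker_eq_bot.2 D.param_injective)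
  have : FiniteDimensional ℝ (CMat n) := inferInstanceAs (FiniteDimensional ℝ (Fin n → Fin n → ℂ))
  exact ⟨ν, ν.continuous_of_finiteDimensional, fun a =>
    congrArg (fun T : D.ParamU →ₗ[ℝ] D.ParamU => T a) hν⟩

/-- Elements of `U` which move a point close to the minimum to a point close to the minimum are
small: for elements of a fixed size this holds by compactness, and larger elements are reduced to
this size by `lam t` for `t < 1`, which does not increase the moment map of the circle. -/
theorem exists_level_norm_lt [IsManifold 𝓘(ℂ, EY) ω Y] [T2Space Y] [CompactSpace X]
    (hD : D.IsStable) {w : ℝ} (hw : IsLeast (range fun x => D.height (D.incl x)) w) {r : ℝ}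
    (hr : 0 < r) : ∃ η > 0, ∀ (x : X) (a : D.ParamU), D.height (D.incl x) < w + η →
      D.height (D.incl (D.expAct (D.param a) x)) < w + η → ‖a‖ < r := by
  set f : D.ParamU × X → ℝ := fun p =>
    max (D.height (D.incl p.2)) (D.height (D.incl (D.expAct (D.param p.1) p.2))) with hf
  have hfc : Continuous f := (D.continuous_height.comp continuous_snd).max
    (D.continuous_height.comp D.continuous_expAct_param)
  have hsphere : ∃ η > 0, ∀ p ∈ Metric.sphere (0 : D.ParamU) r ×ˢ (univ : Set X), w + η ≤ f p := by
    rcases (Metric.sphere (0 : D.ParamU) r ×ˢ (univ : Set X)).eq_empty_or_nonempty with he | hne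
    · exact ⟨1, one_pos, fun p hp => by rw [he] at hp; exact hp.elim⟩
    · obtain ⟨p, hp, hmin⟩ := ((isCompact_sphere (0 : D.ParamU) r).prod
        isCompact_univ).exists_isMinOn hne hfc.continuousOn
      refine ⟨f p - w, ?_, fun q hq => ?_⟩
      · refine sub_pos.2 (not_le.1 fun hle => ?_)
        have h0 := D.eq_zero_of_expAct_mem_base hD
          (D.mem_base_of_height_le hw ((le_max_left _ _).trans hle)) (D.param_mem p.1)
          (D.mem_base_of_height_le hw ((le_max_right _ _).trans hle))
        have h1 : p.1 = 0 := D.param_injective (by rw [h0, map_zero])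
        have h2 : ‖p.1‖ = r := by simpa using hp.1
        rw [h1, norm_zero] at h2
        exact hr.ne h2
      · have := isMinOn_iff.1 hmin q hq
        linarith
  obtain ⟨η, hη, hηf⟩ := hsphere
  refine ⟨η, hη, fun x a hx hax => ?_⟩
  by_contra hlt
  obtain ⟨ν, hνc, hν⟩ := D.exists_coordinates
  have hA := D.param_mem a
  set b : ℝ → D.ParamU := fun s => ν (D.grp.adLam (expUnit s) (D.param a)) with hb
  have hbp : ∀ s, D.param (b s) = D.grp.adLam (expUnit s) (D.param a) := fun s => by
    obtain ⟨b', hb'⟩ := D.exists_param_eq (D.grp.adLam_mem_lieU hA (expUnit s))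
    simp only [hb, ← hb', hν]
  have hbc : Continuous fun s => ‖b s‖ := (hνc.comp (D.grp.continuous_adLam hA)).norm
  have hb0 : b 0 = a := D.param_injective (by
    rw [hbp]
    simp [InternallyGradedGroup.adLam, expUnit_zero])
  have hbt : Tendsto (fun s => ‖b s‖) atBot (𝓝 0) := by
    have h1 := ((hνc.tendsto 0).comp (D.grp.tendsto_adLam_atBot hA)).norm
    rw [map_zero, norm_zero] at h1
    exact h1
  obtain ⟨s₀, hs₀, hs₀r⟩ := ((eventually_le_atBot (0 : ℝ)).and
    (hbt.eventually (eventually_lt_nhds hr))).exists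
  obtain ⟨s, hs, hsr⟩ := intermediate_value_Icc hs₀ hbc.continuousOn
    ⟨hs₀r.le, by simpa only [hb0] using not_lt.1 hlt⟩
  have h1 := hηf (b s, D.act (D.grp.lam (expUnit s)) x) ⟨by simpa using hsr, mem_univ _⟩
  refine absurd h1 (not_le.2 (max_lt ((D.height_act_lam_le hs.2 x).trans_lt hx) ?_))
  simp only [hbp, ← D.act_lam_expAct _ hA]
  exact (D.height_act_lam_le hs.2 _).trans_lt hax

theorem exists_param_act {u : D.grp.H} (hu : (u : CGL n) ∈ D.grp.U) :
    ∃ a, (∀ x, D.act u x = D.expAct (D.param a) x) ∧ (a = 0 → u = 1) := by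
  obtain ⟨A, hA, hAu⟩ := D.grp.exists_expGL_eq hu
  obtain ⟨a, rfl⟩ := D.exists_param_eq hA
  refine ⟨a, fun x => ?_, fun ha => ?_⟩
  · rw [expAct, hAu, toSub_coe_self]
  · rw [ha, map_zero, expGL_zero] at hAu
    exact Subtype.ext hAu.symm

/-- Close to the minimum, the zeros of the moment map of `U` form a slice. -/
theorem exists_level_free [FiniteDimensional ℂ EX] [IsManifold 𝓘(ℂ, EX) ω X]
    [IsManifold 𝓘(ℂ, EY) ω Y] [T2Space Y] [CompactSpace X] (hD : D.IsStable) {w : ℝ}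
    (hw : IsLeast (range fun x => D.height (D.incl x)) w) :
    ∃ η > 0, ∀ u : D.grp.H, (u : CGL n) ∈ D.grp.U → ∀ x ∈ D.zerosBelow (w + η),
      D.act u x ∈ D.zerosBelow (w + η) → u = 1 := by
  set Q : ℝ → X → Prop := fun r x => ∀ a : D.ParamU, ‖a‖ < r → D.mom (D.incl x) = 0 →
    D.mom (D.incl (D.expAct (D.param a) x)) = 0 → a = 0 with hQ
  obtain ⟨r, hr, hrQ⟩ : ∃ r > 0, ∀ z ∈ D.base, ∀ᶠ x in 𝓝 z, Q r x := by
    refine D.isClosed_base.isCompact.induction_on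
      (p := fun s => ∃ r > 0, ∀ z ∈ s, ∀ᶠ x in 𝓝 z, Q r x) ⟨1, one_pos, fun z hz => hz.elim⟩
      (fun s t hst ⟨r, hr, h⟩ => ⟨r, hr, fun z hz => h z (hst hz)⟩) ?_ ?_
    · rintro s t ⟨r, hr, h⟩ ⟨r', hr', h'⟩
      refine ⟨min r r', lt_min hr hr', fun z hz => ?_⟩
      rcases hz with hz | hz
      · filter_upwards [h z hz] with x hx a ha
        exact hx a (ha.trans_le (min_le_left _ _))
      · filter_upwards [h' z hz] with x hx a ha
        exact hx a (ha.trans_le (min_le_right _ _))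
    · intro z hz
      obtain ⟨r, hr, h⟩ := D.exists_locally_free hD hz
      exact ⟨{x | ∀ᶠ y in 𝓝 x, Q r y}, mem_nhdsWithin_of_mem_nhds (eventually_eventually_nhds.2 h),
        r, hr, fun y hy => hy⟩
  obtain ⟨η₁, hη₁, h1⟩ := D.exists_level hw hrQ
  obtain ⟨η₂, hη₂, h2⟩ := D.exists_level_norm_lt hD hw hr
  refine ⟨min η₁ η₂, lt_min hη₁ hη₂, fun u hu x hx hux => ?_⟩
  obtain ⟨a, ha, hau⟩ := D.exists_param_act hu
  rw [ha] at hux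
  have l1 : w + min η₁ η₂ ≤ w + η₁ := by gcongr; exact min_le_left _ _
  have l2 : w + min η₁ η₂ ≤ w + η₂ := by gcongr; exact min_le_right _ _
  exact hau (h1 x (hx.2.trans_le l1) a
    (h2 x a (hx.2.trans_le l2) (hux.2.trans_le l2)) hx.1 hux.1)

/-- The sweep of an open part of the zero set is open. -/
theorem isOpen_sweep_inter {c : ℝ}
    (hc : ∀ x ∈ D.zerosBelow c, ∀ O ∈ 𝓝 x, ∀ᶠ x' in 𝓝 x, ∃ a : D.ParamU,
      D.expAct (D.param a) x' ∈ O ∧ D.mom (D.incl (D.expAct (D.param a) x')) = 0)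
    {O : Set X} (hO : IsOpen O) : IsOpen (D.sweep (D.zerosBelow c ∩ O)) := by
  have hcont : ∀ u : D.grp.H, Continuous (D.act u) := fun u => by
    rw [D.incl_embedding.isEmbedding.continuous_iff]
    have h1 : D.incl ∘ D.act u = fun x => D.amb.act (D.rho u) (D.incl x) :=
      funext fun x => D.act_incl u x
    rw [h1]
    exact D.amb.continuous_act.comp
      (continuous_const.prodMk D.incl_embedding.isEmbedding.continuous)
  rw [isOpen_iff_mem_nhds]
  rintro _ ⟨u, hu, x, ⟨hx, hxO⟩, rfl⟩
  have hinv : Tendsto (D.act u⁻¹) (𝓝 (D.act u x)) (𝓝 x) := by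
    have h1 := (hcont u⁻¹).tendsto (D.act u x)
    rwa [← Equiv.Perm.mul_apply, ← map_mul, inv_mul_cancel, map_one, Equiv.Perm.one_apply] at h1
  have hO' : O ∩ {y | D.height (D.incl y) < c} ∈ 𝓝 x :=
    (hO.inter (isOpen_Iio.preimage D.continuous_height)).mem_nhds ⟨hxO, hx.2⟩
  filter_upwards [hinv.eventually (hc x hx _ hO')] with y hy
  obtain ⟨a, ha, ha0⟩ := hy
  set v : D.grp.H := toSub D.grp.H (expGL (D.param a))
  have hv : (v : CGL n) ∈ D.grp.U := by
    have h1 := D.grp.expGL_mem_U (D.param_mem a)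
    rw [toSub_coe (D.grp.U_unipotent.le h1)]
    exact h1
  refine ⟨(v * u⁻¹)⁻¹, D.grp.U.inv_mem (D.grp.U.mul_mem hv (D.grp.U.inv_mem hu)),
    D.act (v * u⁻¹) y, ?_, ?_⟩
  · rw [map_mul, Equiv.Perm.mul_apply]
    exact ⟨⟨ha0, ha.2⟩, ha.1⟩
  · rw [← Equiv.Perm.mul_apply, ← map_mul, inv_mul_cancel, map_one, Equiv.Perm.one_apply]

/-- Invariance under `Q`, from the equivariance of the moment map. -/
theorem act_mem_zerosBelow {q : D.grp.H} (hq : (q : CGL n) ∈ D.grp.Q) {c : ℝ} {x : X}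
    (hx : x ∈ D.zerosBelow c) : D.act q x ∈ D.zerosBelow c := by
  have hK := D.rho_Q q hq
  refine ⟨?_, ?_⟩
  · rw [D.mom_eq_zero_iff]
    intro A hA
    set B : CMat n := ((q⁻¹ : D.grp.H) : CGL n) * A * (((q⁻¹ : D.grp.H) : CGL n)⁻¹ : CGL n)
    have hB : B ∈ D.grp.lieU := D.grp.conj_mem_lieU hA (q⁻¹).2
    have hAB : A = (q : CGL n) * B * ((q : CGL n)⁻¹ : CGL n) := by
      simp [B, Matrix.mul_assoc]
    rw [hAB, D.dRho_conj (D.grp.lieU_le hB), skewPart_conj (D.amb.complexification.unitary _ hK),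
      D.act_incl, D.amb.muK_conj (D.amb.complexification.skewPart_mem
        (D.dRho_mem_of_mem_lieU hB)) hK]
    exact (D.mom_eq_zero_iff _).1 hx.1 B hB
  · have h1 := D.amb.muK_conj D.gen_mem hK (D.incl x)
    rw [D.rho_commute_gen hq] at h1
    rw [D.act_incl, height, h1]
    exact hx.2

/-- The zeros below `c` are closed in their sweep: a limit point in the sweep is a zero of height at
most `c` in the orbit of a zero below `c`, and equals it by freeness below a larger level. -/
theorem isClosed_zerosBelow {c c' : ℝ} (hcc' : c < c')
    (hfree : ∀ u : D.grp.H, (u : CGL n) ∈ D.grp.U → ∀ x ∈ D.zerosBelow c',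
      D.act u x ∈ D.zerosBelow c' → u = 1) :
    IsClosed ((↑) ⁻¹' D.zerosBelow c : Set (D.sweep (D.zerosBelow c))) := by
  have h : ((↑) ⁻¹' D.zerosBelow c : Set (D.sweep (D.zerosBelow c))) =
      (↑) ⁻¹' {x : X | D.mom (D.incl x) = 0 ∧ D.height (D.incl x) ≤ c} := by
    ext ⟨y, u, hu, x, hx, rfl⟩
    refine ⟨fun h => ⟨h.1, h.2.le⟩, fun h => ?_⟩
    have h1 := hfree u hu x ⟨hx.1, hx.2.trans hcc'⟩ ⟨h.1, h.2.trans_lt hcc'⟩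
    subst h1
    simpa using hx
  rw [h]
  refine IsClosed.preimage continuous_subtype_val ?_
  exact (isClosed_eq D.continuous_mom continuous_const).inter
    (isClosed_le D.continuous_height continuous_const)

/-- A slice whose relatively open parts have open sweeps represents the orbit space of its sweep. -/
theorem isHomeomorph_sliceToQuotient {S : Set X}
    (hfree : ∀ u : D.grp.H, (u : CGL n) ∈ D.grp.U → ∀ x ∈ S, D.act u x ∈ S → u = 1)
    (hopen : ∀ O : Set X, IsOpen O → IsOpen (D.sweep (S ∩ O))) :
    IsHomeomorph (D.sliceToQuotient S) := by
  refine ⟨?_, ?_, ?_, ?_⟩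
  · exact continuous_quotient_mk'.comp (continuous_subtype_val.subtype_mk _)
  · rintro _ ⟨O, hO, rfl⟩
    have hq : Topology.IsQuotientMap (Quotient.mk (D.orbitSetoid (D.sweep S))) :=
      isQuotientMap_quot_mk
    rw [← hq.isOpen_preimage]
    have h : Quotient.mk (D.orbitSetoid (D.sweep S)) ⁻¹' (D.sliceToQuotient S '' (Subtype.val ⁻¹' O)) =
        (Subtype.val ⁻¹' D.sweep (S ∩ O) : Set (D.sweep S)) := by
      ext y
      constructor
      · rintro ⟨x, hx, hxy⟩
        obtain ⟨u, hu, hux⟩ := Quotient.exact hxy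
        exact ⟨u, hu, x, ⟨x.2, hx⟩, hux⟩
      · rintro ⟨u, hu, x, ⟨hxS, hxO⟩, hux⟩
        exact ⟨⟨x, hxS⟩, hxO, Quotient.sound ⟨u, hu, hux⟩⟩
    rw [h]
    exact (hopen O hO).preimage continuous_subtype_val
  · intro x y hxy
    obtain ⟨u, hu, hux⟩ := Quotient.exact hxy
    have hux' : D.act u x = y := hux
    have h1 := hfree u hu x x.2 (by rw [hux']; exact y.2)
    subst h1
    refine Subtype.ext ?_
    rw [← hux', map_one, Equiv.Perm.one_apply]
  · intro p
    obtain ⟨⟨y, u, hu, x, hx, hux⟩, rfl⟩ := Quotient.exists_rep p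
    exact ⟨⟨x, hx⟩, Quotient.sound ⟨u, hu, hux⟩⟩

/-- The character is trivial on `U`, and the imaginary part of `μ_U (A)` is the real part of
`μ_U (-i A)`. -/
theorem muUZero_eq {χ : D.grp.H →* ℂˣ} (hχ : IsRegularFun fun h => (χ h : ℂ)) (c : ℝ) :
    D.muUZero χ c = {x | D.mom (D.incl x) = 0} := by
  have hmu : ∀ x, ∀ A ∈ D.grp.lieU, D.muH χ c x A =
      D.amb.muK (D.incl x) (skewPart (D.dRho A)) +
        Complex.I * D.amb.muK (D.incl x) (skewPart (D.dRho (-Complex.I • A))) := fun x A hA => by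
    have h1 : D.dRho (-Complex.I • A) = -Complex.I • D.dRho A := by
      rw [D.dRho_eq (D.grp.lieU_le (D.grp.lieU.smul_mem _ hA)), map_smul,
        ← D.dRho_eq (D.grp.lieU_le hA)]
    rw [muH, muHY, D.dChar_eq_zero hχ hA, mul_zero, add_zero, h1]
    rfl
  ext x
  simp only [mem_ofPred_eq, D.mom_eq_zero_iff]
  constructor
  · intro h A hA
    have h1 := congrArg Complex.re ((hmu x A hA).symm.trans (h A hA))
    simpa using h1
  · intro h A hA
    rw [hmu x A hA, h A hA, h _ (D.grp.lieU.smul_mem _ hA)]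
    simp

end HamiltonianHAction

end Slice
theorem mainTheorem7 {n m : ℕ}
    {EY : Type*} [NormedAddCommGroup EY] [NormedSpace ℂ EY] [FiniteDimensional ℂ EY]
    {Y : Type*} [TopologicalSpace Y] [T2Space Y] [SecondCountableTopology Y]
    [ChartedSpace EY Y] [IsManifold 𝓘(ℂ, EY) ω Y]
    {EX : Type*} [NormedAddCommGroup EX] [NormedSpace ℂ EX] [FiniteDimensional ℂ EX]
    {X : Type*} [TopologicalSpace X] [T2Space X] [CompactSpace X] [ConnectedSpace X]
    [ChartedSpace EX X] [IsManifold 𝓘(ℂ, EX) ω X]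
    (D : HamiltonianHAction n m EY Y EX X) :
    ∃ ε : ℝ, 0 < ε ∧ ∀ (χ : D.grp.H →* ℂˣ) (c : ℝ),
      IsRegularFun (fun h => (χ h : ℂ)) →
      D.IsWellAdapted χ c ε → D.SemistableEqStable χ c →
      ∃ δ : ℝ, 0 < δ ∧
        -- the slice is a `Q`-invariant symplectic submanifold of `X`
        (IsSymplecticSubmanifold D.formX (D.slice χ c δ) ∧
          ∀ q : D.grp.H, (q : CGL n) ∈ D.grp.Q → ∀ x ∈ D.slice χ c δ,
            D.act q x ∈ D.slice χ c δ) ∧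
        -- its sweep is open and contains it as a closed submanifold
        (IsOpen (D.sweep (D.slice χ c δ)) ∧
          D.slice χ c δ ⊆ D.sweep (D.slice χ c δ) ∧
          IsClosed ((↑) ⁻¹' D.slice χ c δ : Set (D.sweep (D.slice χ c δ))) ∧
          IsEmbeddedSubmanifold EX (D.slice χ c δ)) ∧
        -- it is a slice for the action of `U`
        (∀ u : D.grp.H, (u : CGL n) ∈ D.grp.U → ∀ x ∈ D.slice χ c δ,
          D.act u x ∈ D.slice χ c δ → u = 1) ∧
        -- the inclusion induces a homeomorphism onto the orbit space
        IsHomeomorph (D.sliceToQuotient (D.slice χ c δ)) := by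
  obtain ⟨_, ⟨z₀, rfl⟩, hw⟩ : ∃ w, IsLeast (range fun x => D.height (D.incl x)) w := by
    obtain ⟨z, hz⟩ := isCompact_univ.exists_isMinOn univ_nonempty D.continuous_height.continuousOn
    exact ⟨_, ⟨z, rfl⟩, by rintro _ ⟨x, rfl⟩; exact isMinOn_iff.1 hz.2 x (mem_univ x)⟩
  set w := D.height (D.incl z₀)
  have hw' : IsLeast (range fun x => D.height (D.incl x)) w := ⟨⟨z₀, rfl⟩, hw⟩
  -- stability does not depend on the character; without it, there is nothing to prove
  by_cases hD : D.IsStable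
  swap
  · exact ⟨1, one_pos, fun χ c _ _ h => (hD (D.isStable_of_semistableEqStableU h.1)).elim⟩
  obtain ⟨η₁, hη₁, hfree'⟩ := D.exists_level_free hD hw'
  obtain ⟨η₂, hη₂, hlocal⟩ := D.exists_level hw' fun z hz =>
    (D.eventually_locally_transversal hD hz).and (D.eventually_symplectic_zerosBelow hD hz)
  set η := min η₁ η₂ with hη
  have hη0 : 0 < η := lt_min hη₁ hη₂
  -- with `ε = δ = η / 3`, the slice reaches at most the height `2 η / 3` above the minimum
  refine ⟨η / 3, by linarith, fun χ c hχ hwa _ => ⟨η / 3, by linarith, ?_⟩⟩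
  obtain ⟨C, hC⟩ := D.exists_muLamY_eq χ c
  obtain ⟨w₁, ⟨⟨x₁, hx₁⟩, hmin₁⟩, -, hε⟩ := hwa
  have hw₁ : w₁ ≤ w + C := (hmin₁ ⟨z₀, rfl⟩).trans (hC _).le
  -- the level of the slice, in terms of the moment map without the constant of the character
  set c₀ := η / 3 - C with hc₀
  have hslice : D.slice χ c (η / 3) = D.zerosBelow c₀ := by
    rw [HamiltonianHAction.slice, D.muUZero_eq hχ]
    ext x
    simp only [HamiltonianHAction.muLam, hC, HamiltonianHAction.zerosBelow, mem_inter_iff,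
      mem_ofPred_eq, hc₀, lt_sub_iff_add_lt]
  have hlt₁ : c₀ < w + η₁ := by
    have := min_le_left η₁ η₂
    linarith
  have hle₂ : c₀ ≤ w + η₂ := by
    have := min_le_right η₁ η₂
    linarith
  rw [hslice]
  have hfree : ∀ u : D.grp.H, (u : CGL n) ∈ D.grp.U → ∀ x ∈ D.zerosBelow c₀,
      D.act u x ∈ D.zerosBelow c₀ → u = 1 := fun u hu x hx hux =>
    hfree' u hu x ⟨hx.1, hx.2.trans hlt₁⟩ ⟨hux.1, hux.2.trans hlt₁⟩
  have hl := fun x (hx : x ∈ D.zerosBelow c₀) => hlocal x (hx.2.trans_le hle₂)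
  have hopen : ∀ O : Set X, IsOpen O → IsOpen (D.sweep (D.zerosBelow c₀ ∩ O)) := fun O hO =>
    D.isOpen_sweep_inter (fun x hx => (hl x hx).1 hx.1) hO
  have hemb : IsEmbeddedSubmanifold EX (D.zerosBelow c₀) := fun x hx => ((hl x hx).2 c₀ hx).1
  refine ⟨⟨⟨hemb, fun x hx => ((hl x hx).2 c₀ hx).2⟩, fun q hq x hx => D.act_mem_zerosBelow hq hx⟩,
    ⟨?_, D.subset_sweep _, D.isClosed_zerosBelow hlt₁ hfree', hemb⟩, hfree,
    D.isHomeomorph_sliceToQuotient hfree hopen⟩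
  simpa using hopen univ isOpen_univ
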